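/- Let $k>2$ and $D\ge 2k+1$. Brackets $[\cdots]$ denote antisymmetrization: the signed sum over the distinct terms only, without normalization. A tensor has mixed symmetry $(k,j)$, $j\le k$, if it is antisymmetric in its first $k$ and in its last $j$ indices and satisfies $X_{[\mu_1\cdots\mu_k|\nu_1]\nu_2\cdots\nu_j}=0$ (no condition for $j=0$). Let $\mathcal A$ be the graded-commutative real algebra of polynomials in the $dx^\rho$ ($0\le\rho\le D-1$) and in the components, and all their formal spacetime derivatives, of: a field $t_{\mu_1\cdots\mu_k|\nu_1\cdots\nu_k}$ of mixed symmetry $(k,k)$, symmetric under exchange of the two index blocks; ghosts $\eta^{(m)}_{\mu_1\cdots\mu_k|\nu_1\cdots\nu_{k-m-1}}$, $0\le m\le k-1$, of mixed symmetry $(k,k-m-1)$; and antifields $t^*$, $\eta^{*(m)}$ with the same symmetries as $t$, $\eta^{(m)}$. The only relations are these symmetries and graded commutativity. The Grassmann parities of $t,\eta^{(m)},t^*,\eta^{*(m)},dx^\rho$ are $0,\,m+1,\,1,\,m,\,1$ modulo $2$. The pure ghost number is $m+1$ on $\eta^{(m)}$ and $0$ on the other generators; the antighost number is $1$ on $t^*$,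 $m+2$ on $\eta^{*(m)}$ and $0$ on the other generators; the form degree is $1$ on $dx^\rho$ and $0$ on the other generators; derivatives do not change these degrees. The exterior longitudinal derivative $\gamma$ is the odd right derivation of $\mathcal A$ that commutes with all $\partial_\rho$, vanishes on the antifields, the $dx^\rho$ and $\eta^{(k-1)}$, and satisfies $$\gamma t_{\mu_1\cdots\mu_k|\nu_1\cdots\nu_k}=\eta^{(0)}_{\mu_1\cdots\mu_k|[\nu_2\cdots\nu_k,\nu_1]}+\eta^{(0)}_{\nu_1\cdots\nu_k|[\mu_2\cdots\mu_k,\mu_1]},$$ $$\gamma\eta^{(m)}_{\mu_1\cdots\mu_k|\nu_1\cdots\nu_{k-m-1}}=\partial_{[\mu_1}\eta^{(m+1)}_{\mu_2\cdots\mu_k][\nu_1|\nu_2\cdots\nu_{k-m-1}]}+(-1)^{k+1}(m+2)\,\eta^{(m+1)}_{\mu_1\cdots\mu_k|[\nu_2\cdots\nu_{k-m-1},\nu_1]},\quad 0\le m\le k-2,$$ where $f_{,\mu}=\partial_\mu f$. Let $H^l(\gamma)$ be the space of $\gamma$-closed elements of pure ghost number $l$ modulo $\gamma$-exact ones. Call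 invariant polynomials the elements of the subalgebra generated by the $dx^\rho$, the antifields, the curvature $F_{\mu_1\cdots\mu_{k+1}|\nu_1\cdots\nu_{k+1}}=\partial_{[\mu_1}t_{\mu_2\cdots\mu_{k+1}]|[\nu_2\cdots\nu_{k+1},\nu_1]}$, and all derivatives of the antifields and of the curvature. For $l\ge 0$ let $E^{kl}$ be the space of elements of pure ghost number $kl$ in the subalgebra generated by $\eta^{(k-1)}_{\mu_1\cdots\mu_k}$ and $\partial_{[\mu_1}\eta^{(k-1)}_{\mu_2\cdots\mu_{k+1}]}$. Then: 1. $H^l(\gamma)=0$ for $1\le l\le k-1$. 2. $H^{l'}(\gamma)=0$ for every $l'\ge 0$ that is not of the form $kl$ with $l\in\mathbb{N}$. 3. An element $a\in\mathcal A$ of pure ghost number $0$ and definite antighost number and form degree satisfies $\gamma a=0$ if and only if it is an invariant polynomial. 4. Let $l>0$, let $(e^J)$ be any basis of $E^{kl}$, and let $a\in\mathcal A$ have pure ghost number $kl$, antighost number $j$ and form degree $p$. Then $\gamma a=0$ if and only if $a=\sum_J\alpha_J e^J+\gamma b$ for some $b\in\mathcal A$ and some invariant polynomials $\alpha_J$ of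 antighost number $j$ and form degree $p$, only finitely many of them non-zero. 5. The representatives are non-trivial: for $l\ge 0$, any basis $(e^J)$ of $E^{kl}$ and any invariant polynomials $\alpha_J$, only finitely many of them non-zero, if $\sum_J\alpha_J e^J$ is $\gamma$-exact, then it is $0$. -/

import Mathlib

namespace MixedBRST

variable {ι M N : Type*} [AddCommGroup M] [AddCommGroup N] {k j n : ℕ}

/-- The index tuple `v` with its `i`-th entry removed. -/
def omitAt (v : Fin n → ι) (i : Fin n) : Fin (n - 1) → ι := fun a =>
  if a.1 < i.1 then v ⟨a.1, by omega⟩ else v ⟨a.1 + 1, by omega⟩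

/-- The index tuple `v` with its `i`-th entry removed and `x` put behind the remaining ones. -/
def omitSnoc (v : Fin n → ι) (i : Fin n) (x : ι) : Fin n → ι := fun a =>
  if h : a.1 + 1 < n then omitAt v i ⟨a.1, by omega⟩ else x

/-- The left-hand sides of the linear relations `z = 0` which say that the family
`X μ ν = X_{μ₁⋯μ_k|ν₁⋯ν_j}` has the mixed symmetry `(k, j)`: antisymmetry in both sets of
indices and the Bianchi I identity `X_{[μ₁⋯μ_k|ν₁]ν₂⋯ν_j} = 0`, whose `k + 1` distinct terms are
`X_{μ|ν}` and minus the terms with `μ_a` and `ν₁` exchanged (nothing is imposed for `j = 0`). -/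
inductive YoungRel (X : (Fin k → ι) → (Fin j → ι) → M) : M → Prop
  | antisymmLeft (a b : Fin k) (hab : a ≠ b) (μ : Fin k → ι) (ν : Fin j → ι) :
      YoungRel X (X (μ ∘ Equiv.swap a b) ν + X μ ν)
  | antisymmRight (a b : Fin j) (hab : a ≠ b) (μ : Fin k → ι) (ν : Fin j → ι) :
      YoungRel X (X μ (ν ∘ Equiv.swap a b) + X μ ν)
  | bianchi (h : 0 < j) (μ : Fin k → ι) (ν : Fin j → ι) :
      YoungRel X (X μ ν - ∑ a : Fin k,
        X (Function.update μ a (ν ⟨0, h⟩)) (Function.update ν ⟨0, h⟩ (μ a)))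

/-- For `c ρ μ ν = ∂_ρ η_{μ₁⋯μ_k|ν₁⋯ν_{k-1}}` this is
`η_{μ₁⋯μ_k|[ν₂⋯ν_k,ν₁]} + η_{ν₁⋯ν_k|[μ₂⋯μ_k,μ₁]}`.
Here and below a bracket denotes the signed sum over the distinct terms only. -/
def fieldGauge (c : ι → (Fin k → ι) → (Fin (k - 1) → ι) → M) (μ ν : Fin k → ι) : M :=
  (∑ i : Fin k, (-1 : ℤ) ^ i.1 • c (ν i) μ (omitAt ν i)) +
    ∑ i : Fin k, (-1 : ℤ) ^ i.1 • c (μ i) ν (omitAt μ i)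

/-- For `c ρ μ ν = ∂_ρ η_{μ₁⋯μ_k|ν₁⋯ν_{j-1}}` this is
`∂_{[μ₁} η_{μ₂⋯μ_k][ν₁|ν₂⋯ν_j]} + (-1)^{k+1} (k-j+1) η_{μ₁⋯μ_k|[ν₂⋯ν_j,ν₁]}`,
with `k * j` terms in the first and `j` terms in the second summand. In terms of the order of
reducibility `m = k-j-1` of a ghost of symmetry `(k, j)` the coefficient `k-j+1` is `m+2`. -/
def ghostGauge (c : ι → (Fin k → ι) → (Fin (j - 1) → ι) → M) (μ : Fin k → ι)
    (ν : Fin j → ι) : M :=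
  (∑ i : Fin k, ∑ l : Fin j,
      (-1 : ℤ) ^ (i.1 + l.1) • c (μ i) (omitSnoc μ i (ν l)) (omitAt ν l)) +
    ((-1 : ℤ) ^ (k + 1) * ((k : ℤ) - j + 1)) •
      ∑ l : Fin j, (-1 : ℤ) ^ l.1 • c (ν l) μ (omitAt ν l)

/-! ### The gauge transformations respect the mixed symmetries -/

/-- The family `X` has the mixed symmetry `(k, j)`. -/
structure IsYoung (X : (Fin k → ι) → (Fin j → ι) → M) : Prop where
  left : ∀ (a b : Fin k), a ≠ b → ∀ μ ν, X (μ ∘ Equiv.swap a b) ν = - X μ ν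
  right : ∀ (a b : Fin j), a ≠ b → ∀ μ ν, X μ (ν ∘ Equiv.swap a b) = - X μ ν
  bianchi : ∀ (h : 0 < j) μ ν, X μ ν = ∑ a : Fin k,
    X (Function.update μ a (ν ⟨0, h⟩)) (Function.update ν ⟨0, h⟩ (μ a))

theorem YoungRel.map_eq_zero {X : (Fin k → ι) → (Fin j → ι) → M} {z : M} (h : YoungRel X z)
    (φ : M →+ N) (hφ : IsYoung fun μ ν => φ (X μ ν)) : φ z = 0 := by
  cases h with
  | antisymmLeft a b hab μ ν => rw [map_add, hφ.left a b hab]; simp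
  | antisymmRight a b hab μ ν => rw [map_add, hφ.right a b hab]; simp
  | bianchi h μ ν => rw [map_sub, map_sum, sub_eq_zero]; exact hφ.bianchi h μ ν

theorem isYoung_map {X : (Fin k → ι) → (Fin j → ι) → M} (φ : M →+ N)
    (h : ∀ z, YoungRel X z → φ z = 0) : IsYoung fun μ ν => φ (X μ ν) where
  left a b hab μ ν := by
    rw [eq_neg_iff_add_eq_zero, ← map_add]; exact h _ (.antisymmLeft a b hab μ ν)
  right a b hab μ ν := by
    rw [eq_neg_iff_add_eq_zero, ← map_add]; exact h _ (.antisymmRight a b hab μ ν)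
  bianchi h0 μ ν := by
    rw [← sub_eq_zero, ← map_sum, ← map_sub]; exact h _ (.bianchi h0 μ ν)

theorem anti_perm {f : (Fin n → ι) → M}
    (hf : ∀ a b : Fin n, a ≠ b → ∀ v, f (v ∘ Equiv.swap a b) = - f v)
    (σ : Equiv.Perm (Fin n)) : ∀ v, f (v ∘ σ) = (Equiv.Perm.sign σ : ℤ) • f v := by
  induction σ using Equiv.Perm.swap_induction_on with
  | one => intro v; simp
  | swap_mul σ x y hxy ih =>
    intro v
    rw [Equiv.Perm.coe_mul, ← Function.comp_assoc, ih, hf x y hxy, Equiv.Perm.sign_mul,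
      Equiv.Perm.sign_swap hxy]
    simp

/-- Signed values depend only on the image of `0`. -/
theorem tail_perm {C : (Fin (n + 1) → ι) → M}
    (hC : ∀ (e : Equiv.Perm (Fin n)) v,
      C (v ∘ (Equiv.Perm.decomposeFin.symm (0, e))) = (Equiv.Perm.sign e : ℤ) • C v)
    (σ τ : Equiv.Perm (Fin (n + 1))) (h : σ 0 = τ 0) (v : Fin (n + 1) → ι) :
    (Equiv.Perm.sign σ : ℤ) • C (v ∘ σ) = (Equiv.Perm.sign τ : ℤ) • C (v ∘ τ) := by
  obtain ⟨⟨p, e⟩, hpe⟩ := Equiv.Perm.decomposeFin.symm.surjective (τ⁻¹ * σ)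
  have hp : p = 0 := by
    have := Equiv.Perm.decomposeFin_symm_apply_zero p e
    rw [hpe] at this
    rw [← this]; simp [h]
  subst hp
  have hσ : σ = τ * Equiv.Perm.decomposeFin.symm (0, e) := by rw [hpe]; simp
  rw [hσ, Equiv.Perm.coe_mul, ← Function.comp_assoc, hC, Equiv.Perm.sign_mul,
    Equiv.Perm.decomposeFin.symm_sign]
  rcases Int.units_eq_one_or (Equiv.Perm.sign e) with h1 | h1 <;> simp [h1]

theorem omitAt_succ (v : Fin (n + 1) → ι) (i : Fin (n + 1)) :
    omitAt v i = v ∘ i.succAbove := by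
  funext a
  simp only [omitAt, Function.comp, Fin.succAbove, Fin.lt_def, Fin.val_castSucc]
  split_ifs <;> rfl

theorem cycle_zero (v : Fin (n + 1) → ι) (i : Fin (n + 1)) :
    (v ∘ ⇑(Equiv.symm i.cycleRange)) 0 = v i := by
  simp [Fin.cycleRange_symm_zero]

theorem cycle_tail (v : Fin (n + 1) → ι) (i : Fin (n + 1)) :
    (v ∘ ⇑(Equiv.symm i.cycleRange)) ∘ Fin.succ = v ∘ i.succAbove := by
  funext a; simp [Fin.cycleRange_symm_succ]

theorem cycle_eq_cons (v : Fin (n + 1) → ι) (i : Fin (n + 1)) :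
    v ∘ ⇑(Equiv.symm i.cycleRange) = Fin.cons (v i) (v ∘ i.succAbove) := by
  funext a
  refine Fin.cases ?_ (fun a => ?_) a
  · simp [Fin.cycleRange_symm_zero]
  · simp [Fin.cycleRange_symm_succ]

theorem sign_cycle_symm (i : Fin (n + 1)) :
    ((Equiv.Perm.sign (Equiv.symm i.cycleRange) : ℤˣ) : ℤ) = (-1) ^ i.1 := by
  rw [Equiv.Perm.sign_symm, Fin.sign_cycleRange]; simp

/-- For `g` antisymmetric in the tail, `∑ i, (-1)^i g (v i) (v without i)` is antisymmetric. -/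
theorem extD_anti {g : ι → (Fin n → ι) → M}
    (hg : ∀ x (a b : Fin n), a ≠ b → ∀ v, g x (v ∘ Equiv.swap a b) = - g x v)
    (σ : Equiv.Perm (Fin (n + 1))) (v : Fin (n + 1) → ι) :
    ∑ i : Fin (n + 1), (-1 : ℤ) ^ i.1 • g ((v ∘ σ) i) ((v ∘ σ) ∘ i.succAbove) =
      (Equiv.Perm.sign σ : ℤ) •
        ∑ i : Fin (n + 1), (-1 : ℤ) ^ i.1 • g (v i) (v ∘ i.succAbove) := by
  set C : (Fin (n + 1) → ι) → M := fun w => g (w 0) (w ∘ Fin.succ) with hCdef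
  have hC : ∀ (e : Equiv.Perm (Fin n)) w,
      C (w ∘ (Equiv.Perm.decomposeFin.symm (0, e))) = (Equiv.Perm.sign e : ℤ) • C w := by
    intro e w
    have h1 : (w ∘ (Equiv.Perm.decomposeFin.symm (0, e))) ∘ Fin.succ = (w ∘ Fin.succ) ∘ e := by
      funext a; simp [Equiv.Perm.decomposeFin_symm_apply_succ]
    simp only [hCdef, h1]
    rw [anti_perm (hg _) e]
    simp [Equiv.Perm.decomposeFin_symm_apply_zero]
  have key : ∀ (w : Fin (n + 1) → ι) (i : Fin (n + 1)),
      (-1 : ℤ) ^ i.1 • g (w i) (w ∘ i.succAbove) =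
        (Equiv.Perm.sign (Equiv.symm i.cycleRange) : ℤ) •
          C (w ∘ ⇑(Equiv.symm i.cycleRange)) := by
    intro w i
    rw [sign_cycle_symm]
    simp only [hCdef, cycle_zero, cycle_tail]
  simp only [key]
  rw [Finset.smul_sum, ← Equiv.sum_comp σ (fun i => (Equiv.Perm.sign σ : ℤ) •
    ((Equiv.Perm.sign (Equiv.symm i.cycleRange) : ℤ) • C (v ∘ ⇑(Equiv.symm i.cycleRange))))]
  refine Finset.sum_congr rfl fun i _ => ?_
  rw [← tail_perm hC (σ * Equiv.symm i.cycleRange) (Equiv.symm (σ i).cycleRange)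
    (by simp [Fin.cycleRange_symm_zero]) v]
  rw [Equiv.Perm.coe_mul, Function.comp_assoc, Equiv.Perm.sign_mul, smul_smul, Units.val_mul,
    ← mul_assoc, ← Units.val_mul, Int.units_mul_self, Units.val_one, one_mul]

theorem extD_anti_swap {g : ι → (Fin (n - 1) → ι) → M}
    (hg : ∀ x (a b : Fin (n - 1)), a ≠ b → ∀ v, g x (v ∘ Equiv.swap a b) = - g x v)
    (a b : Fin n) (hab : a ≠ b) (v : Fin n → ι) :
    ∑ i : Fin n, (-1 : ℤ) ^ i.1 • g ((v ∘ Equiv.swap a b) i) (omitAt (v ∘ Equiv.swap a b) i) =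
      - ∑ i : Fin n, (-1 : ℤ) ^ i.1 • g (v i) (omitAt v i) := by
  cases n with
  | zero => exact a.elim0
  | succ n =>
    have h := extD_anti (n := n) hg (Equiv.swap a b) v
    rw [Equiv.Perm.sign_swap hab] at h
    simpa [omitAt_succ] using h

/-- Moving the entry put at the end to the place of the removed one. -/
theorem omitSnoc_eq {f : (Fin (n + 1) → ι) → M}
    (hf : ∀ a b : Fin (n + 1), a ≠ b → ∀ v, f (v ∘ Equiv.swap a b) = - f v)
    (v : Fin (n + 1) → ι) (i : Fin (n + 1)) (x : ι) :
    (-1 : ℤ) ^ i.1 • f (omitSnoc v i x) = (-1 : ℤ) ^ n • f (Function.update v i x) := by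
  have h2 : omitSnoc v i x =
      (Function.update v i x ∘ ⇑(Equiv.symm i.cycleRange)) ∘ finRotate (n + 1) := by
    rw [cycle_eq_cons]
    funext a
    refine Fin.lastCases ?_ (fun a => ?_) a
    · simp [omitSnoc]
    · have h3 : finRotate (n + 1) a.castSucc = a.succ := by
        rw [finRotate_apply]; simp
      simp [omitSnoc, omitAt_succ, h3]
  rw [h2, anti_perm hf, anti_perm hf, sign_cycle_symm, sign_finRotate]
  simp only [smul_smul]
  congr 1
  have : ((-1 : ℤ) ^ i.1) * (-1) ^ i.1 = 1 := by rw [← mul_pow]; simp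
  simp only [Units.val_pow_eq_pow_val, Units.val_neg, Units.val_one, Nat.add_sub_cancel]
  linear_combination (-1 : ℤ) ^ n * this

theorem IsYoung.bianchi_at {X : (Fin k → ι) → (Fin j → ι) → M} (hX : IsYoung X) (b : Fin j)
    (μ : Fin k → ι) (ν : Fin j → ι) :
    X μ ν = ∑ a : Fin k, X (Function.update μ a (ν b)) (Function.update ν b (μ a)) := by
  have h0 : 0 < j := by have := b.2; omega
  by_cases hb : (⟨0, h0⟩ : Fin j) = b
  · subst hb; exact hX.bianchi h0 μ ν
  · have h1 := hX.right _ _ hb μ ν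
    rw [hX.bianchi h0] at h1
    rw [← neg_eq_iff_eq_neg] at h1
    rw [← h1, ← Finset.sum_neg_distrib]
    refine Finset.sum_congr rfl fun a _ => ?_
    rw [← hX.right _ _ hb]
    have h2 : Function.update (ν ∘ Equiv.swap ⟨0, h0⟩ b) ⟨0, h0⟩ (μ a) =
        Function.update ν b (μ a) ∘ Equiv.swap ⟨0, h0⟩ b := by
      funext q
      by_cases hq0 : q = ⟨0, h0⟩
      · subst hq0; simp
      · by_cases hqb : q = b
        · subst hqb; simp [hq0, hb]
        · simp [Equiv.swap_apply_of_ne_of_ne hq0 hqb, hq0, hqb]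
    rw [h2]
    congr 1
    funext q
    simp

theorem update_swap (μ : Fin n → ι) {i i' : Fin n} (h : i ≠ i') (a : ι) :
    Function.update (Function.update μ i' a) i (μ i') =
      Function.update μ i a ∘ Equiv.swap i i' := by
  funext q
  by_cases hq : q = i
  · subst hq; simp [Function.update_of_ne h.symm]
  · by_cases hq' : q = i'
    · subst hq'; simp [hq]
    · simp [Equiv.swap_apply_of_ne_of_ne hq hq', hq, hq']

/-- The algebraic heart of the consistency of the action on the ghosts. -/
theorem ghost_bianchi_aux {p : ℕ} (c : ι → (Fin (n + 1) → ι) → M)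
    (hc : ∀ x (a b : Fin (n + 1)), a ≠ b → ∀ v, c x (v ∘ Equiv.swap a b) = - c x v)
    (ν' : Fin p → ι) (U : Fin p → ι → ι → (Fin (n + 1) → ι) → M)
    (hB : ∀ l ρ x μ, ∑ i, U l ρ (μ i) (Function.update μ i x) = U l ρ x μ)
    (hF : ∀ l ρ μ, U l ρ (ν' l) μ = (-1 : ℤ) ^ l.1 • c ρ μ)
    (μ : Fin (n + 1) → ι) (a : ι) (d e : ι → (Fin (n + 1) → ι) → M)
    (hd : ∀ a μ, d a μ = c a μ - ∑ l : Fin p, (-1 : ℤ) ^ l.1 • U l (ν' l) a μ)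
    (he : ∀ a μ, e a μ = (∑ i, c (μ i) (Function.update μ i a)) -
      ∑ i, ∑ l : Fin p, (-1 : ℤ) ^ l.1 • U l (μ i) a (Function.update μ i (ν' l))) :
    (e a μ + ((n : ℤ) + 1 - p) • d a μ) =
      ∑ i, (e (μ i) (Function.update μ i a) +
        ((n : ℤ) + 1 - p) • d (μ i) (Function.update μ i a)) := by
  have sq : ∀ (l : Fin p) (m : M), (-1 : ℤ) ^ l.1 • (-1 : ℤ) ^ l.1 • m = m := by
    intro l m
    rw [smul_smul, ← mul_pow]; simp
  set X := ∑ i, c (μ i) (Function.update μ i a) with hX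
  set Y := ∑ i, ∑ l : Fin p, (-1 : ℤ) ^ l.1 • U l (μ i) a (Function.update μ i (ν' l)) with hY
  set Z := ∑ l : Fin p, (-1 : ℤ) ^ l.1 • U l (ν' l) a μ with hZ
  have h1 : ∑ i, d (μ i) (Function.update μ i a) = X - Z := by
    simp only [hd, Finset.sum_sub_distrib]
    rw [Finset.sum_comm]
    simp only [← Finset.smul_sum, hB]
    rfl
  have h2 : ∑ i', ∑ i, c (Function.update μ i' a i)
      (Function.update (Function.update μ i' a) i (μ i')) =
        ((n : ℤ) + 1) • c a μ - (n : ℤ) • X := by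
    rw [Finset.sum_comm]
    have : ∀ i, ∑ i', c (Function.update μ i' a i)
      (Function.update (Function.update μ i' a) i (μ i')) =
        c a μ - (n : ℤ) • c (μ i) (Function.update μ i a) := by
      intro i
      rw [← Finset.add_sum_erase _ _ (Finset.mem_univ i)]
      rw [Finset.sum_congr rfl (g := fun _ => - c (μ i) (Function.update μ i a))]
      · simp [sub_eq_add_neg]
      · intro i' hi'
        have hne : i ≠ i' := (Finset.ne_of_mem_erase hi').symm
        rw [update_swap μ hne, hc _ _ _ hne, Function.update_of_ne hne]
    simp only [this, Finset.sum_sub_distrib, ← Finset.smul_sum]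
    simp only [Finset.sum_const, Finset.card_univ, Fintype.card_fin, hX]
    congr 1
    rw [← natCast_zsmul]; push_cast; rfl
  have h3 : ∑ i', ∑ i, ∑ l : Fin p, (-1 : ℤ) ^ l.1 • U l (Function.update μ i' a i) (μ i')
      (Function.update (Function.update μ i' a) i (ν' l)) =
        (p : ℤ) • c a μ + Y - (p : ℤ) • X := by
    rw [Finset.sum_comm]
    have h31 : ∀ i, ∑ i', ∑ l : Fin p, (-1 : ℤ) ^ l.1 • U l (Function.update μ i' a i) (μ i')
        (Function.update (Function.update μ i' a) i (ν' l)) =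
        ∑ l : Fin p, ((-1 : ℤ) ^ l.1 • U l a (μ i) (Function.update μ i (ν' l)) +
          ((-1 : ℤ) ^ l.1 • U l (μ i) a (Function.update μ i (ν' l)) -
            c (μ i) (Function.update μ i a))) := by
      intro i
      rw [Finset.sum_comm]
      refine Finset.sum_congr rfl fun l _ => ?_
      rw [← Finset.smul_sum, ← Finset.add_sum_erase _ _ (Finset.mem_univ i)]
      have hb := hB l (μ i) a (Function.update μ i (ν' l))
      rw [← Finset.add_sum_erase _ _ (Finset.mem_univ i)] at hb
      simp only [Function.update_self, Function.update_idem, hF] at hb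
      rw [← hb]
      simp only [Function.update_self, Function.update_idem, smul_add, sq]
      rw [add_sub_cancel_left]
      congr 2
      refine Finset.sum_congr rfl fun i' hi' => ?_
      have hne : i' ≠ i := Finset.ne_of_mem_erase hi'
      rw [Function.update_of_ne hne.symm, Function.update_of_ne hne,
        Function.update_comm hne]
    simp only [h31, Finset.sum_add_distrib, Finset.sum_sub_distrib]
    have h32 : ∑ i, ∑ l : Fin p, (-1 : ℤ) ^ l.1 • U l a (μ i) (Function.update μ i (ν' l)) =
        (p : ℤ) • c a μ := by
      rw [Finset.sum_comm]
      simp only [← Finset.smul_sum, hB, hF, sq]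
      simp
    rw [h32]
    simp only [Finset.sum_const, Finset.card_univ, Fintype.card_fin, ← Finset.smul_sum,
      natCast_zsmul]
    abel
  rw [Finset.sum_add_distrib, ← Finset.smul_sum, h1]
  simp only [he, hd, Finset.sum_sub_distrib, h2, h3]
  rw [← hX, ← hY, ← hZ]
  module

theorem ghostGauge_eq {c : ι → (Fin (n + 1) → ι) → (Fin (j - 1) → ι) → M}
    (hc : ∀ ρ, IsYoung (c ρ)) (μ : Fin (n + 1) → ι) (ν : Fin j → ι) :
    ghostGauge c μ ν = (-1 : ℤ) ^ n •
      ((∑ l : Fin j, (-1 : ℤ) ^ l.1 •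
          ∑ i, c (μ i) (Function.update μ i (ν l)) (omitAt ν l)) +
        ((n : ℤ) + 1 - j + 1) • ∑ l : Fin j, (-1 : ℤ) ^ l.1 • c (ν l) μ (omitAt ν l)) := by
  have h : ∀ i (l : Fin j), (-1 : ℤ) ^ (i.1 + l.1) • c (μ i) (omitSnoc μ i (ν l)) (omitAt ν l) =
      (-1 : ℤ) ^ n • (-1 : ℤ) ^ l.1 • c (μ i) (Function.update μ i (ν l)) (omitAt ν l) := by
    intro i l
    have := omitSnoc_eq (f := fun w => c (μ i) w (omitAt ν l))
      (fun a b hab w => (hc _).left a b hab w _) μ i (ν l)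
    rw [pow_add, mul_comm, mul_smul, this, smul_comm]
  rw [ghostGauge]
  simp only [h]
  rw [Finset.sum_comm, smul_add]
  simp only [Finset.smul_sum]
  congr 1
  refine Finset.sum_congr rfl fun l _ => ?_
  simp only [smul_smul]
  congr 1
  push_cast
  ring

theorem IsYoung.ghostGauge {c : ι → (Fin (n + 1) → ι) → (Fin (j - 1) → ι) → M}
    (hc : ∀ ρ, IsYoung (c ρ)) :
    IsYoung (ghostGauge c : (Fin (n + 1) → ι) → (Fin j → ι) → M) := by
  refine ⟨fun a b hab μ ν => ?_, fun a b hab μ ν => ?_, fun h μ ν => ?_⟩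
  · rw [ghostGauge_eq hc, ghostGauge_eq hc, ← smul_neg]
    congr 1
    rw [neg_add, ← smul_neg, ← Finset.sum_neg_distrib, ← Finset.sum_neg_distrib]
    simp only [← smul_neg, ← Finset.sum_neg_distrib]
    congr 1
    · refine Finset.sum_congr rfl fun l _ => ?_
      congr 1
      rw [← Equiv.sum_comp (Equiv.swap a b) (fun i => - c (μ i) _ _)]
      refine Finset.sum_congr rfl fun i _ => ?_
      rw [← (hc _).left a b hab]
      congr 1
      funext q
      by_cases hq : q = i
      · subst hq; simp
      · simp [hq]
    · congr 1
      refine Finset.sum_congr rfl fun l _ => ?_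
      rw [(hc _).left a b hab]
  · rw [ghostGauge_eq hc, ghostGauge_eq hc, ← smul_neg]
    congr 1
    rw [neg_add, ← smul_neg]
    congr 1
    · refine extD_anti_swap (g := fun x w => ∑ i, c (μ i) (Function.update μ i x) w)
        (fun x a b h v => ?_) a b hab ν
      rw [← Finset.sum_neg_distrib]
      exact Finset.sum_congr rfl fun i _ => (hc _).right a b h _ v
    · congr 1
      exact extD_anti_swap (g := fun x w => c x μ w)
        (fun x a b h v => (hc _).right a b h _ v) a b hab ν
  · obtain ⟨p, rfl⟩ : ∃ p, j = p + 1 := ⟨j - 1, by omega⟩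
    change MixedBRST.ghostGauge c μ ν = ∑ a, MixedBRST.ghostGauge c (Function.update μ a (ν 0))
      (Function.update ν 0 (μ a))
    simp only [ghostGauge_eq hc]
    rw [← Finset.smul_sum]
    congr 1
    obtain ⟨a, ν', rfl⟩ : ∃ a ν', ν = Fin.cons (α := fun _ => ι) a ν' :=
      ⟨ν 0, Fin.tail ν, (Fin.cons_self_tail ν).symm⟩
    simp only [Fin.cons_zero, Fin.update_cons_zero]
    have hcast : (n : ℤ) + 1 - ((p + 1 : ℕ) : ℤ) + 1 = (n : ℤ) + 1 - p := by push_cast; ring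
    rw [hcast]
    refine ghost_bianchi_aux (fun ρ μ => c ρ μ ν')
      (fun x a b hab v => (hc x).left a b hab v ν') ν'
      (fun l ρ x μ => c ρ μ ((Fin.cons x ν' : Fin (p + 1) → ι) ∘ l.succ.succAbove))
      ?_ ?_ μ a
      (fun a μ => ∑ l : Fin (p + 1), (-1 : ℤ) ^ l.1 •
        c ((Fin.cons a ν' : Fin (p + 1) → ι) l) μ (omitAt (Fin.cons a ν' : Fin (p + 1) → ι) l))
      (fun a μ => ∑ l : Fin (p + 1), (-1 : ℤ) ^ l.1 • ∑ i,
        c (μ i) (Function.update μ i ((Fin.cons a ν' : Fin (p + 1) → ι) l))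
          (omitAt (Fin.cons a ν' : Fin (p + 1) → ι) l)) ?_ ?_
    · intro l ρ x μ
      cases p with
      | zero => exact l.elim0
      | succ q =>
        rw [(hc ρ).bianchi (Nat.succ_pos q) μ]
        refine Finset.sum_congr rfl fun i _ => ?_
        congr 1
        funext b
        refine Fin.cases ?_ (fun b => ?_) b
        · simp [Function.update]
        · simp [Function.update, Fin.ext_iff]
    · intro l ρ μ
      cases p with
      | zero => exact l.elim0
      | succ q =>
        have h1 : (Fin.cons (ν' l) ν' : Fin (q + 2) → ι) ∘ l.succ.succAbove =
            ν' ∘ ⇑(Equiv.symm l.cycleRange) := by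
          rw [cycle_eq_cons]
          funext b
          refine Fin.cases ?_ (fun b => ?_) b <;> simp
        rw [h1]
        have := anti_perm (f := fun w => c ρ μ w) (fun a b hab v => (hc ρ).right a b hab μ v)
          (Equiv.symm l.cycleRange) ν'
        rw [sign_cycle_symm] at this
        exact this
    · intro a μ
      rw [Fin.sum_univ_succ]
      simp only [omitAt_succ, Fin.cons_zero, Fin.cons_succ, Fin.val_zero, pow_zero, one_smul,
        Fin.val_succ, pow_succ, mul_neg, mul_one, neg_smul, Finset.sum_neg_distrib,
        sub_eq_add_neg]
      congr 1
    · intro a μ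
      rw [Fin.sum_univ_succ]
      simp only [omitAt_succ, Fin.cons_zero, Fin.cons_succ, Fin.val_zero, pow_zero, one_smul,
        Fin.val_succ, pow_succ, mul_neg, mul_one, neg_smul, Finset.sum_neg_distrib,
        sub_eq_add_neg]
      rw [Finset.sum_comm]
      simp only [Finset.smul_sum]
      congr 1

/-- The tuple of the first column in the partial exchange of `r` entries. -/
def exchL (μ : Fin (n + 1) → ι) (ν : Fin n → ι) (r : ℕ) (σ : Equiv.Perm (Fin (n + 1))) :
    Fin (n + 1) → ι :=
  Fin.cons (μ (σ 0)) fun q => if q.1 < r then ν q else μ (σ q.succ)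

/-- The tuple of the second column in the partial exchange of `r` entries. -/
def exchR (μ : Fin (n + 1) → ι) (ν : Fin n → ι) (r : ℕ) (σ : Equiv.Perm (Fin (n + 1))) :
    Fin n → ι :=
  fun q => if q.1 < r then μ (σ q.succ) else ν q

theorem exchL_zero (μ : Fin (n + 1) → ι) (ν : Fin n → ι) (r : ℕ)
    (σ : Equiv.Perm (Fin (n + 1))) : exchL μ ν r σ 0 = μ (σ 0) := rfl

theorem exchL_lt (μ : Fin (n + 1) → ι) (ν : Fin n → ι) {r : ℕ} (σ : Equiv.Perm (Fin (n + 1)))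
    {q : Fin n} (h : q.1 < r) : exchL μ ν r σ q.succ = ν q := by
  rw [exchL, Fin.cons_succ, if_pos h]

theorem exchL_ge (μ : Fin (n + 1) → ι) (ν : Fin n → ι) {r : ℕ} (σ : Equiv.Perm (Fin (n + 1)))
    {q : Fin n} (h : ¬ q.1 < r) : exchL μ ν r σ q.succ = μ (σ q.succ) := by
  rw [exchL, Fin.cons_succ, if_neg h]

theorem exchR_lt (μ : Fin (n + 1) → ι) (ν : Fin n → ι) {r : ℕ} (σ : Equiv.Perm (Fin (n + 1)))
    {q : Fin n} (h : q.1 < r) : exchR μ ν r σ q = μ (σ q.succ) := by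
  rw [exchR, if_pos h]

theorem exchR_ge (μ : Fin (n + 1) → ι) (ν : Fin n → ι) {r : ℕ} (σ : Equiv.Perm (Fin (n + 1)))
    {q : Fin n} (h : ¬ q.1 < r) : exchR μ ν r σ q = ν q := by
  rw [exchR, if_neg h]

theorem exch_swap {R : Type*} {X : (Fin (n + 1) → ι) → (Fin n → ι) → R}
    (μ : Fin (n + 1) → ι) (ν : Fin n → ι) (σ : Equiv.Perm (Fin (n + 1))) (b a : Fin n)
    (ha : a.1 < b.1) :
    X (Function.update (exchL μ ν b.1 σ) a.succ (exchR μ ν b.1 σ b))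
      (Function.update (exchR μ ν b.1 σ) b (exchL μ ν b.1 σ a.succ)) =
    X (exchL μ (ν ∘ Equiv.swap a b) b.1 σ) (exchR μ (ν ∘ Equiv.swap a b) b.1 σ) := by
  have hab : a ≠ b := by intro h; subst h; exact lt_irrefl _ ha
  congr 1
  · funext q
    refine Fin.cases ?_ (fun q => ?_) q
    · simp [exchL, Function.update, Fin.ext_iff]
    · by_cases hq : q = a
      · subst hq; simp [exchL_lt _ _ _ ha, exchR_ge _ _ _ (lt_irrefl b.1)]
      · by_cases hqb : q = b
        · subst hqb; simp [exchL, hq]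
        · simp [exchL, hq, Equiv.swap_apply_of_ne_of_ne hq hqb]
  · funext q
    by_cases hqb : q = b
    · subst hqb; simp [exchR_ge _ _ _ (lt_irrefl q.1), exchL_lt _ _ _ ha]
    · by_cases hq : q = a
      · subst hq; simp [exchR, hqb, ha]
      · simp [exchR, hqb, Equiv.swap_apply_of_ne_of_ne hq hqb]

theorem exch_step {X : (Fin (n + 1) → ι) → (Fin n → ι) → M} (hX : IsYoung X)
    (μ : Fin (n + 1) → ι) (ν : Fin n → ι) (σ : Equiv.Perm (Fin (n + 1))) (b : Fin n)
    (a : Fin (n + 1)) (ha : ∀ q : Fin n, q.1 < b.1 → a ≠ q.succ) :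
    (Equiv.Perm.sign σ : ℤ) • X (Function.update (exchL μ ν b.1 σ) a (exchR μ ν b.1 σ b))
      (Function.update (exchR μ ν b.1 σ) b (exchL μ ν b.1 σ a)) =
    (Equiv.Perm.sign (σ * Equiv.swap b.succ a) : ℤ) •
      X (exchL μ ν (b.1 + 1) (σ * Equiv.swap b.succ a))
        (exchR μ ν (b.1 + 1) (σ * Equiv.swap b.succ a)) := by
  have hval : exchL μ ν b.1 σ a = μ (σ a) := by
    revert ha
    refine Fin.cases ?_ (fun a => ?_) a
    · intro _; simp [exchL]
    · intro ha
      have : ¬ a.1 < b.1 := fun h => ha a h rfl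
      rw [exchL_ge _ _ _ this]
  have hR : Function.update (exchR μ ν b.1 σ) b (μ (σ a)) =
      exchR μ ν (b.1 + 1) (σ * Equiv.swap b.succ a) := by
    funext q
    by_cases hqb : q = b
    · subst hqb; simp [exchR]
    · have hne : q.1 ≠ b.1 := fun h => hqb (Fin.ext h)
      by_cases hq : q.1 < b.1
      · have h1 : q.succ ≠ b.succ := fun h => hqb (Fin.succ_injective _ h)
        have h2 : q.1 < b.1 + 1 := by omega
        simp [exchR, hqb, hq, h2, Equiv.swap_apply_of_ne_of_ne h1 (ha q hq).symm]
      · have h2 : ¬ q.1 < b.1 + 1 := by omega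
        simp [exchR, hqb, hq, h2]
  have hL : Function.update (exchL μ ν b.1 σ) a (ν b) =
      exchL μ ν (b.1 + 1) (σ * Equiv.swap b.succ a) ∘ Equiv.swap b.succ a := by
    have hL' : ∀ q, q ≠ a → q ≠ b.succ → exchL μ ν b.1 σ q =
        exchL μ ν (b.1 + 1) (σ * Equiv.swap b.succ a) q := by
      intro q
      refine Fin.cases ?_ (fun q => ?_) q
      · intro h1 h2
        simp [exchL, Equiv.swap_apply_of_ne_of_ne h2 h1]
      · intro h1 h2
        have hne : q.1 ≠ b.1 := fun h => h2 (by rw [Fin.ext h])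
        by_cases hq : q.1 < b.1
        · have h3 : q.1 < b.1 + 1 := by omega
          rw [exchL_lt _ _ _ hq, exchL_lt _ _ _ h3]
        · have h3 : ¬ q.1 < b.1 + 1 := by omega
          rw [exchL_ge _ _ _ hq, exchL_ge _ _ _ h3]
          simp [Equiv.swap_apply_of_ne_of_ne h2 h1]
    funext q
    by_cases hqa : q = a
    · subst hqa; simp [exchL]
    · by_cases hqb : q = b.succ
      · subst hqb
        have : exchL μ ν (b.1 + 1) (σ * Equiv.swap b.succ a) a = μ (σ b.succ) := by
          revert ha hqa
          refine Fin.cases ?_ (fun a => ?_) a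
          · intro _ _; simp [exchL]
          · intro ha hqa
            have h1 : ¬ a.1 < b.1 := fun h => ha a h rfl
            have h2 : a.1 ≠ b.1 := fun h => hqa (by rw [Fin.ext h])
            have h3 : ¬ a.1 < b.1 + 1 := by omega
            rw [exchL_ge _ _ _ h3]; simp
        simp [hqa, this]
        simp [exchL]
      · simp [hqa, Equiv.swap_apply_of_ne_of_ne hqb hqa, hL' q hqa hqb]
  have hb : exchR μ ν b.1 σ b = ν b := by simp [exchR]
  rw [hval, hb, hR, hL]
  by_cases hab : b.succ = a
  · subst hab; simp
  · rw [hX.left _ _ hab, Equiv.Perm.sign_mul, Equiv.Perm.sign_swap hab]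
    simp

theorem exch_sum [Module ℝ M] {X : (Fin (n + 1) → ι) → (Fin n → ι) → M} (hX : IsYoung X)
    (μ : Fin (n + 1) → ι) (r : ℕ) (hr : r ≤ n) (ν : Fin n → ι) :
    ∑ σ : Equiv.Perm (Fin (n + 1)),
      (Equiv.Perm.sign σ : ℤ) • X (exchL μ ν r σ) (exchR μ ν r σ) =
      ((r.factorial * (n + 1 - r).factorial : ℕ) : ℝ) • X μ ν := by
  induction r generalizing ν with
  | zero =>
    have h : ∀ σ : Equiv.Perm (Fin (n + 1)),
        (Equiv.Perm.sign σ : ℤ) • X (exchL μ ν 0 σ) (exchR μ ν 0 σ) = X μ ν := by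
      intro σ
      have h1 : exchL μ ν 0 σ = μ ∘ σ := by
        funext q
        refine Fin.cases ?_ (fun q => ?_) q <;> simp [exchL]
      have h2 : exchR μ ν 0 σ = ν := by funext q; simp [exchR]
      rw [h1, h2, anti_perm (f := fun w => X w ν) (fun a b hab v => hX.left a b hab v ν) σ,
        smul_smul, ← Units.val_mul, Int.units_mul_self]
      simp
    simp only [h, Finset.sum_const, Finset.card_univ, Fintype.card_perm, Fintype.card_fin]
    rw [← Nat.cast_smul_eq_nsmul ℝ]; simp
  | succ r ih =>
    have hrn : r < n := hr
    specialize ih hrn.le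
    set S := ∑ σ : Equiv.Perm (Fin (n + 1)),
      (Equiv.Perm.sign σ : ℤ) • X (exchL μ ν (r + 1) σ) (exchR μ ν (r + 1) σ) with hS
    set K : ℝ := ((r.factorial * (n + 1 - r).factorial : ℕ) : ℝ) with hK
    have hstep : ∀ a : Fin (n + 1), (∀ q : Fin n, q.1 < r → a ≠ q.succ) →
        ∑ σ : Equiv.Perm (Fin (n + 1)), (Equiv.Perm.sign σ : ℤ) •
          X (Function.update (exchL μ ν r σ) a (exchR μ ν r σ ⟨r, hrn⟩))
          (Function.update (exchR μ ν r σ) ⟨r, hrn⟩ (exchL μ ν r σ a)) = S := by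
      intro a ha
      rw [hS, ← Equiv.sum_comp (Equiv.mulRight (Equiv.swap (Fin.succ ⟨r, hrn⟩) a))
        (fun σ => (Equiv.Perm.sign σ : ℤ) • X (exchL μ ν (r + 1) σ) (exchR μ ν (r + 1) σ))]
      exact Finset.sum_congr rfl fun σ _ => exch_step hX μ ν σ ⟨r, hrn⟩ a ha
    have hmain := ih ν
    have hb : ∀ σ : Equiv.Perm (Fin (n + 1)),
        (Equiv.Perm.sign σ : ℤ) • X (exchL μ ν r σ) (exchR μ ν r σ) =
        ∑ a, (Equiv.Perm.sign σ : ℤ) •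
          X (Function.update (exchL μ ν r σ) a (exchR μ ν r σ ⟨r, hrn⟩))
          (Function.update (exchR μ ν r σ) ⟨r, hrn⟩ (exchL μ ν r σ a)) := by
      intro σ
      rw [← Finset.smul_sum, ← hX.bianchi_at]
    simp only [hb] at hmain
    rw [Finset.sum_comm, Fin.sum_univ_succ, hstep 0 (fun q _ => (Fin.succ_ne_zero q).symm)]
      at hmain
    have hite : ∀ a : Fin n, ∑ σ : Equiv.Perm (Fin (n + 1)), (Equiv.Perm.sign σ : ℤ) •
          X (Function.update (exchL μ ν r σ) a.succ (exchR μ ν r σ ⟨r, hrn⟩))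
          (Function.update (exchR μ ν r σ) ⟨r, hrn⟩ (exchL μ ν r σ a.succ)) =
        if a.1 < r then - (K • X μ ν) else S := by
      intro a
      split_ifs with ha
      · have hne : a ≠ ⟨r, hrn⟩ := by intro h; rw [h] at ha; simp at ha
        rw [← smul_neg, ← hX.right _ _ hne, ← ih]
        exact Finset.sum_congr rfl fun σ _ => congrArg _ (exch_swap (X := X) μ ν σ ⟨r, hrn⟩ a ha)
      · exact hstep _ fun q hq h => ha (by rwa [Fin.succ_injective _ h])
    simp only [hite] at hmain
    rw [Finset.sum_ite] at hmain
    have hc1 : (Finset.univ.filter fun a : Fin n => a.1 < r).card = r := by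
      rw [Fin.card_filter_val_lt]; exact min_eq_right hrn.le
    have hc2 : (Finset.univ.filter fun a : Fin n => ¬ a.1 < r).card = n - r := by
      have := Finset.card_filter_add_card_filter_not (s := (Finset.univ : Finset (Fin n)))
        (fun a : Fin n => a.1 < r)
      rw [hc1, Finset.card_univ, Fintype.card_fin] at this
      omega
    simp only [Finset.sum_const, hc1, hc2] at hmain
    rw [← Nat.cast_smul_eq_nsmul ℝ, ← Nat.cast_smul_eq_nsmul ℝ, Nat.cast_sub hrn.le] at hmain
    have hpos : ((n : ℝ) - r + 1) ≠ 0 := by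
      have : (r : ℝ) < n := by exact_mod_cast hrn
      linarith
    have h2 : ((n : ℝ) - r + 1) • S = (((r : ℝ) + 1) * K) • X μ ν := by
      have : ((n : ℝ) - r + 1) • S = (S + ((r : ℝ) • -(K • X μ ν) + ((n : ℝ) - r) • S)) +
          (r : ℝ) • (K • X μ ν) := by module
      rw [this, hmain]; module
    have hKK : (((r : ℝ) + 1) * K) =
        ((n : ℝ) - r + 1) * (((r + 1).factorial * (n + 1 - (r + 1)).factorial : ℕ) : ℝ) := by
      have : n + 1 - r = (n - r) + 1 := by omega
      rw [hK, this, Nat.factorial_succ, Nat.factorial_succ]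
      push_cast [Nat.cast_sub hrn.le, Nat.add_sub_add_right]
      ring
    rw [hKK, mul_smul] at h2
    exact smul_right_injective M hpos h2

theorem exch_all [Module ℝ M] {X : (Fin (n + 1) → ι) → (Fin n → ι) → M} (hX : IsYoung X)
    (μ : Fin (n + 1) → ι) (ν : Fin n → ι) :
    ∑ i : Fin (n + 1), (-1 : ℤ) ^ i.1 • X (Fin.cons (μ i) ν) (μ ∘ i.succAbove) = X μ ν := by
  have h := exch_sum hX μ n le_rfl ν
  set C : (Fin (n + 1) → ι) → M := fun w => X (Fin.cons (w 0) ν) (w ∘ Fin.succ) with hCdef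
  have hC : ∀ (e : Equiv.Perm (Fin n)) w,
      C (w ∘ (Equiv.Perm.decomposeFin.symm (0, e))) = (Equiv.Perm.sign e : ℤ) • C w := by
    intro e w
    have h1 : (w ∘ (Equiv.Perm.decomposeFin.symm (0, e))) ∘ Fin.succ = (w ∘ Fin.succ) ∘ e := by
      funext a; simp [Equiv.Perm.decomposeFin_symm_apply_succ]
    simp only [hCdef, h1]
    rw [anti_perm (fun a b hab v => hX.right a b hab _ v) e]
    simp [Equiv.Perm.decomposeFin_symm_apply_zero]
  have h1 : ∀ σ : Equiv.Perm (Fin (n + 1)),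
      X (exchL μ ν n σ) (exchR μ ν n σ) = C (μ ∘ σ) := by
    intro σ
    have hl : exchL μ ν n σ = Fin.cons (μ (σ 0)) ν := by
      funext q
      refine Fin.cases ?_ (fun q => ?_) q <;> simp [exchL]
    have hr : exchR μ ν n σ = (μ ∘ σ) ∘ Fin.succ := by
      funext q; simp [exchR]
    rw [hl, hr]; rfl
  have h2 : ∀ (p : Fin (n + 1)) (e : Equiv.Perm (Fin n)),
      (Equiv.Perm.sign (Equiv.Perm.decomposeFin.symm (p, e)) : ℤ) •
        C (μ ∘ (Equiv.Perm.decomposeFin.symm (p, e))) =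
      (-1 : ℤ) ^ p.1 • X (Fin.cons (μ p) ν) (μ ∘ p.succAbove) := by
    intro p e
    rw [tail_perm hC _ (Equiv.symm p.cycleRange)
      (by simp [Fin.cycleRange_symm_zero, Equiv.Perm.decomposeFin_symm_apply_zero]) μ,
      sign_cycle_symm]
    simp only [hCdef, cycle_zero, cycle_tail]
  simp only [h1] at h
  rw [← Equiv.sum_comp Equiv.Perm.decomposeFin.symm, Fintype.sum_prod_type] at h
  simp only [h2, Finset.sum_const, Finset.card_univ, Fintype.card_perm, Fintype.card_fin] at h
  rw [← Finset.smul_sum, ← Nat.cast_smul_eq_nsmul ℝ] at h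
  have hn : ((n.factorial : ℕ) : ℝ) ≠ 0 := by exact_mod_cast n.factorial_ne_zero
  have h3 : n + 1 - n = 1 := by omega
  rw [h3, Nat.factorial_one, mul_one] at h
  exact smul_right_injective M hn h

theorem IsYoung.fieldGauge [Module ℝ M] {c : ι → (Fin (n + 1) → ι) → (Fin n → ι) → M}
    (hc : ∀ ρ, IsYoung (c ρ)) :
    IsYoung (fieldGauge c : (Fin (n + 1) → ι) → (Fin (n + 1) → ι) → M) := by
  have hswap : ∀ (a b : Fin (n + 1)), a ≠ b → ∀ μ ν,
      MixedBRST.fieldGauge c (μ ∘ Equiv.swap a b) ν = - MixedBRST.fieldGauge c μ ν := by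
    intro a b hab μ ν
    rw [MixedBRST.fieldGauge, MixedBRST.fieldGauge, neg_add]
    congr 1
    · rw [← Finset.sum_neg_distrib]
      refine Finset.sum_congr rfl fun i _ => ?_
      rw [(hc _).left a b hab, smul_neg]
    · exact extD_anti_swap (n := n + 1) (g := fun x w => c x ν w)
        (fun x a b h v => (hc x).right a b h ν v) a b hab μ
  have hsymm : ∀ μ ν, MixedBRST.fieldGauge c μ ν = MixedBRST.fieldGauge c ν μ := by
    intro μ ν
    rw [MixedBRST.fieldGauge, MixedBRST.fieldGauge, add_comm]
  refine ⟨hswap, fun a b hab μ ν => ?_, fun h μ ν => ?_⟩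
  · rw [hsymm, hswap a b hab, hsymm]
  · change MixedBRST.fieldGauge c μ ν = ∑ a, MixedBRST.fieldGauge c (Function.update μ a (ν 0))
      (Function.update ν 0 (μ a))
    obtain ⟨a, ν', rfl⟩ : ∃ a ν', ν = Fin.cons (α := fun _ => ι) a ν' :=
      ⟨ν 0, Fin.tail ν, (Fin.cons_self_tail ν).symm⟩
    simp only [Fin.cons_zero, Fin.update_cons_zero]
    have hcons : ∀ x : ι, ∀ μ : Fin (n + 1) → ι,
        MixedBRST.fieldGauge c μ (Fin.cons x ν' : Fin (n + 1) → ι) =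
          (c x μ ν' - ∑ l : Fin n, (-1 : ℤ) ^ l.1 •
              c (ν' l) μ ((Fin.cons x ν' : Fin (n + 1) → ι) ∘ l.succ.succAbove)) +
            ∑ i : Fin (n + 1), (-1 : ℤ) ^ i.1 •
              c (μ i) (Fin.cons x ν' : Fin (n + 1) → ι) (μ ∘ i.succAbove) := by
      intro x μ
      rw [MixedBRST.fieldGauge, Fin.sum_univ_succ]
      simp only [omitAt_succ, Fin.cons_zero, Fin.cons_succ, Fin.val_zero, pow_zero, one_smul,
        Fin.val_succ, pow_succ, mul_neg, mul_one, neg_smul, Finset.sum_neg_distrib,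
        sub_eq_add_neg]
      congr 1
    simp only [hcons, Finset.sum_add_distrib, Finset.sum_sub_distrib]
    have e1 : ∑ i, ∑ l : Fin n, (-1 : ℤ) ^ l.1 • c (ν' l) (Function.update μ i a)
          ((Fin.cons (μ i) ν' : Fin (n + 1) → ι) ∘ l.succ.succAbove) =
        ∑ l : Fin n, (-1 : ℤ) ^ l.1 •
          c (ν' l) μ ((Fin.cons a ν' : Fin (n + 1) → ι) ∘ l.succ.succAbove) := by
      rw [Finset.sum_comm]
      refine Finset.sum_congr rfl fun l _ => ?_
      rw [← Finset.smul_sum]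
      congr 1
      cases n with
      | zero => exact l.elim0
      | succ q =>
        rw [(hc (ν' l)).bianchi (Nat.succ_pos q) μ]
        refine Finset.sum_congr rfl fun i _ => ?_
        congr 1
        funext b
        refine Fin.cases ?_ (fun b => ?_) b
        · simp [Function.update]
        · simp [Function.update, Fin.ext_iff]
    have hex : ∀ ρ (w : Fin (n + 1) → ι), ∑ i : Fin (n + 1), (-1 : ℤ) ^ i.1 •
        c ρ (Fin.cons (w i) ν') (w ∘ i.succAbove) = c ρ w ν' := fun ρ w => exch_all (hc ρ) w ν'
    have e2 : ∑ i', ∑ i : Fin (n + 1), (-1 : ℤ) ^ i.1 •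
        c (Function.update μ i' a i) (Fin.cons (μ i') ν' : Fin (n + 1) → ι)
          (Function.update μ i' a ∘ i.succAbove) =
        c a μ ν' + ∑ i : Fin (n + 1), ((-1 : ℤ) ^ i.1 •
          c (μ i) (Fin.cons a ν' : Fin (n + 1) → ι) (μ ∘ i.succAbove) -
            c (μ i) (Function.update μ i a) ν') := by
      rw [Finset.sum_comm]
      have hi : ∀ i : Fin (n + 1), ∑ i', (-1 : ℤ) ^ i.1 •
          c (Function.update μ i' a i) (Fin.cons (μ i') ν' : Fin (n + 1) → ι)
            (Function.update μ i' a ∘ i.succAbove) =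
          (-1 : ℤ) ^ i.1 • c a (Fin.cons (μ i) ν' : Fin (n + 1) → ι) (μ ∘ i.succAbove) +
            ((-1 : ℤ) ^ i.1 •
              c (μ i) (Fin.cons a ν' : Fin (n + 1) → ι) (μ ∘ i.succAbove) -
            c (μ i) (Function.update μ i a) ν') := by
        intro i
        have h1 := hex (μ i) (Fin.cons a (μ ∘ i.succAbove))
        rw [Fin.sum_univ_succ] at h1
        have h2 : c (μ i) (Fin.cons a (μ ∘ i.succAbove)) ν' =
            (-1 : ℤ) ^ i.1 • c (μ i) (Function.update μ i a) ν' := by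
          have := cycle_eq_cons (Function.update μ i a) i
          simp only [Function.update_self] at this
          have h3 : Function.update μ i a ∘ i.succAbove = μ ∘ i.succAbove := by
            funext q; simp
          rw [h3] at this
          rw [← this, anti_perm (f := fun w => c (μ i) w ν')
            (fun a b hab v => (hc _).left a b hab v ν'), sign_cycle_symm]
        rw [h2] at h1
        rw [Fin.sum_univ_succAbove _ i]
        have h4 : ∀ b : Fin n, (-1 : ℤ) ^ i.1 •
            c (Function.update μ (i.succAbove b) a i)
              (Fin.cons (μ (i.succAbove b)) ν' : Fin (n + 1) → ι)
              (Function.update μ (i.succAbove b) a ∘ i.succAbove) =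
            - (-1 : ℤ) ^ i.1 • (-1 : ℤ) ^ b.succ.1 •
              c (μ i) (Fin.cons ((Fin.cons a (μ ∘ i.succAbove) : Fin (n + 1) → ι) b.succ) ν')
                ((Fin.cons a (μ ∘ i.succAbove) : Fin (n + 1) → ι) ∘ b.succ.succAbove) := by
          intro b
          cases n with
          | zero => exact b.elim0
          | succ q =>
            have h5 : (Fin.cons a (μ ∘ i.succAbove) : Fin (q + 2) → ι) ∘ b.succ.succAbove =
                Function.update (μ ∘ i.succAbove) b a ∘ ⇑(Equiv.symm b.cycleRange) := by
              rw [cycle_eq_cons]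
              funext q
              refine Fin.cases ?_ (fun q => ?_) q <;> simp
            have h6 : Function.update μ (i.succAbove b) a ∘ i.succAbove =
                Function.update (μ ∘ i.succAbove) b a := by
              funext q
              by_cases hq : q = b
              · subst hq; simp
              · simp [hq]
            rw [h5, h6, anti_perm (fun a b hab v => (hc _).right a b hab _ v), sign_cycle_symm,
              Function.update_of_ne (Fin.ne_succAbove i b)]
            have sq : ((-1 : ℤ) ^ b.1) * (-1) ^ b.1 = 1 := by rw [← mul_pow]; simp
            simp only [Fin.cons_succ, Function.comp, smul_smul, Fin.val_succ]
            congr 1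
            linear_combination (-(-1 : ℤ) ^ i.1) * sq
        rw [Finset.sum_congr rfl fun b _ => h4 b, ← Finset.smul_sum]
        have h5 : Function.update μ i a ∘ i.succAbove = μ ∘ i.succAbove := by
          funext q; simp
        rw [Function.update_self, h5]
        have h7 := eq_sub_of_add_eq' h1
        rw [h7]
        have sq : ∀ m : M, (-1 : ℤ) ^ i.1 • (-1 : ℤ) ^ i.1 • m = m := by
          intro m; rw [smul_smul, ← mul_pow]; simp
        have h8 : (Fin.cons a (μ ∘ i.succAbove) : Fin (n + 1) → ι) ∘ Fin.succAbove 0 =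
            μ ∘ i.succAbove := by
          funext q; simp
        rw [h8, Fin.cons_zero, Fin.val_zero, pow_zero, one_smul, smul_sub, neg_smul, neg_smul, sq]
        abel
      rw [Finset.sum_congr rfl fun i _ => hi i, Finset.sum_add_distrib, hex]
    rw [e1, e2, Finset.sum_sub_distrib]
    abel

/-! ## The algebra of local forms -/

/-- Generators of the BRST algebra of the `(k, k)` field in `D` dimensions. A multiset `S` of
spacetime indices stands for the derivative `∂_S`. -/
inductive Gen (k D : ℕ)
  /-- the one-form `dx^ρ` -/
  | dx (ρ : Fin D)
  /-- `∂_S t_{μ₁⋯μ_k|ν₁⋯ν_k}` -/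
  | t (S : Multiset (Fin D)) (μ ν : Fin k → Fin D)
  /-- `∂_S η^{(k-j-1)}_{μ₁⋯μ_k|ν₁⋯ν_j}`: the ghost of mixed symmetry `(k, j)` -/
  | ghost (j : ℕ) (hj : j < k) (S : Multiset (Fin D)) (μ : Fin k → Fin D) (ν : Fin j → Fin D)
  /-- `∂_S t^{*μ₁⋯μ_k|ν₁⋯ν_k}` -/
  | tStar (S : Multiset (Fin D)) (μ ν : Fin k → Fin D)
  /-- `∂_S η^{(k-j-1)*μ₁⋯μ_k|ν₁⋯ν_j}` -/
  | ghostStar (j : ℕ) (hj : j < k) (S : Multiset (Fin D)) (μ : Fin k → Fin D)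
      (ν : Fin j → Fin D)

namespace Gen

variable {k D : ℕ}

/-- Grassmann parity (to be read modulo 2), form degree included. -/
def parity : Gen k D → ℕ
  | dx _ => 1
  | t _ _ _ => 0
  | ghost j _ _ _ _ => k - j
  | tStar _ _ _ => 1
  | ghostStar j _ _ _ _ => k - j + 1

/-- Pure ghost number. -/
def pgh : Gen k D → ℕ
  | ghost j _ _ _ _ => k - j
  | _ => 0

/-- Antighost number. -/
def agh : Gen k D → ℕ
  | tStar _ _ _ => 1
  | ghostStar j _ _ _ _ => k - j + 1
  | _ => 0

/-- Form degree. -/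
def formDeg : Gen k D → ℕ
  | dx _ => 1
  | _ => 0

end Gen

open Gen

/-- Defining relations: graded commutativity and the mixed symmetries of the generators. -/
inductive Rel (k D : ℕ) : FreeAlgebra ℝ (Gen k D) → FreeAlgebra ℝ (Gen k D) → Prop
  | comm (x y : Gen k D) : Rel k D (FreeAlgebra.ι ℝ x * FreeAlgebra.ι ℝ y)
      ((-1 : ℝ) ^ (x.parity * y.parity) • (FreeAlgebra.ι ℝ y * FreeAlgebra.ι ℝ x))
  | t (S : Multiset (Fin D)) (z : FreeAlgebra ℝ (Gen k D))
      (hz : YoungRel (fun μ ν => FreeAlgebra.ι ℝ (Gen.t S μ ν)) z) : Rel k D z 0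
  | t_symm (S : Multiset (Fin D)) (μ ν : Fin k → Fin D) :
      Rel k D (FreeAlgebra.ι ℝ (Gen.t S μ ν)) (FreeAlgebra.ι ℝ (Gen.t S ν μ))
  | ghost (j : ℕ) (hj : j < k) (S : Multiset (Fin D)) (z : FreeAlgebra ℝ (Gen k D))
      (hz : YoungRel (fun μ ν => FreeAlgebra.ι ℝ (Gen.ghost j hj S μ ν)) z) : Rel k D z 0
  | tStar (S : Multiset (Fin D)) (z : FreeAlgebra ℝ (Gen k D))
      (hz : YoungRel (fun μ ν => FreeAlgebra.ι ℝ (Gen.tStar S μ ν)) z) : Rel k D z 0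
  | tStar_symm (S : Multiset (Fin D)) (μ ν : Fin k → Fin D) :
      Rel k D (FreeAlgebra.ι ℝ (Gen.tStar S μ ν)) (FreeAlgebra.ι ℝ (Gen.tStar S ν μ))
  | ghostStar (j : ℕ) (hj : j < k) (S : Multiset (Fin D)) (z : FreeAlgebra ℝ (Gen k D))
      (hz : YoungRel (fun μ ν => FreeAlgebra.ι ℝ (Gen.ghostStar j hj S μ ν)) z) : Rel k D z 0

/-- The graded-commutative algebra of local forms, that is of polynomials in the `dx^ρ`, the
fields, ghosts, antifields and their derivatives. -/
def LocalForm (k D : ℕ) : Type := RingQuot (Rel k D)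

instance (k D : ℕ) : Ring (LocalForm k D) := inferInstanceAs (Ring (RingQuot (Rel k D)))

instance (k D : ℕ) : Algebra ℝ (LocalForm k D) :=
  inferInstanceAs (Algebra ℝ (RingQuot (Rel k D)))

variable {k D : ℕ}

/-- The quotient map. -/
def mk : FreeAlgebra ℝ (Gen k D) →ₐ[ℝ] LocalForm k D := RingQuot.mkAlgHom ℝ (Rel k D)

theorem mk_rel {x y : FreeAlgebra ℝ (Gen k D)} (h : Rel k D x y) : mk x = mk y :=
  RingQuot.mkAlgHom_rel ℝ h

theorem mk_surjective : Function.Surjective (mk (k := k) (D := D)) :=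
  RingQuot.mkAlgHom_surjective ℝ (Rel k D)

/-- Algebra homomorphisms out of the quotient. -/
def lift {B : Type*} [Ring B] [Algebra ℝ B] (f : FreeAlgebra ℝ (Gen k D) →ₐ[ℝ] B)
    (h : ∀ ⦃x y⦄, Rel k D x y → f x = f y) : LocalForm k D →ₐ[ℝ] B :=
  RingQuot.liftAlgHom ℝ ⟨f, h⟩

theorem lift_mk {B : Type*} [Ring B] [Algebra ℝ B] (f : FreeAlgebra ℝ (Gen k D) →ₐ[ℝ] B)
    (h : ∀ ⦃x y⦄, Rel k D x y → f x = f y) (x : FreeAlgebra ℝ (Gen k D)) :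
    lift f h (mk x) = f x :=
  RingQuot.liftAlgHom_mkAlgHom_apply ℝ f h x

/-- The class of a generator. -/
def gen (x : Gen k D) : LocalForm k D := mk (FreeAlgebra.ι ℝ x)

/-- The action of the exterior longitudinal derivative on the generators. -/
def gammaGen : Gen k D → LocalForm k D
  | .t S μ ν =>
      if h : 0 < k then
        fieldGauge (fun ρ μ' ν' => gen (.ghost (k - 1) (by omega) (ρ ::ₘ S) μ' ν')) μ ν
      else 0
  | .ghost j hj S μ ν =>
      ghostGauge (fun ρ μ' ν' => gen (.ghost (j - 1) (by omega) (ρ ::ₘ S) μ' ν')) μ ν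
  | _ => 0

theorem gen_comm (x y : Gen k D) :
    gen x * gen y = (-1 : ℝ) ^ (x.parity * y.parity) • (gen y * gen x) := by
  have := mk_rel (Rel.comm x y)
  rwa [map_smul, map_mul, map_mul] at this

/-- The elements which graded-commute with `gen y` like an element of parity `e`. -/
def commSubgroup (y : Gen k D) (e : ℕ) : AddSubgroup (LocalForm k D) where
  carrier := {m | gen y * m = (-1 : ℝ) ^ (y.parity * e) • (m * gen y)}
  zero_mem' := by simp
  add_mem' := by
    intro a b ha hb
    simp only [Set.mem_ofPred_eq] at *
    rw [mul_add, ha, hb, add_mul, smul_add]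
  neg_mem' := by
    intro a ha
    simp only [Set.mem_ofPred_eq] at *
    rw [mul_neg, ha, neg_mul, smul_neg]

theorem gen_gammaGen_comm (x y : Gen k D) :
    gen y * gammaGen x =
      (-1 : ℝ) ^ (y.parity * (x.parity + 1)) • (gammaGen x * gen y) := by
  change gammaGen x ∈ commSubgroup y (x.parity + 1)
  cases x with
  | dx => exact zero_mem _
  | tStar => exact zero_mem _
  | ghostStar => exact zero_mem _
  | t S μ ν =>
    simp only [gammaGen]
    split_ifs with h
    · have hm : ∀ ρ μ' ν', gen (.ghost (k - 1) (by omega) (ρ ::ₘ S) μ' ν') ∈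
          commSubgroup y ((Gen.t S μ ν).parity + 1) := by
        intro ρ μ' ν'
        have := gen_comm y (.ghost (k - 1) (by omega) (ρ ::ₘ S) μ' ν')
        have hp : k - (k - 1) = 0 + 1 := by omega
        simp only [Gen.parity, hp] at this
        exact this
      exact add_mem (sum_mem fun i _ => zsmul_mem (hm _ _ _) _)
        (sum_mem fun i _ => zsmul_mem (hm _ _ _) _)
    · exact zero_mem _
  | ghost j hj S μ ν =>
    simp only [gammaGen]
    rcases Nat.eq_zero_or_pos j with h0 | h0
    · subst h0
      simp [ghostGauge, zero_mem]
    · have hm : ∀ ρ μ' ν', gen (.ghost (j - 1) (by omega) (ρ ::ₘ S) μ' ν') ∈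
          commSubgroup y ((Gen.ghost j hj S μ ν).parity + 1) := by
        intro ρ μ' ν'
        have := gen_comm y (.ghost (j - 1) (by omega) (ρ ::ₘ S) μ' ν')
        have hp : k - (j - 1) = k - j + 1 := by omega
        simp only [Gen.parity, hp] at this
        exact this
      exact add_mem (sum_mem fun i _ => sum_mem fun l _ => zsmul_mem (hm _ _ _) _)
        (zsmul_mem (sum_mem fun i _ => zsmul_mem (hm _ _ _) _) _)

theorem isYoung_ghost (j : ℕ) (hj : j < k) (S : Multiset (Fin D)) :
    IsYoung fun μ ν => gen (.ghost j hj S μ ν) :=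
  isYoung_map (mk (k := k) (D := D) : FreeAlgebra ℝ (Gen k D) →+ LocalForm k D) fun z hz => by
    have := mk_rel (Rel.ghost j hj S z hz)
    rwa [map_zero] at this

theorem isYoung_t (S : Multiset (Fin D)) :
    IsYoung fun (μ ν : Fin k → Fin D) => gen (.t S μ ν) :=
  isYoung_map (mk (k := k) (D := D) : FreeAlgebra ℝ (Gen k D) →+ LocalForm k D) fun z hz => by
    have := mk_rel (Rel.t S z hz)
    rwa [map_zero] at this

theorem isYoung_tStar (S : Multiset (Fin D)) :
    IsYoung fun (μ ν : Fin k → Fin D) => gen (.tStar S μ ν) :=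
  isYoung_map (mk (k := k) (D := D) : FreeAlgebra ℝ (Gen k D) →+ LocalForm k D) fun z hz => by
    have := mk_rel (Rel.tStar S z hz)
    rwa [map_zero] at this

theorem isYoung_ghostStar (j : ℕ) (hj : j < k) (S : Multiset (Fin D)) :
    IsYoung fun μ ν => gen (.ghostStar j hj S μ ν) :=
  isYoung_map (mk (k := k) (D := D) : FreeAlgebra ℝ (Gen k D) →+ LocalForm k D) fun z hz => by
    have := mk_rel (Rel.ghostStar j hj S z hz)
    rwa [map_zero] at this

theorem isYoung_gamma_t (S : Multiset (Fin D)) :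
    IsYoung fun (μ ν : Fin k → Fin D) => gammaGen (.t S μ ν) := by
  cases k with
  | zero => constructor <;> simp [gammaGen]
  | succ n =>
    have h := IsYoung.fieldGauge (fun ρ => isYoung_ghost (k := n + 1) n (by omega) (ρ ::ₘ S))
    simpa [gammaGen] using h

theorem isYoung_gamma_ghost (j : ℕ) (hj : j < k) (S : Multiset (Fin D)) :
    IsYoung fun μ ν => gammaGen (.ghost j hj S μ ν) := by
  obtain ⟨n, rfl⟩ : ∃ n, k = n + 1 := ⟨k - 1, by omega⟩
  exact IsYoung.ghostGauge (fun ρ => isYoung_ghost (k := n + 1) (j - 1) (by omega) (ρ ::ₘ S))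

theorem isYoung_zero : IsYoung fun (_ : Fin k → ι) (_ : Fin j → ι) => (0 : M) := by
  constructor <;> simp

theorem IsYoung.smul [Module ℝ M] {X : (Fin k → ι) → (Fin j → ι) → M} (hX : IsYoung X)
    (r : ℝ) : IsYoung fun μ ν => r • X μ ν where
  left a b hab μ ν := by rw [hX.left a b hab, smul_neg]
  right a b hab μ ν := by rw [hX.right a b hab, smul_neg]
  bianchi h μ ν := by rw [← Finset.smul_sum, ← hX.bianchi h]

/-- The matrix `(x, γ x; 0, (-1)^{ε(x)} x)` of a generator `x`. Multiplicativity in `x` is the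
Leibniz rule of an odd right derivation. -/
def gammaMatrix (x : Gen k D) : Matrix (Fin 2) (Fin 2) (LocalForm k D) :=
  !![gen x, gammaGen x; 0, (-1 : ℝ) ^ x.parity • gen x]

theorem youngRel_matrix {j : ℕ} {S : (Fin k → Fin D) → (Fin j → Fin D) → Gen k D} (e : ℕ)
    (hp : ∀ μ ν, (S μ ν).parity = e) (h1 : IsYoung fun μ ν => gen (S μ ν))
    (h2 : IsYoung fun μ ν => gammaGen (S μ ν)) {z : FreeAlgebra ℝ (Gen k D)}
    (hz : YoungRel (fun μ ν => FreeAlgebra.ι ℝ (S μ ν)) z) :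
    FreeAlgebra.lift ℝ gammaMatrix z = 0 := by
  have key : ∀ a b : Fin 2, IsYoung fun μ ν => gammaMatrix (S μ ν) a b := by
    intro a b
    fin_cases a <;> fin_cases b
    · exact h1
    · exact h2
    · exact isYoung_zero
    · simp only [gammaMatrix, hp]
      exact h1.smul _
  ext a b
  have := hz.map_eq_zero
    ((Matrix.entryAddMonoidHom (LocalForm k D) a b).comp
      (FreeAlgebra.lift ℝ (gammaMatrix (k := k) (D := D)) :
        FreeAlgebra ℝ (Gen k D) →+ Matrix (Fin 2) (Fin 2) (LocalForm k D)))
    (by simpa using key a b)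
  simpa using this

/-- The homomorphism `a ↦ (a, γ a; 0, (-1)^{ε(a)} a)`. -/
def gammaHom : LocalForm k D →ₐ[ℝ] Matrix (Fin 2) (Fin 2) (LocalForm k D) :=
  lift (FreeAlgebra.lift ℝ gammaMatrix) <| by
    intro u v h
    cases h with
    | comm x y =>
      have hs : ∀ m : ℕ, ((-1 : ℝ) ^ m) * (-1) ^ m = 1 := by
        intro m; rw [← mul_pow]; simp
      rw [map_smul, map_mul, map_mul, FreeAlgebra.lift_ι_apply, FreeAlgebra.lift_ι_apply]
      have h1 := gen_comm x y
      have h2 := gen_gammaGen_comm y x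
      have h3 := gen_gammaGen_comm x y
      ext a b
      fin_cases a <;> fin_cases b
      · simpa [gammaMatrix, Matrix.mul_apply, Fin.sum_univ_two] using h1
      · simp [gammaMatrix, Matrix.mul_apply, Fin.sum_univ_two]
        rw [h2, h3]
        have e1 : (-1 : ℝ) ^ (x.parity * (y.parity + 1)) =
            (-1) ^ (x.parity * y.parity) * (-1) ^ x.parity := by rw [← pow_add]; ring_nf
        have e2 : (-1 : ℝ) ^ (x.parity * y.parity) * (-1) ^ (y.parity * (x.parity + 1)) =
            (-1) ^ y.parity := by
          have := hs (x.parity * y.parity)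
          have e3 : y.parity * (x.parity + 1) = x.parity * y.parity + y.parity := by ring
          rw [e3, pow_add, ← mul_assoc, this, one_mul]
        simp only [smul_smul, e1, e2]
        abel
      · simp [gammaMatrix, Matrix.mul_apply, Fin.sum_univ_two]
      · simp [gammaMatrix, Matrix.mul_apply, Fin.sum_univ_two]
        rw [h1]
        module
    | t S z hz =>
      rw [map_zero]
      exact youngRel_matrix (S := Gen.t S) 0 (fun _ _ => rfl) (isYoung_t S) (isYoung_gamma_t S) hz
    | t_symm S μ ν =>
      rw [FreeAlgebra.lift_ι_apply, FreeAlgebra.lift_ι_apply]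
      have h1 : gen (Gen.t S μ ν) = gen (Gen.t S ν μ) :=
        mk_rel (Rel.t_symm S μ ν)
      have h2 : gammaGen (Gen.t S μ ν) = gammaGen (Gen.t S ν μ) := by
        simp only [gammaGen, fieldGauge, add_comm]
      simp only [gammaMatrix, h1, h2]
      rfl
    | ghost j hj S z hz =>
      rw [map_zero]
      exact youngRel_matrix (S := Gen.ghost j hj S) (k - j) (fun _ _ => rfl) (isYoung_ghost j hj S)
        (isYoung_gamma_ghost j hj S) hz
    | tStar S z hz =>
      rw [map_zero]
      exact youngRel_matrix (S := Gen.tStar S) 1 (fun _ _ => rfl) (isYoung_tStar S) isYoung_zero hz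
    | tStar_symm S μ ν =>
      rw [FreeAlgebra.lift_ι_apply, FreeAlgebra.lift_ι_apply]
      have h1 : gen (Gen.tStar S μ ν) = gen (Gen.tStar S ν μ) :=
        mk_rel (Rel.tStar_symm S μ ν)
      simp only [gammaMatrix, h1]
      rfl
    | ghostStar j hj S z hz =>
      rw [map_zero]
      exact youngRel_matrix (S := Gen.ghostStar j hj S) (k - j + 1) (fun _ _ => rfl) (isYoung_ghostStar j hj S) isYoung_zero hz

/-- The exterior longitudinal derivative `γ`: the odd right derivation of the algebra of local
forms, commuting with the `∂_ρ`, with the values `gammaGen` on the generators. -/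
def gamma : LocalForm k D →ₗ[ℝ] LocalForm k D :=
  (Matrix.entryLinearMap ℝ (LocalForm k D) (0 : Fin 2) (1 : Fin 2)).comp
    (gammaHom (k := k) (D := D)).toLinearMap

theorem gammaHom_gen (x : Gen k D) : gammaHom (gen x) = gammaMatrix x := by
  rw [gammaHom, gen, lift_mk, FreeAlgebra.lift_ι_apply]

theorem gamma_gen (x : Gen k D) : gamma (gen x) = gammaGen x := by
  simp [gamma, gammaHom_gen, gammaMatrix]

theorem gammaHom_col (a : LocalForm k D) : gammaHom a 0 0 = a ∧ gammaHom a 1 0 = 0 := by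
  obtain ⟨f, rfl⟩ := mk_surjective a
  induction f using FreeAlgebra.induction with
  | grade0 r => simp [Matrix.algebraMap_matrix_apply]
  | grade1 x => exact ⟨by rw [← gen, gammaHom_gen]; rfl, by rw [← gen, gammaHom_gen]; rfl⟩
  | mul a b ha hb => simp [Matrix.mul_apply, Fin.sum_univ_two, ha, hb]
  | add a b ha hb => simp [ha, hb]

/-- The Leibniz rule. -/
theorem gamma_mul_gen (a : LocalForm k D) (x : Gen k D) :
    gamma (a * gen x) = a * gamma (gen x) + (-1 : ℝ) ^ x.parity • (gamma a * gen x) := by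
  simp [gamma, Matrix.mul_apply, Fin.sum_univ_two, gammaHom_col, gammaHom_gen, gammaMatrix]

/-- Elements of pure ghost number `l`. -/
def pghPart (k D l : ℕ) : Submodule ℝ (LocalForm k D) :=
  Submodule.span ℝ {z | ∃ L : List (Gen k D), (L.map Gen.pgh).sum = l ∧ z = (L.map gen).prod}

/-- Elements of pure ghost number `l`, antighost number `j` and form degree `p`. -/
def homogeneousPart (k D l j p : ℕ) : Submodule ℝ (LocalForm k D) :=
  Submodule.span ℝ {z | ∃ L : List (Gen k D), (L.map Gen.pgh).sum = l ∧
    (L.map Gen.agh).sum = j ∧ (L.map Gen.formDeg).sum = p ∧ z = (L.map gen).prod}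

/-- The `γ`-closed elements of pure ghost number `l`. -/
def cocycles (k D l : ℕ) : Submodule ℝ (LocalForm k D) :=
  LinearMap.ker gamma ⊓ pghPart k D l

/-- `H^l(γ)`: `γ`-closed elements of pure ghost number `l` modulo `γ`-exact ones. -/
abbrev HGamma (k D l : ℕ) : Type :=
  cocycles k D l ⧸ (LinearMap.range (gamma (k := k) (D := D))).submoduleOf (cocycles k D l)

/-- `∂_S F_{μ₁⋯μ_{k+1}|ν₁⋯ν_{k+1}}`, where `F = ∂_{[μ₁} t_{μ₂⋯μ_{k+1}]|[ν₂⋯ν_{k+1},ν₁]}`. -/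
def curvature (S : Multiset (Fin D)) (μ ν : Fin (k + 1) → Fin D) : LocalForm k D :=
  ∑ i : Fin (k + 1), ∑ l : Fin (k + 1), (-1 : ℤ) ^ (i.1 + l.1) •
    gen (.t (μ i ::ₘ ν l ::ₘ S) (omitAt μ i) (omitAt ν l))

/-- The invariant polynomials `α([χ*], [F])`: (form-valued) polynomials in the antifields, the
curvature and their derivatives. -/
def invariantPolynomials (k D : ℕ) : Subalgebra ℝ (LocalForm k D) :=
  Algebra.adjoin ℝ
    ({z | ∃ ρ, z = gen (.dx ρ)} ∪
      {z | ∃ S μ ν, z = gen (.tStar S μ ν)} ∪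
      {z | ∃ j hj S μ ν, z = gen (.ghostStar j hj S μ ν)} ∪
      {z | ∃ S μ ν, z = curvature S μ ν})

/-- The undifferentiated top ghost `η^{(k-1)}_{μ₁⋯μ_k}`. -/
def topGhost (hk : 0 < k) (μ : Fin k → Fin D) : LocalForm k D :=
  gen (.ghost 0 hk 0 μ Fin.elim0)

/-- `∂_{[μ₁} η^{(k-1)}_{μ₂⋯μ_{k+1}]}`. -/
def topGhostCurl (hk : 0 < k) (μ : Fin (k + 1) → Fin D) : LocalForm k D :=
  ∑ i : Fin (k + 1), (-1 : ℤ) ^ i.1 • gen (.ghost 0 hk {μ i} (omitAt μ i) Fin.elim0)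

/-- The polynomials of pure ghost number `l` in the top ghost and its antisymmetrized first
derivative. -/
def topGhostPolynomials (hk : 0 < k) (D l : ℕ) : Submodule ℝ (LocalForm k D) :=
  Subalgebra.toSubmodule (Algebra.adjoin ℝ
    ({z | ∃ μ, z = topGhost hk μ} ∪ {z | ∃ μ, z = topGhostCurl hk μ})) ⊓ pghPart k D l

end MixedBRST

/-!
The cohomology of `γ` is computed by Hodge theory with respect to a contracting homotopy.

The field `t`, the ghosts and all their derivatives form a single family of tensors
`X_{S; μ₁⋯μ_a|ν₁⋯ν_b}` with a multiset `S` of derivative indices (`genFam`). On such families act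
creators and annihilators of indices: two sets of fermionic ones for the two antisymmetric columns
and one set of bosonic ones for the derivative indices (`Oscillators`). Mixed symmetry of the family
`X` is the equation `E X = 0`, where `E` moves an index of the second column to the first one
(`E_false_genFam`), and `γ` acts as the gauge operator `L = d₁ S + (n₁ - n₂ + 1) d₂`, up to a sign
(`post_gamma`). Here `d₁`, `d₂` are the exterior derivatives on the columns, `S` is the adjoint
of `E`, and `n₁`, `n₂` are the lengths of the columns.

The odd derivation `htpy` which moves a derivative index of a ghost to the second column is
well defined, and `lap = γ htpy + htpy γ` is an even derivation commuting with `γ`. By the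
commutation relations of the bilinears in the oscillators it acts on the family of generators as
`(n₁ - n₂ + 2) (p + n₂) - C`, where `p` is the number of derivative indices and `C` is a quadratic
operator (`post_lap`). On the components with `(n₁, n₂) = (k, b)` the quadratic relations between
`C`, `htpy γ` and the curvature operator followed by its adjoint (`lap_chain`) split each generator
into eigenvectors with the eigenvalues `(q + 2) x`, `(q + 1) x`, `(q + 1) (x - 1)` and
`q (x - 1)`, with `q = k - b ≥ 0` and `x = p + b`. These are non-negative, and the eigenvectors
for the eigenvalue zero are combinations of derivatives of the curvature, top ghosts and their curls
(`genFun_mem_modes`). The `dx^ρ` and the antifields are annihilated by `γ` and `htpy`.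

Since `lap` is a derivation, the whole algebra is the sum of the algebra generated by these zero
modes, on which `γ` vanishes, and of eigenspaces with positive eigenvalues, on which every cocycle
is exact (`exists_zeroModeAlgebra_add_gamma`). The image of `γ` lies in the second summand
(`eq_zero_of_zeroModeAlgebra_of_exact`). So the cohomology is the algebra of the zero modes. A
product of zero modes is, up to a sign, an invariant polynomial times a product of `m` top ghosts
and curls, which has pure ghost number `k m`; projecting to a definite degree (`degProj`) gives all
the claims.
-/

namespace MixedBRST

section

/-! ### Oscillator algebra and its bilinears -/

/-- Two columns of fermionic oscillators and one row of bosonic ones in a ring: `c i` annihilates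
and `d i` creates an index of the column `i`, `x` annihilates and `y` creates a derivative index.
Oscillators of different columns commute rather than anticommute; this is the sign convention
of tensors `X_{μ|ν}` with two separate sets of antisymmetric indices. -/
structure Oscillators (ι R : Type*) [Ring R] [DecidableEq ι] where
  c : Bool → ι → R
  d : Bool → ι → R
  x : ι → R
  y : ι → R
  cc : ∀ i ρ σ, c i ρ * c i σ = -(c i σ * c i ρ)
  dd : ∀ i ρ σ, d i ρ * d i σ = -(d i σ * d i ρ)
  cd : ∀ i ρ σ, c i ρ * d i σ = (if ρ = σ then 1 else 0) - d i σ * c i ρ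
  cc' : ∀ i ρ σ, c i ρ * c (!i) σ = c (!i) σ * c i ρ
  dd' : ∀ i ρ σ, d i ρ * d (!i) σ = d (!i) σ * d i ρ
  cd' : ∀ i ρ σ, c i ρ * d (!i) σ = d (!i) σ * c i ρ
  xx : ∀ ρ σ, x ρ * x σ = x σ * x ρ
  yy : ∀ ρ σ, y ρ * y σ = y σ * y ρ
  xy : ∀ ρ σ, x ρ * y σ = (if ρ = σ then 1 else 0) + y σ * x ρ
  xc : ∀ i ρ σ, x ρ * c i σ = c i σ * x ρ
  xd : ∀ i ρ σ, x ρ * d i σ = d i σ * x ρ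
  yc : ∀ i ρ σ, y ρ * c i σ = c i σ * y ρ
  yd : ∀ i ρ σ, y ρ * d i σ = d i σ * y ρ

namespace Oscillators

variable {ι R : Type*} [Ring R] [DecidableEq ι] (O : Oscillators ι R) (i : Bool)

theorem dc (i : Bool) (ρ σ : ι) :
    O.d i ρ * O.c i σ = (if ρ = σ then 1 else 0) - O.c i σ * O.d i ρ := by
  rw [O.cd]; simp [eq_comm]

theorem dc' (i : Bool) (ρ σ : ι) : O.d i ρ * O.c (!i) σ = O.c (!i) σ * O.d i ρ := by
  have := O.cd' (!i) σ ρ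
  rw [Bool.not_not] at this
  exact this.symm

variable [Fintype ι]

/-- The exterior derivative on the column `i`: a derivative index becomes an index of the
column. -/
def A : R := ∑ ρ, O.d i ρ * O.x ρ

/-- The contraction adjoint to `A`: an index of the column `i` becomes a derivative index. -/
def B : R := ∑ ρ, O.y ρ * O.c i ρ

/-- Moves an index from the other column to the column `i`. -/
def E : R := ∑ ρ, O.d i ρ * O.c (!i) ρ

/-- The number of indices of the column `i`. -/
def n : R := ∑ ρ, O.d i ρ * O.c i ρ

/-- The number of derivative indices. -/
def nx : R := ∑ ρ, O.y ρ * O.x ρ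

theorem sum_d_x : ∑ ρ, O.d i ρ * O.x ρ = O.A i := rfl

theorem sum_y_c : ∑ ρ, O.y ρ * O.c i ρ = O.B i := rfl

theorem sum_d_c : ∑ ρ, O.d i ρ * O.c i ρ = O.n i := rfl

theorem sum_d_c' : ∑ ρ, O.d i ρ * O.c (!i) ρ = O.E i := rfl

theorem sum_y_x : ∑ ρ, O.y ρ * O.x ρ = O.nx := rfl

/-! The adjoint action of the bilinears on the oscillators. -/

theorem x_B (ρ : ι) : O.x ρ * O.B i = O.c i ρ + O.B i * O.x ρ := by
  simp only [B, Finset.mul_sum, Finset.sum_mul, ← mul_assoc, O.xy, add_mul, ite_mul, one_mul,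
    zero_mul, Finset.sum_add_distrib, Finset.sum_ite_eq, Finset.mem_univ, if_true]
  simp only [mul_assoc, O.xc]

theorem d_B (ρ : ι) : O.d i ρ * O.B i = O.y ρ - O.B i * O.d i ρ := by
  simp only [B, Finset.mul_sum, Finset.sum_mul, ← mul_assoc, ← O.yd]
  simp only [mul_assoc, O.dc, mul_sub, mul_ite, mul_one, mul_zero, Finset.sum_sub_distrib,
    Finset.sum_ite_eq, Finset.mem_univ, if_true]

theorem d_B' (ρ : ι) : O.d i ρ * O.B (!i) = O.B (!i) * O.d i ρ := by
  simp only [B, Finset.mul_sum, Finset.sum_mul, ← mul_assoc, ← O.yd]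
  simp only [mul_assoc, O.dc']

theorem c_B (ρ : ι) : O.c i ρ * O.B i = -(O.B i * O.c i ρ) := by
  simp only [B, Finset.mul_sum, Finset.sum_mul, ← mul_assoc, ← O.yc, ← Finset.sum_neg_distrib]
  simp only [mul_assoc, O.cc i ρ, mul_neg]

theorem c_B' (ρ : ι) : O.c i ρ * O.B (!i) = O.B (!i) * O.c i ρ := by
  simp only [B, Finset.mul_sum, Finset.sum_mul, ← mul_assoc, ← O.yc]
  simp only [mul_assoc, O.cc' i ρ]

theorem y_B (ρ : ι) : O.y ρ * O.B i = O.B i * O.y ρ := by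
  simp only [B, Finset.mul_sum, Finset.sum_mul, mul_assoc, ← O.yc]
  simp only [← mul_assoc, O.yy ρ]

theorem d_A (ρ : ι) : O.d i ρ * O.A i = -(O.A i * O.d i ρ) := by
  simp only [A, Finset.mul_sum, Finset.sum_mul, mul_assoc, O.xd, ← Finset.sum_neg_distrib]
  simp only [← mul_assoc, O.dd i ρ, neg_mul]

theorem d_A' (ρ : ι) : O.d i ρ * O.A (!i) = O.A (!i) * O.d i ρ := by
  simp only [A, Finset.mul_sum, Finset.sum_mul, mul_assoc, O.xd]
  simp only [← mul_assoc, O.dd' i ρ]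

theorem x_A (ρ : ι) : O.x ρ * O.A i = O.A i * O.x ρ := by
  simp only [A, Finset.mul_sum, Finset.sum_mul, ← mul_assoc, O.xd]
  simp only [mul_assoc, O.xx ρ]

theorem E_x (ρ : ι) : O.E i * O.x ρ = O.x ρ * O.E i := by
  simp only [E, Finset.mul_sum, Finset.sum_mul, mul_assoc, ← O.xc]
  simp only [← mul_assoc, ← O.xd]

theorem E_y (ρ : ι) : O.E i * O.y ρ = O.y ρ * O.E i := by
  simp only [E, Finset.mul_sum, Finset.sum_mul, mul_assoc, ← O.yc]
  simp only [← mul_assoc, ← O.yd]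

theorem E_d (ρ : ι) : O.E i * O.d i ρ = -(O.d i ρ * O.E i) := by
  simp only [E, Finset.mul_sum, Finset.sum_mul, mul_assoc, ← O.dc', ← Finset.sum_neg_distrib]
  simp only [← mul_assoc, O.dd i ρ, neg_mul, neg_neg]

theorem E_d' (ρ : ι) : O.E i * O.d (!i) ρ = O.d i ρ - O.d (!i) ρ * O.E i := by
  simp only [E, Finset.mul_sum, Finset.sum_mul, mul_assoc, O.cd, mul_sub, mul_ite, mul_one,
    mul_zero, Finset.sum_sub_distrib, Finset.sum_ite_eq', Finset.mem_univ, if_true]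
  simp only [← mul_assoc, O.dd']

theorem E_c (ρ : ι) : O.E i * O.c i ρ = O.c (!i) ρ - O.c i ρ * O.E i := by
  simp only [E, Finset.mul_sum, Finset.sum_mul, mul_assoc, ← O.cc']
  simp only [← mul_assoc, O.dc, sub_mul, ite_mul, one_mul,
    zero_mul, Finset.sum_sub_distrib, Finset.sum_ite_eq', Finset.mem_univ, if_true]

theorem E_c' (ρ : ι) : O.E i * O.c (!i) ρ = -(O.c (!i) ρ * O.E i) := by
  simp only [E, Finset.mul_sum, Finset.sum_mul, mul_assoc, O.cc _ _ ρ, ← Finset.sum_neg_distrib]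
  simp only [← mul_assoc, ← O.dc', mul_neg]

theorem n_d (ρ : ι) : O.n i * O.d i ρ = O.d i ρ * O.n i + O.d i ρ := by
  simp only [n, Finset.mul_sum, Finset.sum_mul, mul_assoc, O.cd, mul_sub, mul_ite, mul_one,
    mul_zero, Finset.sum_sub_distrib, Finset.sum_ite_eq', Finset.mem_univ, if_true]
  simp only [← mul_assoc, O.dd i _ ρ, neg_mul, Finset.sum_neg_distrib]
  abel

theorem n_d' (ρ : ι) : O.n i * O.d (!i) ρ = O.d (!i) ρ * O.n i := by
  simp only [n, Finset.mul_sum, Finset.sum_mul, mul_assoc, O.cd']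
  simp only [← mul_assoc, O.dd']

theorem n_c (ρ : ι) : O.n i * O.c i ρ = O.c i ρ * O.n i - O.c i ρ := by
  have h : ∀ σ, O.d i σ * O.c i σ * O.c i ρ =
      O.c i ρ * (O.d i σ * O.c i σ) - if σ = ρ then O.c i σ else 0 := by
    intro σ
    rw [mul_assoc, O.cc i σ ρ, mul_neg, ← mul_assoc, O.dc, sub_mul, ite_mul, one_mul, zero_mul,
      neg_sub, mul_assoc]
  simp only [n, Finset.mul_sum, Finset.sum_mul, h, Finset.sum_sub_distrib, Finset.sum_ite_eq',
    Finset.mem_univ, if_true]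

theorem n_c' (ρ : ι) : O.n i * O.c (!i) ρ = O.c (!i) ρ * O.n i := by
  simp only [n, Finset.mul_sum, Finset.sum_mul, mul_assoc, O.cc']
  simp only [← mul_assoc, O.dc']

theorem n_x (ρ : ι) : O.n i * O.x ρ = O.x ρ * O.n i := by
  simp only [n, Finset.mul_sum, Finset.sum_mul, mul_assoc, ← O.xc]
  simp only [← mul_assoc, ← O.xd]

theorem n_y (ρ : ι) : O.n i * O.y ρ = O.y ρ * O.n i := by
  simp only [n, Finset.mul_sum, Finset.sum_mul, mul_assoc, ← O.yc]
  simp only [← mul_assoc, ← O.yd]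

theorem nx_c (ρ : ι) : O.nx * O.c i ρ = O.c i ρ * O.nx := by
  simp only [nx, Finset.mul_sum, Finset.sum_mul, mul_assoc, O.xc]
  simp only [← mul_assoc, O.yc]

theorem nx_y (ρ : ι) : O.nx * O.y ρ = O.y ρ * O.nx + O.y ρ := by
  simp only [nx, Finset.mul_sum, Finset.sum_mul, mul_assoc, O.xy, mul_add, mul_ite, mul_one,
    mul_zero, Finset.sum_add_distrib, Finset.sum_ite_eq', Finset.mem_univ, if_true]
  simp only [← mul_assoc, O.yy ρ]
  abel

/-! The relations of the superalgebra `gl(1|2)`, with the signs of the present convention. -/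

theorem A_B : O.A i * O.B i = O.n i + O.nx - O.B i * O.A i := by
  conv_lhs => enter [1]; rw [A]
  rw [Finset.sum_mul]
  simp only [mul_assoc, O.x_B, mul_add]
  simp only [← mul_assoc, O.d_B, sub_mul, Finset.sum_add_distrib, Finset.sum_sub_distrib]
  simp only [mul_assoc, ← Finset.mul_sum, O.sum_d_x, O.sum_d_c, O.sum_y_x]
  abel

theorem A_B' : O.A i * O.B (!i) = O.E i + O.B (!i) * O.A i := by
  conv_lhs => enter [1]; rw [A]
  rw [Finset.sum_mul]
  simp only [mul_assoc, O.x_B, mul_add]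
  simp only [← mul_assoc, O.d_B', Finset.sum_add_distrib]
  simp only [mul_assoc, ← Finset.mul_sum, O.sum_d_x, O.sum_d_c']

theorem A_A' : O.A i * O.A (!i) = O.A (!i) * O.A i := by
  conv_lhs => enter [1]; rw [A]
  rw [Finset.sum_mul]
  simp only [mul_assoc, O.x_A]
  simp only [← mul_assoc, O.d_A']
  simp only [mul_assoc, ← Finset.mul_sum, O.sum_d_x]

theorem B_B' : O.B i * O.B (!i) = O.B (!i) * O.B i := by
  conv_lhs => enter [1]; rw [B]
  rw [Finset.sum_mul]
  simp only [mul_assoc, O.c_B']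
  simp only [← mul_assoc, O.y_B]
  simp only [mul_assoc, ← Finset.mul_sum, O.sum_y_c]

theorem A_A [Algebra ℝ R] : O.A i * O.A i = 0 := by
  have h : O.A i * O.A i = -(O.A i * O.A i) := by
    conv_lhs => enter [1]; rw [A]
    rw [Finset.sum_mul]
    simp only [mul_assoc, O.x_A]
    simp only [← mul_assoc, O.d_A]
    simp only [mul_assoc, ← Finset.mul_sum, neg_mul, Finset.sum_neg_distrib, O.sum_d_x]
  have h2 : (2 : ℝ) • (O.A i * O.A i) = 0 := by
    rw [two_smul]; nth_rewrite 2 [h]; abel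
  exact (smul_eq_zero_iff_right two_ne_zero).1 h2

theorem B_B [Algebra ℝ R] : O.B i * O.B i = 0 := by
  have h : O.B i * O.B i = -(O.B i * O.B i) := by
    conv_lhs => enter [1]; rw [B]
    rw [Finset.sum_mul]
    simp only [mul_assoc, O.c_B, mul_neg]
    simp only [← mul_assoc, O.y_B]
    simp only [mul_assoc, ← Finset.mul_sum, Finset.sum_neg_distrib, O.sum_y_c]
  have h2 : (2 : ℝ) • (O.B i * O.B i) = 0 := by
    rw [two_smul]; nth_rewrite 2 [h]; abel
  exact (smul_eq_zero_iff_right two_ne_zero).1 h2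

theorem E_A : O.E i * O.A i = -(O.A i * O.E i) := by
  rw [A, Finset.mul_sum]
  simp only [← mul_assoc, O.E_d, neg_mul]
  simp only [mul_assoc, O.E_x]
  simp only [← mul_assoc, ← Finset.sum_mul, Finset.sum_neg_distrib, O.sum_d_x]

theorem E_A' : O.E i * O.A (!i) = O.A i - O.A (!i) * O.E i := by
  rw [A, Finset.mul_sum]
  simp only [← mul_assoc, O.E_d', sub_mul]
  simp only [mul_assoc, O.E_x]
  simp only [← mul_assoc, ← Finset.sum_mul, Finset.sum_sub_distrib, O.sum_d_x]

theorem E_B : O.E i * O.B i = O.B (!i) - O.B i * O.E i := by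
  rw [B, Finset.mul_sum]
  simp only [← mul_assoc, O.E_y]
  simp only [mul_assoc, O.E_c, mul_sub]
  simp only [← mul_assoc, ← Finset.sum_mul, Finset.sum_sub_distrib, O.sum_y_c]

theorem E_B' : O.E i * O.B (!i) = -(O.B (!i) * O.E i) := by
  rw [B, Finset.mul_sum]
  simp only [← mul_assoc, O.E_y]
  simp only [mul_assoc, O.E_c', mul_neg]
  simp only [← mul_assoc, ← Finset.sum_mul, Finset.sum_neg_distrib, O.sum_y_c]

theorem E_E' : O.E i * O.E (!i) = O.n i - O.n (!i) + O.E (!i) * O.E i := by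
  conv_lhs => enter [2]; rw [E, Bool.not_not]
  rw [Finset.mul_sum]
  simp only [← mul_assoc, O.E_d', sub_mul]
  simp only [mul_assoc, O.E_c, mul_sub]
  simp only [Finset.sum_sub_distrib]
  simp only [← mul_assoc, ← Finset.sum_mul, O.sum_d_c]
  have : ∑ j, O.d (!i) j * O.c i j = O.E (!i) := by rw [E, Bool.not_not]
  rw [this]
  abel

theorem n_A : O.n i * O.A i = O.A i * O.n i + O.A i := by
  rw [A, Finset.mul_sum]
  simp only [← mul_assoc, O.n_d, add_mul]
  simp only [mul_assoc, O.n_x]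
  simp only [← mul_assoc, ← Finset.sum_mul, Finset.sum_add_distrib, O.sum_d_x]

theorem n_A' : O.n i * O.A (!i) = O.A (!i) * O.n i := by
  rw [A, Finset.mul_sum]
  simp only [← mul_assoc, O.n_d']
  simp only [mul_assoc, O.n_x]
  simp only [← mul_assoc, ← Finset.sum_mul, O.sum_d_x]

theorem n_B : O.n i * O.B i = O.B i * O.n i - O.B i := by
  rw [B, Finset.mul_sum]
  simp only [← mul_assoc, O.n_y]
  simp only [mul_assoc, O.n_c, mul_sub]
  simp only [← mul_assoc, ← Finset.sum_mul, Finset.sum_sub_distrib, O.sum_y_c]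

theorem n_B' : O.n i * O.B (!i) = O.B (!i) * O.n i := by
  rw [B, Finset.mul_sum]
  simp only [← mul_assoc, O.n_y]
  simp only [mul_assoc, O.n_c']
  simp only [← mul_assoc, ← Finset.sum_mul, O.sum_y_c]

theorem nx_B : O.nx * O.B i = O.B i * O.nx + O.B i := by
  rw [B, Finset.mul_sum]
  simp only [← mul_assoc, O.nx_y, add_mul]
  simp only [mul_assoc, O.nx_c]
  simp only [← mul_assoc, ← Finset.sum_mul, Finset.sum_add_distrib, O.sum_y_c]

theorem nx_d (i : Bool) (ρ : ι) : O.nx * O.d i ρ = O.d i ρ * O.nx := by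
  simp only [nx, Finset.mul_sum, Finset.sum_mul, mul_assoc, O.xd]
  simp only [← mul_assoc, O.yd]

theorem nx_x (ρ : ι) : O.nx * O.x ρ = O.x ρ * O.nx - O.x ρ := by
  have h : ∀ σ, O.y σ * O.x σ * O.x ρ =
      O.x ρ * (O.y σ * O.x σ) - if ρ = σ then O.x σ else 0 := by
    intro σ
    rw [← mul_assoc, O.xy, add_mul, ite_mul, one_mul, zero_mul, mul_assoc, mul_assoc, O.xx ρ]
    abel
  simp only [nx, Finset.mul_sum, Finset.sum_mul, h, Finset.sum_sub_distrib, Finset.sum_ite_eq,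
    Finset.mem_univ, if_true]

theorem nx_A : O.nx * O.A i = O.A i * O.nx - O.A i := by
  rw [A, Finset.mul_sum]
  simp only [← mul_assoc, O.nx_d]
  simp only [mul_assoc, O.nx_x, mul_sub]
  simp only [← mul_assoc, ← Finset.sum_mul, Finset.sum_sub_distrib, O.sum_d_x]

theorem n_E : O.n i * O.E i = O.E i * O.n i + O.E i := by
  rw [E, Finset.mul_sum]
  simp only [← mul_assoc, O.n_d, add_mul]
  simp only [mul_assoc, O.n_c']
  simp only [← mul_assoc, ← Finset.sum_mul, Finset.sum_add_distrib, O.sum_d_c']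

theorem n_E' : O.n (!i) * O.E i = O.E i * O.n (!i) - O.E i := by
  have h := fun ρ => O.n_d' (!i) ρ
  rw [Bool.not_not] at h
  rw [E, Finset.mul_sum]
  simp only [← mul_assoc, h]
  simp only [mul_assoc, O.n_c, mul_sub]
  simp only [← mul_assoc, ← Finset.sum_mul, Finset.sum_sub_distrib, O.sum_d_c']

/-! The first column is `false`, the second one `true`. -/

/-- The difference of the lengths of the columns, plus one. -/
def m : R := O.n false - O.n true + 1

/-- The gauge operator: `d₁ S + (n₁ - n₂ + 1) d₂`, where `d₁`, `d₂` are the exterior derivatives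
on the two columns and `S` moves an index from the first to the second column. It maps tensors of
mixed symmetry `(k, j)` to tensors of mixed symmetry `(k, j + 1)`. -/
def L : R := O.A false * O.E true + O.m * O.A true

/-- The `gl(2)`-invariant quadratic operator of which the Laplacian is a shift. -/
def C : R := O.B false * O.A false + O.B true * O.A true

/-- The curvature `d₁ d₂` followed by its adjoint. -/
def Z : R := O.B false * (O.B true * (O.A false * O.A true))

/-- The Laplacian on tensors of mixed symmetry. -/
def D : R := (O.m + 1) * (O.nx + O.n true) - O.C

theorem E_m : O.E true * O.m = (O.m + 2) * O.E true := by
  have h4 : O.n false * O.E true = O.E true * O.n false - O.E true := O.n_E' true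
  rw [m]
  linear_combination (norm := noncomm_ring) O.n_E true - h4

theorem E_m' : O.E false * O.m = (O.m - 2) * O.E false := by
  have h4 : O.n true * O.E false = O.E false * O.n true - O.E false := O.n_E' false
  rw [m]
  linear_combination (norm := noncomm_ring) h4 - O.n_E false

theorem A_m : O.A false * O.m = (O.m - 1) * O.A false := by
  have h6 : O.n true * O.A false = O.A false * O.n true := O.n_A' true
  rw [m]
  linear_combination (norm := noncomm_ring) h6 - O.n_A false

theorem A_m' : O.A true * O.m = (O.m + 1) * O.A true := by
  have h5 : O.n false * O.A true = O.A true * O.n false := O.n_A' false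
  rw [m]
  linear_combination (norm := noncomm_ring) O.n_A true - h5

theorem B_m : O.B false * O.m = (O.m + 1) * O.B false := by
  have h6 : O.n true * O.B false = O.B false * O.n true := O.n_B' true
  rw [m]
  linear_combination (norm := noncomm_ring) h6 - O.n_B false

theorem B_m' : O.B true * O.m = (O.m - 1) * O.B true := by
  have h5 : O.n false * O.B true = O.B true * O.n false := O.n_B' false
  rw [m]
  linear_combination (norm := noncomm_ring) O.n_B true - h5

theorem A_N : O.A false * (O.nx + O.n true) = (O.nx + O.n true + 1) * O.A false := by
  have h6 : O.n true * O.A false = O.A false * O.n true := O.n_A' true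
  linear_combination (norm := noncomm_ring) -h6 - O.nx_A false

theorem A_N' : O.A true * (O.nx + O.n true) = (O.nx + O.n true) * O.A true := by
  linear_combination (norm := noncomm_ring) -O.n_A true - O.nx_A true

theorem B_N : O.B false * (O.nx + O.n true) = (O.nx + O.n true - 1) * O.B false := by
  have h6 : O.n true * O.B false = O.B false * O.n true := O.n_B' true
  linear_combination (norm := noncomm_ring) -h6 - O.nx_B false

theorem B_N' : O.B true * (O.nx + O.n true) = (O.nx + O.n true) * O.B true := by
  linear_combination (norm := noncomm_ring) -O.n_B true - O.nx_B true

/-- The gauge operator squares to zero; this is the reducibility of the gauge transformations. -/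
theorem L_mul_L [Algebra ℝ R] : O.L * O.L = 0 := by
  have h1 : O.E true * O.A false = O.A true - O.A false * O.E true := O.E_A' true
  have h7 : O.A false * O.A true = O.A true * O.A false := O.A_A' false
  have f1 : O.A false * O.E true * (O.A false * O.E true) = O.A false * O.A true * O.E true := by
    linear_combination (norm := noncomm_ring) O.A false * h1 * O.E true -
      O.A_A false * (O.E true * O.E true)
  have f2 : O.A false * O.E true * (O.m * O.A true) =
      -((O.m + 1) * O.A false * O.A true * O.E true) := by
    linear_combination (norm := noncomm_ring) O.A false * O.E_m * O.A true +
      O.A_m * (O.E true * O.A true) + (O.m + 1) * O.A false * O.E_A true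
  have f3 : O.m * O.A true * (O.m * O.A true) = 0 := by
    linear_combination (norm := noncomm_ring) O.m * O.A_m' * O.A true +
      O.m * (O.m + 1) * O.A_A true
  rw [L]
  linear_combination (norm := noncomm_ring) f1 + f2 + f3 - O.m * h7 * O.E true

/-- The curvature is gauge invariant. -/
theorem A_A_L [Algebra ℝ R] : O.A false * O.A true * O.L = 0 := by
  have h1 : O.A false * O.A true = O.A true * O.A false := O.A_A' false
  rw [L]
  linear_combination (norm := noncomm_ring) h1 * O.A false * O.E true +
    O.A true * O.A_A false * O.E true + O.A false * O.A_m' * O.A true +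
    O.A false * (O.m + 1) * O.A_A true

/-- The gauge operator preserves mixed symmetry, that is the kernel of `E false`. -/
theorem E_mul_L : O.E false * O.L =
    -((O.A false * O.E true + (O.m - 2) * O.A true) * O.E false) := by
  have h1 : O.E false * O.E true = O.n false - O.n true + O.E true * O.E false := O.E_E' false
  have h2 : O.E false * O.A true = O.A false - O.A true * O.E false := O.E_A' false
  have h3 : O.A false * O.m = (O.m - 1) * O.A false := O.A_m
  have h4 := O.E_m'
  have hm : O.n false - O.n true = O.m - 1 := by rw [m]; abel
  rw [hm] at h1
  rw [L]
  linear_combination (norm := noncomm_ring) O.E_A false * O.E true - O.A false * h1 - h3 +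
    h4 * O.A true + (O.m - 2) * h2

/-- On tensors of mixed symmetry the anticommutator of the gauge operator and the contraction on the
second column is the operator `D`. -/
theorem B_L_add_L_B : O.B true * O.L + O.L * O.B true = O.D - O.E true * O.E false := by
  have h1 : O.E false * O.E true = O.n false - O.n true + O.E true * O.E false := O.E_E' false
  have h2 : O.A false * O.B true = O.E false + O.B true * O.A false := O.A_B' false
  have h3 : O.E true * O.B true = O.B false - O.B true * O.E true := O.E_B true
  have hm : O.n false = O.m - 1 + O.n true := by rw [m]; abel
  have h4 := O.A_B false
  rw [hm] at h1 h4
  rw [L, D, C]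
  linear_combination (norm := noncomm_ring) O.B_m' * O.A true + O.A false * h3 + h4 - h2 * O.E true
    - h1 + O.m * O.A_B true

theorem C_mul_C [Algebra ℝ R] : O.C * O.C = (O.m + (O.nx + O.n true)) * O.C - O.B true * O.L +
    2 * O.Z - O.B false * O.A true * O.E false := by
  have hm : O.n false = O.m - 1 + O.n true := by rw [m]; abel
  have h1 : O.A false * O.B true = O.E false + O.B true * O.A false := O.A_B' false
  have h2 : O.A true * O.B false = O.E true + O.B false * O.A true := O.A_B' true
  have h3 : O.A true * O.A false = O.A false * O.A true := O.A_A' true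
  have h4 : O.E false * O.A true = O.A false - O.A true * O.E false := O.E_A' false
  have h5 : O.E true * O.A false = O.A true - O.A false * O.E true := O.E_A' true
  have h6 : O.B true * O.B false = O.B false * O.B true := O.B_B' true
  have h7 := O.A_B false
  rw [hm] at h7
  rw [C, Z, L]
  linear_combination (norm := noncomm_ring) O.B false * h7 * O.A false -
    O.B false * O.B false * O.A_A false + O.B_m * O.A false + O.B_N * O.A false +
    O.B true * O.A_B true * O.A true - O.B true * O.B true * O.A_A true + O.B_N' * O.A true +
    O.B false * h1 * O.A true + O.B false * h4 + O.B true * h2 * O.A false + O.B true * h5 +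
    h6 * O.A true * O.A false + O.B false * O.B true * h3 + O.B_m' * O.A true

/-! On tensors of mixed symmetry, where `E false` vanishes, the following three relations show that
`1`, `C`, `B true * L` and `Z` span an invariant space of `D`, in which `D` is triangular; the
coefficients depend on the numbers of indices. -/

theorem C_mul_D [Algebra ℝ R] : ∃ X, O.C * O.D = ((O.m + 1) * (O.nx + O.n true) -
    (O.m + (O.nx + O.n true))) * O.C + O.B true * O.L - 2 * O.Z + X * O.E false := by
  refine ⟨O.B false * O.A true, ?_⟩
  have h1 : O.C * O.m = O.m * O.C := by
    rw [C]
    linear_combination (norm := noncomm_ring) O.B false * O.A_m + O.B true * O.A_m' +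
      O.B_m * O.A false + O.B_m' * O.A true
  have h2 : O.C * (O.nx + O.n true) = (O.nx + O.n true) * O.C := by
    rw [C]
    linear_combination (norm := noncomm_ring) O.B false * O.A_N + O.B true * O.A_N' +
      O.B_N * O.A false + O.B_N' * O.A true
  have h3 := O.C_mul_C
  rw [D]
  linear_combination (norm := noncomm_ring) h1 * (O.nx + O.n true) + O.m * h2 + h2 - h3

theorem B_L_mul_D [Algebra ℝ R] : ∃ X, O.B true * O.L * O.D =
    ((O.m + 1) * (O.nx + O.n true) - (O.nx + O.n true)) * (O.B true * O.L) - (O.m - 1) * O.Z +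
      X * O.E false := by
  have h0 := O.B_L_add_L_B
  set Y := O.A false * O.E true + (O.m - 2) * O.A true with hY
  have hT : O.E false * O.L = -(Y * O.E false) := O.E_mul_L
  have h1 : O.A false * O.B true = O.E false + O.B true * O.A false := O.A_B' false
  have h2 : O.E false * O.B true = -(O.B true * O.E false) := O.E_B' false
  have h3 : O.A false * O.L = (O.m - 1) * O.A false * O.A true := by
    rw [L]
    linear_combination (norm := noncomm_ring) O.A_A false * O.E true + O.A_m * O.A true
  have h4 : O.C * (O.B true * O.L) = (O.nx + O.n true) * (O.B true * O.L) + (O.m - 1) * O.Z -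
      O.B false * Y * O.E false := by
    rw [C, Z]
    linear_combination (norm := noncomm_ring) O.B false * h1 * O.L + O.B false * hT +
      O.B true * O.A_B true * O.L - O.B_B true * (O.A true * O.L) + O.B_N' * O.L +
      O.B false * O.B true * h3 + O.B false * O.B_m' * O.A false * O.A true +
      O.B_m * O.B true * O.A false * O.A true
  refine ⟨O.B false * Y - O.E true * O.B true * Y + O.B true * O.L * O.E true, ?_⟩
  have h5 : O.D = O.B true * O.L + O.L * O.B true + O.E true * O.E false := by rw [h0]; abel
  have h6 : O.B true * O.L * O.D = O.D * (O.B true * O.L) +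
      (O.B true * O.L * O.E true - O.E true * O.B true * Y) * O.E false := by
    rw [h5]
    linear_combination (norm := noncomm_ring) O.B true * O.L_mul_L * O.B true -
      O.L * O.B_B true * O.L - O.E true * h2 * O.L + O.E true * O.B true * hT
  rw [h6]
  nth_rewrite 1 [D]
  linear_combination (norm := noncomm_ring) -h4

theorem Z_mul_D [Algebra ℝ R] : O.Z * O.D = ((O.m + 1) * (O.nx + O.n true) -
    (O.m - 1 + 2 * (O.nx + O.n true))) * O.Z := by
  have hm : O.n false = O.m - 1 + O.n true := by rw [m]; abel
  have h7 := O.A_B false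
  rw [hm] at h7
  have h3 : O.A true * O.A false = O.A false * O.A true := O.A_A' true
  have g1 : O.A false * O.A true * O.m = O.m * (O.A false * O.A true) := by
    linear_combination (norm := noncomm_ring) O.A false * O.A_m' + O.A_m * O.A true
  have g2 : O.A false * O.A true * (O.nx + O.n true) =
      (O.nx + O.n true + 1) * (O.A false * O.A true) := by
    linear_combination (norm := noncomm_ring) O.A false * O.A_N' + O.A_N * O.A true
  have g3 : O.B false * O.B true * O.m = O.m * (O.B false * O.B true) := by
    linear_combination (norm := noncomm_ring) O.B false * O.B_m' + O.B_m * O.B true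
  have g4 : O.B false * O.B true * (O.nx + O.n true) =
      (O.nx + O.n true - 1) * (O.B false * O.B true) := by
    linear_combination (norm := noncomm_ring) O.B false * O.B_N' + O.B_N * O.B true
  have h1 : O.Z * O.m = O.m * O.Z := by
    rw [Z]
    linear_combination (norm := noncomm_ring) O.B false * O.B true * g1 +
      g3 * (O.A false * O.A true)
  have h2 : O.Z * (O.nx + O.n true) = (O.nx + O.n true) * O.Z := by
    rw [Z]
    linear_combination (norm := noncomm_ring) O.B false * O.B true * g2 +
      g4 * (O.A false * O.A true)
  have h4 : O.A false * O.A true * O.C = (O.m - 1 + 2 * (O.nx + O.n true) + 2) *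
      (O.A false * O.A true) := by
    rw [C]
    linear_combination (norm := noncomm_ring) -h3 * O.B false * O.A false +
      O.A true * h7 * O.A false - O.A true * O.B false * O.A_A false +
      O.A_m' * O.A false + O.A_N' * O.A false + (O.m + (O.nx + O.n true)) * h3 +
      O.A false * O.A_B true * O.A true - O.A false * O.B true * O.A_A true + O.A_N * O.A true
  have h5 : O.Z * O.C = (O.m - 1 + 2 * (O.nx + O.n true)) * O.Z := by
    rw [Z]
    linear_combination (norm := noncomm_ring) O.B false * O.B true * h4 +
      g3 * (O.A false * O.A true) + 2 * g4 * (O.A false * O.A true)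
  rw [D]
  linear_combination (norm := noncomm_ring) h1 * (O.nx + O.n true) + O.m * h2 + h2 - h5

end Oscillators

end

section

/-! ### Families of antisymmetric tensors -/

/-- Sequences of antisymmetric tensors, the `n`-th one with `n` indices in `ι`, with components
in `N`. -/
def Alt (ι N : Type*) [AddCommGroup N] [Module ℝ N] :
    Submodule ℝ (∀ n : ℕ, (Fin n → ι) → N) where
  carrier := {Y | ∀ (n : ℕ) (a b : Fin n), a ≠ b → ∀ v, Y n (v ∘ Equiv.swap a b) = -Y n v}
  zero_mem' := by intro n a b _ v; simp
  add_mem' := by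
    intro Y Y' h h' n a b hab v
    simp only [Pi.add_apply, h n a b hab, h' n a b hab]
    abel
  smul_mem' := by
    intro r Y h n a b hab v
    simp only [Pi.smul_apply, h n a b hab, smul_neg]

namespace Alt

variable {ι N N' : Type*} [AddCommGroup N] [Module ℝ N] [AddCommGroup N'] [Module ℝ N']

/-- Acting with a linear map on the components. -/
def map (f : N →ₗ[ℝ] N') : Alt ι N →ₗ[ℝ] Alt ι N' where
  toFun Y := ⟨fun n v => f (Y.1 n v), fun n a b hab v => by
    dsimp only; rw [Y.2 n a b hab, map_neg]⟩
  map_add' Y Y' := by ext n v; simp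
  map_smul' r Y := by ext n v; simp

theorem map_apply (f : N →ₗ[ℝ] N') (Y : Alt ι N) (n : ℕ) (v : Fin n → ι) :
    (map f Y).1 n v = f (Y.1 n v) := rfl

/-- Contraction: the first index is set to `ρ`. -/
def contr (ρ : ι) : Alt ι N →ₗ[ℝ] Alt ι N where
  toFun Y := ⟨fun n v => Y.1 (n + 1) (Fin.cons ρ v), fun n a b hab v => by
    rw [← Y.2 (n + 1) a.succ b.succ (by simpa using hab)]
    refine congrArg (Y.1 _) ?_
    funext q
    refine Fin.cases ?_ (fun q => ?_) q
    · simp [Equiv.swap_apply_of_ne_of_ne (Fin.succ_ne_zero a).symm (Fin.succ_ne_zero b).symm]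
    · have : Equiv.swap a.succ b.succ q.succ = (Equiv.swap a b q).succ := by
        simp only [Equiv.swap_apply_def, Fin.succ_inj]
        split_ifs <;> rfl
      simp [this]⟩
  map_add' Y Y' := by ext n v; simp
  map_smul' r Y := by ext n v; simp

theorem contr_apply (ρ : ι) (Y : Alt ι N) (n : ℕ) (v : Fin n → ι) :
    (contr ρ Y).1 n v = Y.1 (n + 1) (Fin.cons ρ v) := rfl

theorem contr_contr (ρ σ : ι) (Y : Alt ι N) : contr ρ (contr σ Y) = -contr σ (contr ρ Y) := by
  ext n v
  simp only [Submodule.coe_neg, Pi.neg_apply, contr_apply]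
  rw [← Y.2 (n + 2) 0 1 (by simp)]
  refine congrArg (Y.1 _) ?_
  funext q
  refine Fin.cases ?_ (fun q => ?_) q
  · simp
  · refine Fin.cases ?_ (fun q => ?_) q
    · simp
    · have : Equiv.swap (0 : Fin (n + 2)) 1 q.succ.succ = q.succ.succ :=
        Equiv.swap_apply_of_ne_of_ne (Fin.succ_ne_zero _) (by simp [Fin.ext_iff])
      simp only [Function.comp, this, Fin.cons_succ]

variable [DecidableEq ι]

/-- The components of the exterior product with the basis covector of index `ρ`. -/
def wedgeFun (ρ : ι) (Y : ∀ n : ℕ, (Fin n → ι) → N) : ∀ n : ℕ, (Fin n → ι) → N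
  | 0, _ => 0
  | n + 1, v => ∑ i : Fin (n + 1), (-1 : ℤ) ^ i.1 • if v i = ρ then Y n (v ∘ i.succAbove) else 0

/-- The exterior product with the basis covector of index `ρ`. -/
def wedge (ρ : ι) : Alt ι N →ₗ[ℝ] Alt ι N where
  toFun Y := ⟨wedgeFun ρ Y.1, fun n a b hab v => by
    cases n with
    | zero => exact a.elim0
    | succ n =>
      have := extD_anti (g := fun x w => if x = ρ then Y.1 n w else 0)
        (fun x a b hab w => by split_ifs <;> simp [Y.2 n a b hab]) (Equiv.swap a b) v
      rw [Equiv.Perm.sign_swap hab] at this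
      simpa [wedgeFun] using this⟩
  map_add' Y Y' := by
    ext n v
    cases n with
    | zero => simp [wedgeFun]
    | succ n =>
      simp only [wedgeFun, Submodule.coe_add, Pi.add_apply, ← Finset.sum_add_distrib, ← smul_add]
      refine Finset.sum_congr rfl fun i _ => ?_
      split_ifs <;> simp
  map_smul' r Y := by
    ext n v
    cases n with
    | zero => simp [wedgeFun]
    | succ n =>
      simp only [wedgeFun, Submodule.coe_smul, Pi.smul_apply, Finset.smul_sum, RingHom.id_apply]
      refine Finset.sum_congr rfl fun i _ => ?_
      rw [smul_comm r]
      split_ifs <;> simp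

theorem wedge_zero (ρ : ι) (Y : Alt ι N) (v : Fin 0 → ι) : (wedge ρ Y).1 0 v = 0 := rfl

theorem wedge_succ (ρ : ι) (Y : Alt ι N) (n : ℕ) (v : Fin (n + 1) → ι) :
    (wedge ρ Y).1 (n + 1) v =
      ∑ i : Fin (n + 1), (-1 : ℤ) ^ i.1 • if v i = ρ then Y.1 n (v ∘ i.succAbove) else 0 := rfl

theorem map_wedge (f : N →ₗ[ℝ] N') (ρ : ι) (Y : Alt ι N) :
    map f (wedge ρ Y) = wedge ρ (map f Y) := by
  ext n v
  cases n with
  | zero => simp [map_apply, wedge_zero]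
  | succ n =>
    simp only [map_apply, wedge_succ, map_sum, map_zsmul]
    refine Finset.sum_congr rfl fun i _ => ?_
    split_ifs <;> simp

theorem contr_wedge (ρ σ : ι) (Y : Alt ι N) :
    contr ρ (wedge σ Y) = (if ρ = σ then Y else 0) - wedge σ (contr ρ Y) := by
  ext n v
  rw [contr_apply, wedge_succ, Fin.sum_univ_succ]
  have h0 : (Fin.cons ρ v : Fin (n + 1) → ι) ∘ Fin.succAbove 0 = v := by
    funext q; simp
  simp only [Fin.cons_zero, Fin.val_zero, pow_zero, one_smul, h0, Submodule.coe_sub, Pi.sub_apply,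
    Fin.cons_succ, Fin.val_succ, pow_succ, mul_neg, mul_one, neg_smul, Finset.sum_neg_distrib,
    ← sub_eq_add_neg]
  congr 1
  · split_ifs <;> rfl
  · cases n with
    | zero => simp [wedge_zero]
    | succ n =>
      rw [wedge_succ]
      refine Finset.sum_congr rfl fun i _ => ?_
      have : (Fin.cons ρ v : Fin (n + 2) → ι) ∘ i.succ.succAbove =
          Fin.cons ρ (v ∘ i.succAbove) := by
        funext q
        refine Fin.cases ?_ (fun q => ?_) q <;> simp
      rw [contr_apply, this]

theorem wedge_wedge (ρ σ : ι) (Y : Alt ι N) : wedge ρ (wedge σ Y) = -wedge σ (wedge ρ Y) := by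
  rw [eq_neg_iff_add_eq_zero]
  ext n v
  induction n generalizing Y with
  | zero => simp [wedge_zero]
  | succ n ih =>
    -- contractions commute with the anticommutator of two exterior products
    have h : contr (v 0) (wedge ρ (wedge σ Y) + wedge σ (wedge ρ Y)) =
        wedge ρ (wedge σ (contr (v 0) Y)) + wedge σ (wedge ρ (contr (v 0) Y)) := by
      simp only [map_add, contr_wedge, map_sub]
      split_ifs <;> (try simp only [map_zero]) <;> abel
    have h2 := congrArg (fun Z => Z.1 n (Fin.tail v)) h
    simp only [contr_apply, Fin.cons_self_tail] at h2
    rw [h2]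
    exact ih _ _

end Alt

/-! ### Families of tensors with two columns and derivative indices -/

/-- Families of tensors `X_{μ₁⋯μ_a|ν₁⋯ν_b}`, for all `a` and `b`, depending on a multiset of
derivative indices. They are antisymmetric in the `μ`'s and in the `ν`'s. -/
def Fam (ι N : Type*) [AddCommGroup N] [Module ℝ N] : Type _ := Multiset ι → Alt ι (Alt ι N)

namespace Fam

variable {ι N N' : Type*} [AddCommGroup N] [Module ℝ N] [AddCommGroup N'] [Module ℝ N']

instance : AddCommGroup (Fam ι N) := inferInstanceAs (AddCommGroup (Multiset ι → Alt ι (Alt ι N)))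

instance : Module ℝ (Fam ι N) := inferInstanceAs (Module ℝ (Multiset ι → Alt ι (Alt ι N)))

/-- The components of a family. -/
def ev (X : Fam ι N) {a b : ℕ} (S : Multiset ι) (μ : Fin a → ι) (ν : Fin b → ι) : N :=
  ((X S).1 a μ).1 b ν

theorem ext {X Y : Fam ι N}
    (h : ∀ a b S (μ : Fin a → ι) (ν : Fin b → ι), X.ev S μ ν = Y.ev S μ ν) : X = Y := by
  funext S
  ext a μ b ν
  exact h a b S μ ν

theorem ev_add (X Y : Fam ι N) {a b : ℕ} (S : Multiset ι) (μ : Fin a → ι) (ν : Fin b → ι) :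
    (X + Y).ev S μ ν = X.ev S μ ν + Y.ev S μ ν := rfl

theorem ev_sub (X Y : Fam ι N) {a b : ℕ} (S : Multiset ι) (μ : Fin a → ι) (ν : Fin b → ι) :
    (X - Y).ev S μ ν = X.ev S μ ν - Y.ev S μ ν := rfl

theorem ev_smul (r : ℝ) (X : Fam ι N) {a b : ℕ} (S : Multiset ι) (μ : Fin a → ι)
    (ν : Fin b → ι) : (r • X).ev S μ ν = r • X.ev S μ ν := rfl

theorem ev_zero {a b : ℕ} (S : Multiset ι) (μ : Fin a → ι)
    (ν : Fin b → ι) : (0 : Fam ι N).ev S μ ν = 0 := rfl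

theorem ev_sum {κ : Type*} (s : Finset κ) (X : κ → Fam ι N) {a b : ℕ} (S : Multiset ι)
    (μ : Fin a → ι) (ν : Fin b → ι) :
    (∑ i ∈ s, X i).ev S μ ν = ∑ i ∈ s, (X i).ev S μ ν := by
  classical
  induction s using Finset.induction_on with
  | empty => simp [ev_zero]
  | insert i s hi ih => rw [Finset.sum_insert hi, Finset.sum_insert hi, ev_add, ih]

/-- Acting with a linear map on the components. -/
def post (f : N →ₗ[ℝ] N') : Fam ι N →ₗ[ℝ] Fam ι N' := (Alt.map (Alt.map f)).compLeft _

theorem ev_post (f : N →ₗ[ℝ] N') (X : Fam ι N) {a b : ℕ} (S : Multiset ι) (μ : Fin a → ι)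
    (ν : Fin b → ι) : (post f X).ev S μ ν = f (X.ev S μ ν) := rfl

/-- Adding the derivative index `ρ`. -/
def low (ρ : ι) : Module.End ℝ (Fam ι N) where
  toFun X S := X (ρ ::ₘ S)
  map_add' _ _ := rfl
  map_smul' _ _ := rfl

variable [DecidableEq ι]

/-- Removing the derivative index `ρ` in all possible ways. -/
def rai (ρ : ι) : Module.End ℝ (Fam ι N) where
  toFun X S := (S.count ρ : ℝ) • X (S.erase ρ)
  map_add' X Y := funext fun _ => smul_add _ (X _) (Y _)
  map_smul' r X := funext fun _ => smul_comm _ r (X _)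

/-- The annihilators of indices of the first (`false`) and second (`true`) column. -/
def ann : Bool → ι → Module.End ℝ (Fam ι N)
  | false, ρ => (Alt.contr ρ).compLeft _
  | true, ρ => (Alt.map (Alt.contr ρ)).compLeft _

/-- The creators of indices of the first (`false`) and second (`true`) column. -/
def cre : Bool → ι → Module.End ℝ (Fam ι N)
  | false, ρ => (Alt.wedge ρ).compLeft _
  | true, ρ => (Alt.map (Alt.wedge ρ)).compLeft _

/-- The oscillators acting on families of tensors. -/
def osc : Oscillators ι (Module.End ℝ (Fam ι N)) where
  c := ann
  d := cre
  x := low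
  y := rai
  cc i ρ σ := by
    refine LinearMap.ext fun X => funext fun S => ?_
    cases i
    · exact Alt.contr_contr ρ σ (X S)
    · ext a μ : 3
      exact Alt.contr_contr ρ σ ((X S).1 a μ)
  dd i ρ σ := by
    refine LinearMap.ext fun X => funext fun S => ?_
    cases i
    · exact Alt.wedge_wedge ρ σ (X S)
    · ext a μ : 3
      exact Alt.wedge_wedge ρ σ ((X S).1 a μ)
  cd i ρ σ := by
    refine LinearMap.ext fun X => funext fun S => ?_
    have hX : ((if ρ = σ then 1 else 0) - cre i σ * ann i ρ : Module.End ℝ (Fam ι N)) X S =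
        (if ρ = σ then X S else 0) - cre i σ (ann i ρ X) S := by
      split_ifs <;> rfl
    rw [hX]
    cases i
    · exact Alt.contr_wedge ρ σ (X S)
    · ext a μ : 3
      refine (Alt.contr_wedge ρ σ ((X S).1 a μ)).trans ?_
      by_cases h : ρ = σ
      · rw [if_pos h, if_pos h]; rfl
      · rw [if_neg h, if_neg h]; rfl
  cc' i ρ σ := by cases i <;> rfl
  dd' i ρ σ := by
    refine LinearMap.ext fun X => funext fun S => ?_
    cases i
    · change Alt.wedge ρ (Alt.map (Alt.wedge σ) (X S)) = Alt.map (Alt.wedge σ) (Alt.wedge ρ (X S))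
      rw [Alt.map_wedge]
    · change Alt.map (Alt.wedge ρ) (Alt.wedge σ (X S)) = Alt.wedge σ (Alt.map (Alt.wedge ρ) (X S))
      rw [Alt.map_wedge]
  cd' i ρ σ := by
    refine LinearMap.ext fun X => funext fun S => ?_
    cases i
    · rfl
    · change Alt.map (Alt.contr ρ) (Alt.wedge σ (X S)) = Alt.wedge σ (Alt.map (Alt.contr ρ) (X S))
      rw [Alt.map_wedge]
  xx ρ σ := by
    refine LinearMap.ext fun X => funext fun S => ?_
    exact congrArg X (Multiset.cons_swap _ _ _)
  yy ρ σ := by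
    refine LinearMap.ext fun X => funext fun S => ?_
    change (S.count ρ : ℝ) • ((S.erase ρ).count σ : ℝ) • X ((S.erase ρ).erase σ) =
      (S.count σ : ℝ) • ((S.erase σ).count ρ : ℝ) • X ((S.erase σ).erase ρ)
    by_cases h : ρ = σ
    · rw [h]
    · rw [Multiset.count_erase_of_ne h, Multiset.count_erase_of_ne (Ne.symm h),
        Multiset.erase_comm, smul_comm]
  xy ρ σ := by
    refine LinearMap.ext fun X => funext fun S => ?_
    have hX : ((if ρ = σ then 1 else 0) + rai σ * low ρ : Module.End ℝ (Fam ι N)) X S =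
        (if ρ = σ then X S else 0) + (S.count σ : ℝ) • X (ρ ::ₘ S.erase σ) := by
      split_ifs <;> rfl
    rw [hX]
    change ((ρ ::ₘ S).count σ : ℝ) • X ((ρ ::ₘ S).erase σ) = _
    by_cases h : ρ = σ
    · subst h
      rw [if_pos rfl, Multiset.count_cons_self, Multiset.erase_cons_head]
      by_cases hS : ρ ∈ S
      · rw [Multiset.cons_erase hS]; push_cast; module
      · rw [Multiset.count_eq_zero_of_notMem hS]; simp
    · rw [if_neg h, Multiset.count_cons_of_ne (Ne.symm h), zero_add,
        Multiset.erase_cons_tail _ h]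
  xc i ρ σ := by cases i <;> rfl
  xd i ρ σ := by cases i <;> rfl
  yc i ρ σ := by
    refine LinearMap.ext fun X => funext fun S => ?_
    cases i
    · exact (map_smul (Alt.contr σ) _ _).symm
    · exact (map_smul (Alt.map (Alt.contr (N := N) σ)) _ (X (S.erase ρ))).symm
  yd i ρ σ := by
    refine LinearMap.ext fun X => funext fun S => ?_
    cases i
    · exact (map_smul (Alt.wedge σ) _ _).symm
    · exact (map_smul (Alt.map (Alt.wedge (N := N) σ)) _ (X (S.erase ρ))).symm

end Fam

end

section

/-! ### Components of the operators on families -/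

namespace Fam

variable {ι N N' : Type*} [AddCommGroup N] [Module ℝ N] [AddCommGroup N'] [Module ℝ N']

/-- Evaluation of the components as a linear map. -/
def evL {a b : ℕ} (S : Multiset ι) (μ : Fin a → ι) (ν : Fin b → ι) : Fam ι N →ₗ[ℝ] N where
  toFun X := X.ev S μ ν
  map_add' _ _ := rfl
  map_smul' _ _ := rfl

variable {a b : ℕ} (X : Fam ι N) (S : Multiset ι)

theorem ev_ann_false (ρ : ι) (μ : Fin a → ι) (ν : Fin b → ι) :
    ev (ann false ρ X) S μ ν = ev X S (Fin.cons ρ μ : Fin (a + 1) → ι) ν := rfl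

theorem ev_ann_true (ρ : ι) (μ : Fin a → ι) (ν : Fin b → ι) :
    ev (ann true ρ X) S μ ν = ev X S μ (Fin.cons ρ ν : Fin (b + 1) → ι) := rfl

theorem ev_low (ρ : ι) (μ : Fin a → ι) (ν : Fin b → ι) :
    ev (low ρ X) S μ ν = ev X (ρ ::ₘ S) μ ν := rfl

theorem post_ann (f : N →ₗ[ℝ] N') (i : Bool) (ρ : ι) : post f (ann i ρ X) = ann i ρ (post f X) := by
  cases i <;> rfl

theorem post_low (f : N →ₗ[ℝ] N') (ρ : ι) : post f (low ρ X) = low ρ (post f X) := rfl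

theorem ev_antisymm_left (c d : Fin a) (hcd : c ≠ d) (μ : Fin a → ι) (ν : Fin b → ι) :
    ev X S (μ ∘ Equiv.swap c d) ν = -ev X S μ ν :=
  congrArg (fun Y : Alt ι N => Y.1 b ν) ((X S).2 a c d hcd μ)

theorem ev_antisymm_right (c d : Fin b) (hcd : c ≠ d) (μ : Fin a → ι) (ν : Fin b → ι) :
    ev X S μ (ν ∘ Equiv.swap c d) = -ev X S μ ν :=
  ((X S).1 a μ).2 b c d hcd ν

theorem neg_one_pow_smul_self {M : Type*} [AddCommGroup M] (i : ℕ) (y : M) :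
    (-1 : ℤ) ^ i • (-1 : ℤ) ^ i • y = y := by
  rw [smul_smul, ← mul_pow]; simp

theorem ev_cycle_left (μ : Fin (a + 1) → ι) (ν : Fin b → ι) (i : Fin (a + 1)) :
    ev X S (Fin.cons (μ i) (μ ∘ i.succAbove) : Fin (a + 1) → ι) ν =
      (-1 : ℤ) ^ i.1 • ev X S μ ν := by
  rw [← cycle_eq_cons, anti_perm (f := fun v => ev X S v ν)
    (fun c d h v => ev_antisymm_left X S c d h v ν), sign_cycle_symm]

theorem ev_cycle_right (μ : Fin a → ι) (ν : Fin (b + 1) → ι) (i : Fin (b + 1)) :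
    ev X S μ (Fin.cons (ν i) (ν ∘ i.succAbove) : Fin (b + 1) → ι) =
      (-1 : ℤ) ^ i.1 • ev X S μ ν := by
  rw [← cycle_eq_cons, anti_perm (f := fun v => ev X S μ v)
    (fun c d h v => ev_antisymm_right X S c d h μ v), sign_cycle_symm]

variable [DecidableEq ι]

theorem ev_rai (ρ : ι) (μ : Fin a → ι) (ν : Fin b → ι) :
    ev (rai ρ X) S μ ν = (S.count ρ : ℝ) • ev X (S.erase ρ) μ ν := rfl

theorem ev_cre_false (ρ : ι) (μ : Fin (a + 1) → ι) (ν : Fin b → ι) :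
    ev (cre false ρ X) S μ ν =
      ∑ i : Fin (a + 1), (-1 : ℤ) ^ i.1 • if μ i = ρ then ev X S (μ ∘ i.succAbove) ν else 0 := by
  let f : Alt ι N →ₗ[ℝ] N :=
    { toFun Y := Y.1 b ν, map_add' _ _ := rfl, map_smul' _ _ := rfl }
  change f ((Alt.wedge ρ (X S)).1 (a + 1) μ) = _
  rw [Alt.wedge_succ, map_sum]
  refine Finset.sum_congr rfl fun i _ => ?_
  rw [map_zsmul]
  split_ifs <;> rfl

theorem ev_cre_false_zero (ρ : ι) (μ : Fin 0 → ι) (ν : Fin b → ι) :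
    ev (cre false ρ X) S μ ν = 0 := rfl

theorem ev_cre_true (ρ : ι) (μ : Fin a → ι) (ν : Fin (b + 1) → ι) :
    ev (cre true ρ X) S μ ν =
      ∑ i : Fin (b + 1), (-1 : ℤ) ^ i.1 • if ν i = ρ then ev X S μ (ν ∘ i.succAbove) else 0 := rfl

theorem ev_cre_true_zero (ρ : ι) (μ : Fin a → ι) (ν : Fin 0 → ι) :
    ev (cre true ρ X) S μ ν = 0 := rfl

theorem post_cre (f : N →ₗ[ℝ] N') (i : Bool) (ρ : ι) : post f (cre i ρ X) = cre i ρ (post f X) := by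
  cases i
  · exact funext fun S => Alt.map_wedge (Alt.map f) ρ (X S)
  · refine funext fun S => ?_
    ext a μ : 3
    exact Alt.map_wedge f ρ ((X S).1 a μ)

theorem post_rai (f : N →ₗ[ℝ] N') (ρ : ι) : post f (rai ρ X) = rai ρ (post f X) :=
  funext fun S => map_smul (Alt.map (Alt.map f)) _ (X (S.erase ρ))

variable [Fintype ι]

theorem A_apply (i : Bool) : osc.A i X = ∑ ρ, cre i ρ (low ρ X) := by
  simp only [Oscillators.A, LinearMap.sum_apply]; rfl

theorem B_apply (i : Bool) : osc.B i X = ∑ ρ, rai ρ (ann i ρ X) := by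
  simp only [Oscillators.B, LinearMap.sum_apply]; rfl

theorem E_apply (i : Bool) : osc.E i X = ∑ ρ, cre i ρ (ann (!i) ρ X) := by
  simp only [Oscillators.E, LinearMap.sum_apply]; rfl

theorem n_apply (i : Bool) : osc.n i X = ∑ ρ, cre i ρ (ann i ρ X) := by
  simp only [Oscillators.n, LinearMap.sum_apply]; rfl

theorem nx_apply : osc.nx X = ∑ ρ, rai ρ (low ρ X) := by
  simp only [Oscillators.nx, LinearMap.sum_apply]; rfl

theorem post_A (f : N →ₗ[ℝ] N') (i : Bool) : post f (osc.A i X) = osc.A i (post f X) := by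
  simp only [A_apply, map_sum, post_cre, post_low]

theorem post_B (f : N →ₗ[ℝ] N') (i : Bool) : post f (osc.B i X) = osc.B i (post f X) := by
  simp only [B_apply, map_sum, post_rai, post_ann]

theorem post_E (f : N →ₗ[ℝ] N') (i : Bool) : post f (osc.E i X) = osc.E i (post f X) := by
  simp only [E_apply, map_sum, post_cre, post_ann]

theorem post_n (f : N →ₗ[ℝ] N') (i : Bool) : post f (osc.n i X) = osc.n i (post f X) := by
  simp only [n_apply, map_sum, post_cre, post_ann]

theorem post_m (f : N →ₗ[ℝ] N') : post f (osc.m X) = osc.m (post f X) := by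
  simp only [Oscillators.m, LinearMap.add_apply, LinearMap.sub_apply, map_add, map_sub, post_n]
  rfl

theorem post_L (f : N →ₗ[ℝ] N') : post f (osc.L X) = osc.L (post f X) := by
  simp only [Oscillators.L, LinearMap.add_apply, Module.End.mul_apply, map_add, post_A, post_m,
    post_E]

theorem post_C (f : N →ₗ[ℝ] N') : post f (osc.C X) = osc.C (post f X) := by
  simp only [Oscillators.C, LinearMap.add_apply, Module.End.mul_apply, map_add, post_A, post_B]

theorem post_Z (f : N →ₗ[ℝ] N') : post f (osc.Z X) = osc.Z (post f X) := by
  simp only [Oscillators.Z, Module.End.mul_apply, post_A, post_B]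

theorem ev_A_false (μ : Fin (a + 1) → ι) (ν : Fin b → ι) : ev (osc.A false X) S μ ν =
    ∑ i : Fin (a + 1), (-1 : ℤ) ^ i.1 • ev X (μ i ::ₘ S) (μ ∘ i.succAbove) ν := by
  simp only [A_apply, ev_sum, ev_cre_false]
  rw [Finset.sum_comm]
  simp [ev_low]

theorem ev_A_false_zero (μ : Fin 0 → ι) (ν : Fin b → ι) : ev (osc.A false X) S μ ν = 0 := by
  simp only [A_apply, ev_sum, ev_cre_false_zero, Finset.sum_const_zero]

theorem ev_A_true (μ : Fin a → ι) (ν : Fin (b + 1) → ι) : ev (osc.A true X) S μ ν =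
    ∑ i : Fin (b + 1), (-1 : ℤ) ^ i.1 • ev X (ν i ::ₘ S) μ (ν ∘ i.succAbove) := by
  simp only [A_apply, ev_sum, ev_cre_true]
  rw [Finset.sum_comm]
  simp [ev_low]

theorem ev_A_true_zero (μ : Fin a → ι) (ν : Fin 0 → ι) : ev (osc.A true X) S μ ν = 0 := by
  simp only [A_apply, ev_sum, ev_cre_true_zero, Finset.sum_const_zero]

theorem ev_E_false (μ : Fin (a + 1) → ι) (ν : Fin b → ι) : ev (osc.E false X) S μ ν =
    ∑ i : Fin (a + 1), (-1 : ℤ) ^ i.1 •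
      ev X S (μ ∘ i.succAbove) (Fin.cons (μ i) ν : Fin (b + 1) → ι) := by
  simp only [E_apply, ev_sum, ev_cre_false]
  rw [Finset.sum_comm]
  simp [ev_ann_true]

theorem ev_E_false_zero (μ : Fin 0 → ι) (ν : Fin b → ι) : ev (osc.E false X) S μ ν = 0 := by
  simp only [E_apply, ev_sum, ev_cre_false_zero, Finset.sum_const_zero]

theorem ev_E_true (μ : Fin a → ι) (ν : Fin (b + 1) → ι) : ev (osc.E true X) S μ ν =
    ∑ i : Fin (b + 1), (-1 : ℤ) ^ i.1 •
      ev X S (Fin.cons (ν i) μ : Fin (a + 1) → ι) (ν ∘ i.succAbove) := by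
  simp only [E_apply, ev_sum, ev_cre_true]
  rw [Finset.sum_comm]
  simp [ev_ann_false]

theorem ev_E_true_zero (μ : Fin a → ι) (ν : Fin 0 → ι) : ev (osc.E true X) S μ ν = 0 := by
  simp only [E_apply, ev_sum, ev_cre_true_zero, Finset.sum_const_zero]

theorem ev_B_false (μ : Fin a → ι) (ν : Fin b → ι) : ev (osc.B false X) S μ ν =
    ∑ ρ, (S.count ρ : ℝ) • ev X (S.erase ρ) (Fin.cons ρ μ : Fin (a + 1) → ι) ν := by
  simp only [B_apply, ev_sum, ev_rai, ev_ann_false]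

theorem ev_B_true (μ : Fin a → ι) (ν : Fin b → ι) : ev (osc.B true X) S μ ν =
    ∑ ρ, (S.count ρ : ℝ) • ev X (S.erase ρ) μ (Fin.cons ρ ν : Fin (b + 1) → ι) := by
  simp only [B_apply, ev_sum, ev_rai, ev_ann_true]

theorem ev_nx (μ : Fin a → ι) (ν : Fin b → ι) :
    ev (osc.nx X) S μ ν = (S.card : ℝ) • ev X S μ ν := by
  simp only [nx_apply, ev_sum, ev_rai, ev_low]
  have h : ∀ ρ, (S.count ρ : ℝ) • ev X (ρ ::ₘ S.erase ρ) μ ν =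
      (S.count ρ : ℝ) • ev X S μ ν := by
    intro ρ
    by_cases hS : ρ ∈ S
    · rw [Multiset.cons_erase hS]
    · rw [Multiset.count_eq_zero_of_notMem hS]; simp
  simp only [h, ← Finset.sum_smul]
  congr 1
  rw [← Nat.cast_sum]
  congr 1
  exact Multiset.sum_count_eq_card fun ρ _ => Finset.mem_univ ρ

theorem ev_n_false (μ : Fin a → ι) (ν : Fin b → ι) :
    ev (osc.n false X) S μ ν = (a : ℝ) • ev X S μ ν := by
  cases a with
  | zero => simp [n_apply, ev_sum, ev_cre_false_zero]
  | succ a =>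
    simp only [n_apply, ev_sum, ev_cre_false]
    rw [Finset.sum_comm]
    simp only [← Finset.smul_sum, Finset.sum_ite_eq, Finset.mem_univ, if_true, ev_ann_false,
      ev_cycle_left, neg_one_pow_smul_self, Finset.sum_const, Finset.card_univ, Fintype.card_fin]
    rw [Nat.cast_smul_eq_nsmul]

theorem ev_n_true (μ : Fin a → ι) (ν : Fin b → ι) :
    ev (osc.n true X) S μ ν = (b : ℝ) • ev X S μ ν := by
  cases b with
  | zero => simp [n_apply, ev_sum, ev_cre_true_zero]
  | succ b =>
    simp only [n_apply, ev_sum, ev_cre_true]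
    rw [Finset.sum_comm]
    simp only [← Finset.smul_sum, Finset.sum_ite_eq, Finset.mem_univ, if_true, ev_ann_true,
      ev_cycle_right, neg_one_pow_smul_self, Finset.sum_const, Finset.card_univ, Fintype.card_fin]
    rw [Nat.cast_smul_eq_nsmul]

theorem ev_m (μ : Fin a → ι) (ν : Fin b → ι) :
    ev (osc.m X) S μ ν = ((a : ℝ) - b + 1) • ev X S μ ν := by
  simp only [Oscillators.m, LinearMap.add_apply, LinearMap.sub_apply, ev_add, ev_sub, ev_n_false,
    ev_n_true, Module.End.one_apply]
  module

theorem ev_N (μ : Fin a → ι) (ν : Fin b → ι) :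
    ev ((osc.nx + osc.n true : Module.End ℝ (Fam ι N)) X) S μ ν =
      ((S.card : ℝ) + b) • ev X S μ ν := by
  rw [LinearMap.add_apply, ev_add, ev_nx, ev_n_true, add_smul]

/-- Without derivative indices the contractions vanish. -/
theorem ev_B_card_zero (i : Bool) (μ : Fin a → ι) (ν : Fin b → ι) :
    ev (osc.B i X) 0 μ ν = 0 := by
  cases i
  · simp [ev_B_false]
  · simp [ev_B_true]

/-! ### Mixed symmetry -/

/-- The Bianchi I identity says that moving indices from the second to the first column and
antisymmetrizing gives zero. -/
theorem ev_E_false_eq (x : ι) (μ : Fin a → ι) (ν : Fin b → ι) :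
    ev (osc.E false X) S (Fin.cons x μ : Fin (a + 1) → ι) ν =
      ev X S μ (Fin.cons x ν : Fin (b + 1) → ι) -
        ∑ i, ev X S (Function.update μ i x) (Fin.cons (μ i) ν : Fin (b + 1) → ι) := by
  rw [ev_E_false, Fin.sum_univ_succ]
  have h0 : (Fin.cons x μ : Fin (a + 1) → ι) ∘ Fin.succAbove 0 = μ := by
    funext q; simp
  simp only [h0, Fin.cons_zero, Fin.cons_succ, Fin.val_zero, pow_zero, one_smul, Fin.val_succ,
    pow_succ, mul_neg, mul_one, neg_smul, Finset.sum_neg_distrib, ← sub_eq_add_neg]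
  congr 1
  refine Finset.sum_congr rfl fun i _ => ?_
  cases a with
  | zero => exact i.elim0
  | succ a =>
    have h1 := ev_cycle_left X S (Function.update μ i x) (Fin.cons (μ i) ν : Fin (b + 1) → ι) i
    have h2 : Function.update μ i x ∘ i.succAbove = μ ∘ i.succAbove := by funext q; simp
    have h3 : (Fin.cons x μ : Fin (a + 2) → ι) ∘ i.succ.succAbove =
        Fin.cons x (μ ∘ i.succAbove) := by
      funext q
      refine Fin.cases ?_ (fun q => ?_) q <;> simp
    rw [Function.update_self, h2] at h1
    rw [h3, h1, neg_one_pow_smul_self]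

theorem isYoung_ev (hX : osc.E false X = 0) (a b : ℕ) :
    IsYoung fun (μ : Fin a → ι) (ν : Fin b → ι) => ev X S μ ν where
  left c d h μ ν := ev_antisymm_left X S c d h μ ν
  right c d h μ ν := ev_antisymm_right X S c d h μ ν
  bianchi h μ ν := by
    obtain ⟨b, rfl⟩ : ∃ c, b = c + 1 := ⟨b - 1, by omega⟩
    obtain ⟨x, ν, rfl⟩ : ∃ x ν', ν = Fin.cons (α := fun _ => ι) x ν' :=
      ⟨ν 0, Fin.tail ν, (Fin.cons_self_tail ν).symm⟩
    have h1 := ev_E_false_eq X S x μ ν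
    rw [hX, ev_zero] at h1
    change _ = ∑ i, ev X S (Function.update μ i ((Fin.cons x ν : Fin (b + 1) → ι) 0))
      (Function.update (Fin.cons x ν : Fin (b + 1) → ι) 0 (μ i))
    simp only [Fin.cons_zero, Fin.update_cons_zero]
    exact (sub_eq_zero.1 h1.symm)

theorem E_false_eq_zero
    (h : ∀ (a b : ℕ) S, IsYoung fun (μ : Fin a → ι) (ν : Fin b → ι) => ev X S μ ν) :
    osc.E false X = 0 := by
  refine Fam.ext fun a b S μ ν => ?_
  cases a with
  | zero => exact ev_E_false_zero X S μ ν
  | succ a =>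
    obtain ⟨x, μ, rfl⟩ : ∃ x μ', μ = Fin.cons (α := fun _ => ι) x μ' :=
      ⟨μ 0, Fin.tail μ, (Fin.cons_self_tail μ).symm⟩
    have h1 := (h a (b + 1) S).bianchi (Nat.succ_pos b) μ (Fin.cons x ν : Fin (b + 1) → ι)
    change _ = ∑ i, ev X S (Function.update μ i ((Fin.cons x ν : Fin (b + 1) → ι) 0))
      (Function.update (Fin.cons x ν : Fin (b + 1) → ι) 0 (μ i)) at h1
    simp only [Fin.cons_zero, Fin.update_cons_zero] at h1
    rw [ev_E_false_eq, h1, sub_self, ev_zero]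

end Fam

end

section

/-! ### The family of the generators -/

section GenFam

variable (k D : ℕ)

/-- The sign relating the gauge transformation of the ghosts to the operator `L`. -/
def sgn : ℤ := (-1) ^ (k + 1)

theorem sgn_smul_sgn {M : Type*} [AddCommGroup M] (x : M) : sgn k • sgn k • x = x :=
  Fam.neg_one_pow_smul_self _ _

/-- The components of `genFam`. -/
def genFun (S : Multiset (Fin D)) (a : ℕ) (μ : Fin a → Fin D) (b : ℕ) (ν : Fin b → Fin D) :
    LocalForm k D :=
  if ha : a = k then
    if hb : b < k then gen (.ghost b hb S (μ ∘ Fin.cast ha.symm) ν)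
    else if hb : b = k then sgn k • gen (.t S (μ ∘ Fin.cast ha.symm) (ν ∘ Fin.cast hb.symm))
    else 0
  else 0

variable {k D}

theorem genFun_ghost {b : ℕ} (hb : b < k) (S : Multiset (Fin D)) (μ : Fin k → Fin D)
    (ν : Fin b → Fin D) : genFun k D S k μ b ν = gen (.ghost b hb S μ ν) := by
  rw [genFun, dif_pos rfl, dif_pos hb]; rfl

theorem genFun_t (S : Multiset (Fin D)) (μ ν : Fin k → Fin D) :
    genFun k D S k μ k ν = sgn k • gen (.t S μ ν) := by
  rw [genFun, dif_pos rfl, dif_neg (lt_irrefl k), dif_pos rfl]; rfl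

theorem genFun_ne {a b : ℕ} (ha : a ≠ k) (S : Multiset (Fin D)) (μ : Fin a → Fin D)
    (ν : Fin b → Fin D) : genFun k D S a μ b ν = 0 := by
  rw [genFun, dif_neg ha]

theorem genFun_gt {a b : ℕ} (hb : k < b) (S : Multiset (Fin D)) (μ : Fin a → Fin D)
    (ν : Fin b → Fin D) : genFun k D S a μ b ν = 0 := by
  rw [genFun]
  split_ifs <;> first | rfl | omega

theorem isYoung_genFun (S : Multiset (Fin D)) (a b : ℕ) :
    IsYoung fun (μ : Fin a → Fin D) (ν : Fin b → Fin D) => genFun k D S a μ b ν := by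
  by_cases ha : a = k
  · subst ha
    rcases lt_trichotomy b a with hb | hb | hb
    · simpa only [genFun_ghost hb] using isYoung_ghost b hb S
    · subst hb
      have h := isYoung_t (k := b) (D := D) S
      simp only [genFun_t]
      constructor
      · intro c d hcd μ ν; rw [h.left c d hcd, smul_neg]
      · intro c d hcd μ ν; rw [h.right c d hcd, smul_neg]
      · intro h0 μ ν; rw [← Finset.smul_sum, ← h.bianchi h0]
    · simpa only [genFun_gt hb] using isYoung_zero
  · simpa only [genFun_ne ha] using isYoung_zero

variable (k D)

/-- The generators `∂_S η` of mixed symmetries `(k, j)` with `j < k` and, up to the sign `sgn k`,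
`∂_S t` as a single family of tensors. -/
def genFam : Fam (Fin D) (LocalForm k D) := fun S =>
  ⟨fun a μ => ⟨fun b ν => genFun k D S a μ b ν,
    fun b c d hcd ν => (isYoung_genFun S a b).right c d hcd μ ν⟩,
    fun a c d hcd μ => Subtype.ext <| funext fun b => funext fun ν =>
      (isYoung_genFun S a b).left c d hcd μ ν⟩

variable {k D}

theorem ev_genFam {a b : ℕ} (S : Multiset (Fin D)) (μ : Fin a → Fin D) (ν : Fin b → Fin D) :
    (genFam k D).ev S μ ν = genFun k D S a μ b ν := rfl

open Fam

theorem E_false_genFam : osc.E false (genFam k D) = 0 :=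
  E_false_eq_zero _ fun a b S => isYoung_genFun S a b

/-- The tensors of mixed symmetry `(k, k)` are symmetric under exchange of the columns. -/
theorem genFun_symm (S : Multiset (Fin D)) (μ ν : Fin k → Fin D) :
    genFun k D S k μ k ν = genFun k D S k ν k μ := by
  rw [genFun_t, genFun_t]
  exact congrArg _ (mk_rel (Rel.t_symm S μ ν))

theorem Fam.ev_L {ι N : Type*} [DecidableEq ι] [Fintype ι] [AddCommGroup N] [Module ℝ N]
    (X : Fam ι N) {a b : ℕ} (S : Multiset ι) (μ : Fin a → ι) (ν : Fin b → ι) :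
    ev (osc.L X) S μ ν = ev (osc.A false (osc.E true X)) S μ ν +
      ((a : ℝ) - b + 1) • ev (osc.A true X) S μ ν := by
  simp only [Oscillators.L, LinearMap.add_apply, Module.End.mul_apply, ev_add, ev_m]

/-- `L` in terms of replacements of indices. -/
theorem Fam.ev_L_succ {ι N : Type*} [DecidableEq ι] [Fintype ι] [AddCommGroup N] [Module ℝ N]
    (X : Fam ι N) {a b : ℕ} (S : Multiset ι) (μ : Fin (a + 1) → ι) (ν : Fin (b + 1) → ι) :
    ev (osc.L X) S μ ν =
      (∑ l : Fin (b + 1), (-1 : ℤ) ^ l.1 •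
          ∑ i, ev X (μ i ::ₘ S) (Function.update μ i (ν l)) (ν ∘ l.succAbove)) +
        (((a + 1 : ℕ) : ℝ) - ((b + 1 : ℕ) : ℝ) + 1) •
          ∑ l : Fin (b + 1), (-1 : ℤ) ^ l.1 • ev X (ν l ::ₘ S) μ (ν ∘ l.succAbove) := by
  rw [ev_L, ev_A_true]
  congr 1
  simp only [ev_A_false, ev_E_true, Finset.smul_sum]
  rw [Finset.sum_comm]
  refine Finset.sum_congr rfl fun l _ => Finset.sum_congr rfl fun i _ => ?_
  have h1 := ev_cycle_left X (μ i ::ₘ S) (Function.update μ i (ν l)) (ν ∘ l.succAbove) i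
  have h2 : Function.update μ i (ν l) ∘ i.succAbove = μ ∘ i.succAbove := by funext q; simp
  rw [Function.update_self, h2] at h1
  rw [h1, smul_comm ((-1 : ℤ) ^ l.1), neg_one_pow_smul_self]

theorem gammaGen_ghost {b : ℕ} (hb : b < k) (S : Multiset (Fin D)) (μ : Fin k → Fin D)
    (ν : Fin b → Fin D) :
    gammaGen (.ghost b hb S μ ν) = sgn k • ev (osc.L (genFam k D)) S μ ν := by
  obtain ⟨n, rfl⟩ : ∃ n, k = n + 1 := ⟨k - 1, by omega⟩
  cases b with
  | zero =>
    rw [ev_L, ev_A_true_zero, ev_A_false]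
    simp [gammaGen, ghostGauge, ev_E_true_zero]
  | succ b =>
    rw [gammaGen, ghostGauge_eq (fun ρ => isYoung_ghost (k := n + 1) _ _ (ρ ::ₘ S)), ev_L_succ]
    have hs : sgn (n + 1) = (-1) ^ n := by rw [sgn]; ring
    have h : ∀ ρ (μ : Fin (n + 1) → Fin D) (ν : Fin b → Fin D),
        ev (genFam (n + 1) D) (ρ ::ₘ S) μ ν = gen (.ghost b (by omega) (ρ ::ₘ S) μ ν) :=
      fun ρ μ ν => genFun_ghost (by omega) _ μ ν
    rw [hs]
    congr 1
    simp only [h, omitAt_succ]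
    congr 1
    rw [← Int.cast_smul_eq_zsmul ℝ]
    push_cast
    rfl

/-- Both terms of the transformation of `t` agree with those of `L`; the first one by exchanging
all indices of the second column with indices of the first one. -/
theorem gammaGen_t (hk : 0 < k) (S : Multiset (Fin D)) (μ ν : Fin k → Fin D) :
    gammaGen (.t S μ ν) = ev (osc.L (genFam k D)) S μ ν := by
  obtain ⟨n, rfl⟩ : ∃ n, k = n + 1 := ⟨k - 1, by omega⟩
  have h : ∀ ρ (μ : Fin (n + 1) → Fin D) (ν : Fin n → Fin D),
      gen (.ghost n (by omega) (ρ ::ₘ S) μ ν) = ev (genFam (n + 1) D) (ρ ::ₘ S) μ ν :=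
    fun ρ μ ν => (genFun_ghost (by omega) _ μ ν).symm
  rw [gammaGen, dif_pos hk, fieldGauge, ev_L, ev_A_true, ev_A_false]
  simp only [omitAt_succ, sub_self, zero_add, one_smul]
  refine (add_comm _ _).trans (congrArg₂ _ ?_ ?_)
  · refine Finset.sum_congr rfl fun i _ => ?_
    rw [ev_E_true]
    congr 1
    refine (h _ _ _).trans ?_
    exact (exch_all (isYoung_genFun (μ i ::ₘ S) (n + 1) n) ν (μ ∘ i.succAbove)).symm
  · exact Finset.sum_congr rfl fun i _ => congrArg _ (h _ _ _)

/-- The exterior longitudinal derivative acts on the family of generators as the gauge operator. For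
`b = k + 1` this holds because the gauge operator annihilates the tensors of mixed symmetry `(k, k)`
that are symmetric under exchange of the columns. -/
theorem post_gamma (hk : 0 < k) :
    post gamma (genFam k D) = sgn k • osc.L (genFam k D) := by
  refine Fam.ext fun a b S μ ν => ?_
  have hR : (sgn k • osc.L (genFam k D)).ev S μ ν = sgn k • ev (osc.L (genFam k D)) S μ ν :=
    map_zsmul (evL S μ ν) _ _
  rw [hR, ev_post, ev_genFam]
  by_cases ha : a = k
  · subst ha
    rcases lt_trichotomy b a with hb | hb | hb
    · rw [genFun_ghost hb, gamma_gen, gammaGen_ghost]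
    · subst hb
      rw [genFun_t, map_zsmul, gamma_gen, gammaGen_t hk]
    · rw [genFun_gt hb, map_zero]
      obtain ⟨n, rfl⟩ : ∃ n, a = n + 1 := ⟨a - 1, by omega⟩
      obtain ⟨b, rfl⟩ : ∃ c, b = c + 1 := ⟨b - 1, by omega⟩
      rw [ev_L, ev_A_true, ev_A_false]
      rcases Nat.lt_or_ge (n + 1) b with h | h
      · simp [ev_E_true, ev_genFam, genFun_gt h]
      · obtain rfl : b = n + 1 := by omega
        -- the first term vanishes by the Bianchi identity with exchanged columns, the second
        -- one because of its coefficient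
        have h0 : ∀ ρ, ∀ μ' : Fin n → Fin D,
            ev (osc.E true (genFam (n + 1) D)) (ρ ::ₘ S) μ' ν = 0 := by
          intro ρ μ'
          have h1 : ev (osc.E false (genFam (n + 1) D)) (ρ ::ₘ S) ν μ' = 0 := by
            rw [E_false_genFam, ev_zero]
          rw [← h1, ev_E_true, ev_E_false]
          exact Finset.sum_congr rfl fun l _ => congrArg _ (genFun_symm _ _ _)
        have h2 : ((n + 1 : ℕ) : ℝ) - ((n + 1 + 1 : ℕ) : ℝ) + 1 = 0 := by push_cast; ring
        simp only [h0, h2]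
        simp
  · rw [genFun_ne ha, map_zero, ev_L]
    have h1 : ev (osc.A true (genFam k D)) S μ ν = 0 := by
      cases b with
      | zero => exact ev_A_true_zero _ _ _ _
      | succ b => simp [ev_A_true, ev_genFam, genFun_ne ha]
    have h2 : ev (osc.A false (osc.E true (genFam k D))) S μ ν = 0 := by
      cases a with
      | zero => exact ev_A_false_zero _ _ _ _
      | succ a =>
        cases b with
        | zero => simp [ev_A_false, ev_E_true_zero]
        | succ b => simp [ev_A_false, ev_E_true, ev_genFam, genFun_ne ha]
    rw [h1, h2]
    simp

/-- `∂_S F` in terms of the exterior derivatives on the two columns. -/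
theorem curvature_eq (S : Multiset (Fin D)) (μ ν : Fin (k + 1) → Fin D) :
    curvature S μ ν = sgn k • ev (osc.A false (osc.A true (genFam k D))) S μ ν := by
  rw [curvature, ev_A_false, Finset.smul_sum]
  refine Finset.sum_congr rfl fun i _ => ?_
  rw [ev_A_true, Finset.smul_sum, Finset.smul_sum]
  refine Finset.sum_congr rfl fun l _ => ?_
  rw [ev_genFam, genFun_t, omitAt_succ, omitAt_succ, smul_comm (sgn k), smul_comm (sgn k),
    sgn_smul_sgn, smul_smul, ← pow_add, Multiset.cons_swap]

theorem topGhostCurl_eq (hk : 0 < k) (μ : Fin (k + 1) → Fin D) :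
    topGhostCurl hk μ = ev (osc.A false (genFam k D)) 0 μ Fin.elim0 := by
  rw [topGhostCurl, ev_A_false]
  refine Finset.sum_congr rfl fun i _ => ?_
  rw [ev_genFam, genFun_ghost hk, omitAt_succ]
  rfl

end GenFam

end

section

variable {k D : ℕ}

/-! ### Odd derivations of the algebra of local forms -/

theorem LocalForm.induction {P : LocalForm k D → Prop} (halg : ∀ r : ℝ, P (algebraMap ℝ _ r))
    (hgen : ∀ x, P (gen x)) (hmul : ∀ a b, P a → P b → P (a * b))
    (hadd : ∀ a b, P a → P b → P (a + b)) (a : LocalForm k D) : P a := by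
  obtain ⟨f, rfl⟩ := mk_surjective a
  induction f using FreeAlgebra.induction with
  | grade0 r => rw [AlgHom.commutes]; exact halg r
  | grade1 x => exact hgen x
  | mul a b ha hb => rw [map_mul]; exact hmul _ _ ha hb
  | add a b ha hb => rw [map_add]; exact hadd _ _ ha hb

/-- The conditions under which a map on the generators extends to an odd right derivation. -/
structure IsOddOnGen (d : Gen k D → LocalForm k D) : Prop where
  comm : ∀ x y : Gen k D,
    gen y * d x = (-1 : ℝ) ^ (y.parity * (x.parity + 1)) • (d x * gen y)
  t : ∀ S, IsYoung fun μ ν => d (.t S μ ν)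
  t_symm : ∀ S μ ν, d (.t S μ ν) = d (.t S ν μ)
  ghost : ∀ j hj S, IsYoung fun μ ν => d (.ghost j hj S μ ν)
  tStar : ∀ S, IsYoung fun μ ν => d (.tStar S μ ν)
  tStar_symm : ∀ S μ ν, d (.tStar S μ ν) = d (.tStar S ν μ)
  ghostStar : ∀ j hj S, IsYoung fun μ ν => d (.ghostStar j hj S μ ν)

namespace IsOddOnGen

/-- The matrix `(x, d x; 0, (-1)^{ε(x)} x)` of a generator `x`. -/
def matrix (d : Gen k D → LocalForm k D) (x : Gen k D) : Matrix (Fin 2) (Fin 2) (LocalForm k D) :=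
  !![gen x, d x; 0, (-1 : ℝ) ^ x.parity • gen x]

theorem youngRel_matrix {d : Gen k D → LocalForm k D} {j : ℕ}
    {X : (Fin k → Fin D) → (Fin j → Fin D) → Gen k D} (e : ℕ)
    (hp : ∀ μ ν, (X μ ν).parity = e) (h1 : IsYoung fun μ ν => gen (X μ ν))
    (h2 : IsYoung fun μ ν => d (X μ ν)) {z : FreeAlgebra ℝ (Gen k D)}
    (hz : YoungRel (fun μ ν => FreeAlgebra.ι ℝ (X μ ν)) z) :
    FreeAlgebra.lift ℝ (matrix d) z = 0 := by
  have key : ∀ a b : Fin 2, IsYoung fun μ ν => matrix d (X μ ν) a b := by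
    intro a b
    fin_cases a <;> fin_cases b
    · exact h1
    · exact h2
    · exact isYoung_zero
    · simp only [matrix, hp]
      exact h1.smul _
  ext a b
  have := hz.map_eq_zero
    ((Matrix.entryAddMonoidHom (LocalForm k D) a b).comp
      (FreeAlgebra.lift ℝ (matrix d) :
        FreeAlgebra ℝ (Gen k D) →+ Matrix (Fin 2) (Fin 2) (LocalForm k D)))
    (by simpa using key a b)
  simpa using this

variable {d : Gen k D → LocalForm k D} (hd : IsOddOnGen d)

/-- The homomorphism `a ↦ (a, d a; 0, (-1)^{ε(a)} a)`. -/
def hom : LocalForm k D →ₐ[ℝ] Matrix (Fin 2) (Fin 2) (LocalForm k D) :=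
  lift (FreeAlgebra.lift ℝ (matrix d)) <| by
    intro u v h
    cases h with
    | comm x y =>
      have hs : ∀ m : ℕ, ((-1 : ℝ) ^ m) * (-1) ^ m = 1 := by
        intro m; rw [← mul_pow]; simp
      rw [map_smul, map_mul, map_mul, FreeAlgebra.lift_ι_apply, FreeAlgebra.lift_ι_apply]
      have h1 := gen_comm x y
      have h2 := hd.comm y x
      have h3 := hd.comm x y
      ext a b
      fin_cases a <;> fin_cases b
      · simpa [matrix, Matrix.mul_apply, Fin.sum_univ_two] using h1
      · simp [matrix, Matrix.mul_apply, Fin.sum_univ_two]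
        rw [h2, h3]
        have e1 : (-1 : ℝ) ^ (x.parity * (y.parity + 1)) =
            (-1) ^ (x.parity * y.parity) * (-1) ^ x.parity := by rw [← pow_add]; ring_nf
        have e2 : (-1 : ℝ) ^ (x.parity * y.parity) * (-1) ^ (y.parity * (x.parity + 1)) =
            (-1) ^ y.parity := by
          have := hs (x.parity * y.parity)
          have e3 : y.parity * (x.parity + 1) = x.parity * y.parity + y.parity := by ring
          rw [e3, pow_add, ← mul_assoc, this, one_mul]
        simp only [smul_smul, e1, e2]
        abel
      · simp [matrix, Matrix.mul_apply, Fin.sum_univ_two]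
      · simp [matrix, Matrix.mul_apply, Fin.sum_univ_two]
        rw [h1]
        module
    | t S z hz =>
      rw [map_zero]
      exact youngRel_matrix (X := Gen.t S) 0 (fun _ _ => rfl) (isYoung_t S) (hd.t S) hz
    | t_symm S μ ν =>
      rw [FreeAlgebra.lift_ι_apply, FreeAlgebra.lift_ι_apply]
      have h1 : gen (Gen.t S μ ν) = gen (Gen.t S ν μ) := mk_rel (Rel.t_symm S μ ν)
      simp only [matrix, h1, hd.t_symm S μ ν]
      rfl
    | ghost j hj S z hz =>
      rw [map_zero]
      exact youngRel_matrix (X := Gen.ghost j hj S) (k - j) (fun _ _ => rfl) (isYoung_ghost j hj S)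
        (hd.ghost j hj S) hz
    | tStar S z hz =>
      rw [map_zero]
      exact youngRel_matrix (X := Gen.tStar S) 1 (fun _ _ => rfl) (isYoung_tStar S) (hd.tStar S) hz
    | tStar_symm S μ ν =>
      rw [FreeAlgebra.lift_ι_apply, FreeAlgebra.lift_ι_apply]
      have h1 : gen (Gen.tStar S μ ν) = gen (Gen.tStar S ν μ) := mk_rel (Rel.tStar_symm S μ ν)
      simp only [matrix, h1, hd.tStar_symm S μ ν]
      rfl
    | ghostStar j hj S z hz =>
      rw [map_zero]
      exact youngRel_matrix (X := Gen.ghostStar j hj S) (k - j + 1) (fun _ _ => rfl)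
        (isYoung_ghostStar j hj S) (hd.ghostStar j hj S) hz

/-- The odd right derivation with the given values on the generators. -/
def der : LocalForm k D →ₗ[ℝ] LocalForm k D :=
  (Matrix.entryLinearMap ℝ (LocalForm k D) (0 : Fin 2) (1 : Fin 2)).comp hd.hom.toLinearMap

theorem hom_gen (x : Gen k D) : hd.hom (gen x) = matrix d x := by
  rw [hom, gen, lift_mk, FreeAlgebra.lift_ι_apply]

theorem der_gen (x : Gen k D) : hd.der (gen x) = d x := by
  simp [der, hom_gen, matrix]

end IsOddOnGen

/-- The parity automorphism `a ↦ (-1)^{ε(a)} a`. -/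
def parityMap : LocalForm k D →ₗ[ℝ] LocalForm k D :=
  (Matrix.entryLinearMap ℝ (LocalForm k D) (1 : Fin 2) (1 : Fin 2)).comp
    (gammaHom (k := k) (D := D)).toLinearMap

theorem parityMap_gen (x : Gen k D) : parityMap (gen x) = (-1 : ℝ) ^ x.parity • gen x := by
  simp [parityMap, gammaHom_gen, gammaMatrix]

theorem parityMap_mul (a b : LocalForm k D) : parityMap (a * b) = parityMap a * parityMap b := by
  simp [parityMap, Matrix.mul_apply, Fin.sum_univ_two, gammaHom_col]

theorem parityMap_algebraMap (r : ℝ) :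
    parityMap (algebraMap ℝ (LocalForm k D) r) = algebraMap ℝ _ r := by
  simp [parityMap, Matrix.algebraMap_matrix_apply]

theorem gamma_mul (a b : LocalForm k D) :
    gamma (a * b) = a * gamma b + gamma a * parityMap b := by
  simp [gamma, parityMap, Matrix.mul_apply, Fin.sum_univ_two, gammaHom_col]

theorem IsOddOnGen.der_mul {d : Gen k D → LocalForm k D} (hd : IsOddOnGen d)
    (a b : LocalForm k D) : hd.der (a * b) = a * hd.der b + hd.der a * parityMap b := by
  have hcol : ∀ a : LocalForm k D,
      hd.hom a 0 0 = a ∧ hd.hom a 1 0 = 0 ∧ hd.hom a 1 1 = parityMap a := by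
    intro a
    induction a using LocalForm.induction with
    | halg r => simp [Matrix.algebraMap_matrix_apply, parityMap_algebraMap]
    | hgen x => simp [hd.hom_gen, IsOddOnGen.matrix, parityMap_gen]
    | hmul a b ha hb => simp [Matrix.mul_apply, Fin.sum_univ_two, ha, hb, parityMap_mul]
    | hadd a b ha hb => simp [ha, hb]
  simp [der, Matrix.mul_apply, Fin.sum_univ_two, hcol]

theorem parityMap_parityMap (a : LocalForm k D) : parityMap (parityMap a) = a := by
  induction a using LocalForm.induction with
  | halg r => rw [parityMap_algebraMap, parityMap_algebraMap]
  | hgen x => rw [parityMap_gen, map_smul, parityMap_gen, smul_smul, ← mul_pow]; simp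
  | hmul a b ha hb => rw [parityMap_mul, parityMap_mul, ha, hb]
  | hadd a b ha hb => rw [map_add, map_add, ha, hb]

/-- Linear maps satisfying the Leibniz rule of an odd right derivation. -/
def IsOddDer (f : LocalForm k D →ₗ[ℝ] LocalForm k D) : Prop :=
  ∀ a b, f (a * b) = a * f b + f a * parityMap b

theorem IsOddDer.map_algebraMap {f : LocalForm k D →ₗ[ℝ] LocalForm k D} (hf : IsOddDer f) (r : ℝ) :
    f (algebraMap ℝ _ r) = 0 := by
  have h := hf 1 1
  have h1 : parityMap (1 : LocalForm k D) = 1 := by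
    rw [← map_one (algebraMap ℝ (LocalForm k D)), parityMap_algebraMap]
  rw [h1, mul_one, one_mul, mul_one] at h
  rw [Algebra.algebraMap_eq_smul_one, map_smul, left_eq_add.1 h, smul_zero]

theorem IsOddDer.parityMap_comm {f : LocalForm k D →ₗ[ℝ] LocalForm k D} (hf : IsOddDer f)
    (hgen : ∀ x, parityMap (f (gen x)) = -f (parityMap (gen x))) (a : LocalForm k D) :
    parityMap (f a) = -f (parityMap a) := by
  induction a using LocalForm.induction with
  | halg r => rw [parityMap_algebraMap, hf.map_algebraMap]; simp
  | hgen x => exact hgen x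
  | hmul a b ha hb =>
    rw [hf, map_add, parityMap_mul, parityMap_mul, parityMap_mul, hf, ha, hb]
    noncomm_ring
  | hadd a b ha hb => rw [map_add, map_add, map_add, map_add, ha, hb]; abel

theorem IsOddDer.square_zero {f : LocalForm k D →ₗ[ℝ] LocalForm k D} (hf : IsOddDer f)
    (hp : ∀ a, parityMap (f a) = -f (parityMap a)) (hgen : ∀ x, f (f (gen x)) = 0)
    (a : LocalForm k D) : f (f a) = 0 := by
  induction a using LocalForm.induction with
  | halg r => rw [hf.map_algebraMap, map_zero]
  | hgen x => exact hgen x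
  | hmul a b ha hb =>
    rw [hf, map_add, hf, hf, hp, ha, hb]
    noncomm_ring
  | hadd a b ha hb => rw [map_add, map_add, ha, hb, add_zero]

/-- The anticommutator of two odd derivations is an even derivation. -/
theorem IsOddDer.anticomm_mul {f g : LocalForm k D →ₗ[ℝ] LocalForm k D} (hf : IsOddDer f)
    (hg : IsOddDer g) (hfp : ∀ a, parityMap (f a) = -f (parityMap a))
    (hgp : ∀ a, parityMap (g a) = -g (parityMap a)) (a b : LocalForm k D) :
    f (g (a * b)) + g (f (a * b)) = a * (f (g b) + g (f b)) + (f (g a) + g (f a)) * b := by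
  rw [hf, hg, map_add, map_add, hf, hg, hf, hg, hgp, hfp, parityMap_parityMap]
  noncomm_ring

/-! ### The contracting homotopy and the Laplacian -/

/-- The span of the generators `∂_S t` (for `l = 0`) or of the `∂_S η` of pure ghost number `l`
(for `l > 0`). -/
def fieldSpan (k D l : ℕ) : Submodule ℝ (LocalForm k D) :=
  Submodule.span ℝ {z | ∃ x : Gen k D, x.parity = l ∧ x.pgh = l ∧ x.agh = 0 ∧ x.formDeg = 0 ∧
    z = gen x}

open Fam

theorem genFun_mem_fieldSpan {b : ℕ} (S : Multiset (Fin D)) (μ : Fin k → Fin D)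
    (ν : Fin b → Fin D) : genFun k D S k μ b ν ∈ fieldSpan k D (k - b) := by
  rcases lt_trichotomy b k with hb | hb | hb
  · rw [genFun_ghost hb]
    exact Submodule.subset_span ⟨_, rfl, rfl, rfl, rfl, rfl⟩
  · subst hb
    rw [genFun_t, Nat.sub_self]
    refine zsmul_mem ?_ _
    exact Submodule.subset_span ⟨_, by simp [Gen.parity], rfl, rfl, rfl, rfl⟩
  · rw [genFun_gt hb]; exact zero_mem _

theorem ev_L_mem_fieldSpan (hk : 0 < k) {b : ℕ} (S : Multiset (Fin D)) (μ : Fin k → Fin D)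
    (ν : Fin b → Fin D) (hb : b ≤ k) :
    ev (osc.L (genFam k D)) S μ ν ∈ fieldSpan k D (k - b + 1) := by
  obtain ⟨n, rfl⟩ : ∃ n, k = n + 1 := ⟨k - 1, by omega⟩
  cases b with
  | zero =>
    rw [ev_L, ev_A_true_zero, ev_A_false]
    simp [ev_E_true_zero, zero_mem]
  | succ b =>
    have h : ∀ S' (μ' : Fin (n + 1) → Fin D) (ν' : Fin b → Fin D),
        ev (genFam (n + 1) D) S' μ' ν' ∈ fieldSpan (n + 1) D (n + 1 - (b + 1) + 1) := by
      intro S' μ' ν'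
      have : n + 1 - (b + 1) + 1 = n + 1 - b := by omega
      rw [this]
      exact genFun_mem_fieldSpan _ _ _
    rw [ev_L_succ]
    exact add_mem (sum_mem fun l _ => zsmul_mem (sum_mem fun i _ => h _ _ _) _)
      (Submodule.smul_mem _ _ (sum_mem fun l _ => zsmul_mem (h _ _ _) _))

theorem ev_B_mem_fieldSpan {b : ℕ} (S : Multiset (Fin D)) (μ : Fin k → Fin D)
    (ν : Fin b → Fin D) :
    ev (osc.B true (genFam k D)) S μ ν ∈ fieldSpan k D (k - (b + 1)) := by
  rw [ev_B_true]
  exact sum_mem fun ρ _ => Submodule.smul_mem _ _ (genFun_mem_fieldSpan _ _ _)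

theorem gammaGen_mem_fieldSpan (hk : 0 < k) (x : Gen k D) :
    gammaGen x ∈ fieldSpan k D (x.pgh + 1) := by
  cases x with
  | dx => exact zero_mem _
  | tStar => exact zero_mem _
  | ghostStar => exact zero_mem _
  | t S μ ν =>
    rw [gammaGen_t hk]
    have := ev_L_mem_fieldSpan hk S μ ν le_rfl
    rwa [Nat.sub_self] at this
  | ghost j hj S μ ν =>
    rw [gammaGen_ghost]
    exact zsmul_mem (ev_L_mem_fieldSpan hk S μ ν hj.le) _

/-- The contracting homotopy on the generators: a derivative index of a ghost is moved to the
second column. -/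
def htpyGen : Gen k D → LocalForm k D
  | .ghost _ _ S μ ν => sgn k • ev (osc.B true (genFam k D)) S μ ν
  | _ => 0

theorem gen_mul_fieldSpan {l : ℕ} (y : Gen k D) {m : LocalForm k D} (hm : m ∈ fieldSpan k D l) :
    gen y * m = (-1 : ℝ) ^ (y.parity * l) • (m * gen y) := by
  induction hm using Submodule.span_induction with
  | mem z hz =>
    obtain ⟨x, h1, -, -, -, rfl⟩ := hz
    rw [gen_comm, h1]
  | zero => simp
  | add a b _ _ ha hb => rw [mul_add, add_mul, ha, hb, smul_add]
  | smul r a _ ha => rw [mul_smul_comm, ha, smul_mul_assoc, smul_comm]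

theorem parityMap_fieldSpan {l : ℕ} {m : LocalForm k D} (hm : m ∈ fieldSpan k D l) :
    parityMap m = (-1 : ℝ) ^ l • m := by
  induction hm using Submodule.span_induction with
  | mem z hz =>
    obtain ⟨x, h1, -, -, -, rfl⟩ := hz
    rw [parityMap_gen, h1]
  | zero => simp
  | add a b _ _ ha hb => rw [map_add, ha, hb, smul_add]
  | smul r a _ ha => rw [map_smul, ha, smul_comm]

theorem IsYoung.zsmul {ι M : Type*} [AddCommGroup M] {k j : ℕ}
    {X : (Fin k → ι) → (Fin j → ι) → M} (hX : IsYoung X) (r : ℤ) :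
    IsYoung fun μ ν => r • X μ ν where
  left a b hab μ ν := by rw [hX.left a b hab, smul_neg]
  right a b hab μ ν := by rw [hX.right a b hab, smul_neg]
  bianchi h μ ν := by rw [← Finset.smul_sum, ← hX.bianchi h]

theorem isOddOnGen_htpyGen : IsOddOnGen (htpyGen (k := k) (D := D)) where
  comm x y := by
    cases x with
    | ghost j hj S μ ν =>
      have h := gen_mul_fieldSpan y (zsmul_mem (ev_B_mem_fieldSpan S μ ν) (sgn k))
      rw [htpyGen, h, show (Gen.ghost j hj S μ ν).parity = k - j from rfl]
      congr 1
      have : y.parity * (k - j + 1) = y.parity * (k - (j + 1)) + 2 * y.parity := by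
        rw [show k - j + 1 = k - (j + 1) + 2 by omega]; ring
      rw [this, pow_add, pow_mul (-1 : ℝ) 2]
      simp
    | _ => simp [htpyGen]
  t S := isYoung_zero
  t_symm S μ ν := rfl
  ghost j hj S := by
    have h : osc.E false (osc.B true (genFam k D)) = 0 := by
      have h1 : osc.E false * osc.B true =
          -(osc.B true * osc.E false : Module.End ℝ (Fam (Fin D) (LocalForm k D))) :=
        osc.E_B' false
      have h2 := LinearMap.congr_fun h1 (genFam k D)
      rw [LinearMap.neg_apply, Module.End.mul_apply, Module.End.mul_apply, E_false_genFam,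
        map_zero, neg_zero] at h2
      exact h2
    exact (isYoung_ev _ S h k j).zsmul _
  tStar S := isYoung_zero
  tStar_symm S μ ν := rfl
  ghostStar j hj S := isYoung_zero

/-- The contracting homotopy: the odd right derivation with the values `htpyGen`. -/
def htpy : LocalForm k D →ₗ[ℝ] LocalForm k D := isOddOnGen_htpyGen.der

theorem htpy_gen (x : Gen k D) : htpy (gen x) = htpyGen x := isOddOnGen_htpyGen.der_gen x

theorem isOddDer_htpy : IsOddDer (htpy (k := k) (D := D)) := isOddOnGen_htpyGen.der_mul

theorem isOddDer_gamma : IsOddDer (gamma (k := k) (D := D)) := gamma_mul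

theorem parityMap_gamma (hk : 0 < k) (a : LocalForm k D) :
    parityMap (gamma a) = -gamma (parityMap a) := by
  refine isOddDer_gamma.parityMap_comm (fun x => ?_) a
  rw [gamma_gen, parityMap_gen, map_smul, gamma_gen]
  cases x with
  | t S μ ν =>
    rw [parityMap_fieldSpan (gammaGen_mem_fieldSpan hk _)]
    simp [Gen.pgh, Gen.parity]
  | ghost j hj S μ ν =>
    rw [parityMap_fieldSpan (gammaGen_mem_fieldSpan hk _)]
    simp [Gen.pgh, Gen.parity, pow_succ]
  | _ => simp [gammaGen]

theorem parityMap_htpy (a : LocalForm k D) : parityMap (htpy a) = -htpy (parityMap a) := by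
  refine isOddDer_htpy.parityMap_comm (fun x => ?_) a
  rw [htpy_gen, parityMap_gen, map_smul, htpy_gen]
  cases x with
  | ghost j hj S μ ν =>
    rw [htpyGen, parityMap_fieldSpan (zsmul_mem (ev_B_mem_fieldSpan S μ ν) (sgn k))]
    have : (Gen.ghost j hj S μ ν).parity = k - (j + 1) + 1 := by
      simp only [Gen.parity]; omega
    rw [this, pow_succ]
    simp
  | _ => simp [htpyGen]

theorem post_htpy : post htpy (genFam k D) = sgn k • osc.B true (genFam k D) := by
  refine Fam.ext fun a b S μ ν => ?_
  have hR : (sgn k • osc.B true (genFam k D)).ev S μ ν =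
      sgn k • ev (osc.B true (genFam k D)) S μ ν :=
    map_zsmul (evL S μ ν) _ _
  rw [hR, ev_post, ev_genFam]
  by_cases ha : a = k
  · subst ha
    rcases lt_trichotomy b a with hb | hb | hb
    · rw [genFun_ghost hb, htpy_gen, htpyGen]
    · subst hb
      rw [genFun_t, map_zsmul, htpy_gen]
      simp [htpyGen, ev_B_true, ev_genFam, genFun_gt (Nat.lt_succ_self b)]
    · rw [genFun_gt hb, map_zero]
      simp [ev_B_true, ev_genFam, genFun_gt (hb.trans (Nat.lt_succ_self b))]
  · rw [genFun_ne ha, map_zero]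
    simp [ev_B_true, ev_genFam, genFun_ne ha]

/-- The exterior longitudinal derivative is a differential. -/
theorem gamma_gamma (hk : 0 < k) (a : LocalForm k D) : gamma (gamma a) = 0 := by
  have h0 : post gamma (post gamma (genFam k D)) = 0 := by
    have h1 := LinearMap.congr_fun (osc.L_mul_L (ι := Fin D)
      (R := Module.End ℝ (Fam (Fin D) (LocalForm k D)))) (genFam k D)
    rw [Module.End.mul_apply] at h1
    rw [post_gamma hk, map_zsmul, post_L, post_gamma hk, map_zsmul, h1]
    simp
  have h1 : ∀ (b : ℕ) (S : Multiset (Fin D)) (μ : Fin k → Fin D) (ν : Fin b → Fin D),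
      gamma (gamma (genFun k D S k μ b ν)) = 0 := fun b S μ ν =>
    congrArg (fun X : Fam (Fin D) (LocalForm k D) => ev X S μ ν) h0
  refine isOddDer_gamma.square_zero (parityMap_gamma hk) (fun x => ?_) a
  cases x with
  | t S μ ν =>
    rw [← sgn_smul_sgn k (gen (.t S μ ν)), ← genFun_t, map_zsmul, map_zsmul, h1, smul_zero]
  | ghost j hj S μ ν => rw [← genFun_ghost, h1]
  | _ => rw [gamma_gen, gammaGen, map_zero] <;> simp

/-- The Laplacian of `γ` and the contracting homotopy. -/
def lap : LocalForm k D →ₗ[ℝ] LocalForm k D := gamma ∘ₗ htpy + htpy ∘ₗ gamma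

theorem lap_apply (a : LocalForm k D) : lap a = gamma (htpy a) + htpy (gamma a) := rfl

theorem lap_mul (hk : 0 < k) (a b : LocalForm k D) : lap (a * b) = a * lap b + lap a * b :=
  isOddDer_gamma.anticomm_mul isOddDer_htpy (parityMap_gamma hk) parityMap_htpy a b

theorem lap_algebraMap (r : ℝ) : lap (algebraMap ℝ (LocalForm k D) r) = 0 := by
  rw [lap_apply, isOddDer_htpy.map_algebraMap, isOddDer_gamma.map_algebraMap, map_zero,
    map_zero, add_zero]

theorem gamma_lap (hk : 0 < k) (a : LocalForm k D) : gamma (lap a) = lap (gamma a) := by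
  simp [lap_apply, gamma_gamma hk]

theorem post_lap (hk : 0 < k) : post lap (genFam k D) = osc.D (genFam k D) := by
  have h : post lap (genFam k D) = post gamma (post htpy (genFam k D)) +
      post htpy (post gamma (genFam k D)) := rfl
  have h2 := LinearMap.congr_fun (osc.B_L_add_L_B (ι := Fin D)
    (R := Module.End ℝ (Fam (Fin D) (LocalForm k D)))) (genFam k D)
  simp only [LinearMap.add_apply, LinearMap.sub_apply, Module.End.mul_apply, E_false_genFam,
    map_zero, sub_zero] at h2
  rw [h, post_htpy, post_gamma hk, map_zsmul, map_zsmul, post_B, post_L, post_gamma hk, post_htpy,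
    map_zsmul, map_zsmul, sgn_smul_sgn, sgn_smul_sgn, h2]

end

section

open Fam

variable {k D : ℕ}

/-! ### Eigenvectors of the Laplacian -/

/-- If `f v - r v` is a sum of vectors from eigenspaces for eigenvalues other than `r`, then `v`
is a sum of eigenvectors. -/
theorem mem_iSup_of_sub_smul_mem {V : Type*} [AddCommGroup V] [Module ℝ V] (f : Module.End ℝ V)
    (E : ℝ → Submodule ℝ V) (hE : ∀ r, E r ≤ f.eigenspace r) {s : Set ℝ} {r : ℝ} (hr : r ∉ s)
    (hEr : f.eigenspace r ≤ E r) {v : V} (hv : f v - r • v ∈ ⨆ i ∈ s, E i) :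
    v ∈ ⨆ i ∈ insert r s, E i := by
  have h : ⨆ i ∈ s, E i ≤ (⨆ i ∈ s, E i).map (f - r • (1 : Module.End ℝ V)) := by
    refine iSup₂_le fun i hi y hy => ?_
    have hir : i - r ≠ 0 := sub_ne_zero.2 fun h => hr (h ▸ hi)
    refine ⟨(i - r)⁻¹ • y, Submodule.smul_mem _ _ (Submodule.mem_iSup_of_mem i
      (Submodule.mem_iSup_of_mem hi hy)), ?_⟩
    have hf : f y = i • y := Module.End.mem_eigenspace_iff.1 (hE i hy)
    simp only [LinearMap.sub_apply, LinearMap.smul_apply, Module.End.one_apply, map_smul, hf]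
    rw [← sub_smul, smul_smul, inv_mul_cancel₀ hir, one_smul]
  obtain ⟨y, hy, hy'⟩ := h hv
  have h1 : v - y ∈ f.eigenspace r := by
    rw [Module.End.mem_eigenspace_iff, map_sub, smul_sub, sub_eq_sub_iff_sub_eq_sub]
    simpa using hy'.symm
  rw [iSup_insert]
  have := Submodule.add_mem_sup (hEr h1) hy
  rwa [sub_add_cancel] at this

/-- The generators of the algebra of invariant polynomials. -/
def invariantGens (k D : ℕ) : Set (LocalForm k D) :=
  {z | ∃ ρ, z = gen (.dx ρ)} ∪
      {z | ∃ S μ ν, z = gen (.tStar S μ ν)} ∪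
      {z | ∃ j hj S μ ν, z = gen (.ghostStar j hj S μ ν)} ∪
      {z | ∃ S μ ν, z = curvature S μ ν}

/-- The top ghosts and their curls. -/
def topGens (hk : 0 < k) (D : ℕ) : Set (LocalForm k D) :=
  {z | ∃ μ, z = topGhost hk μ} ∪ {z | ∃ μ, z = topGhostCurl hk μ}

theorem gamma_invariantGens (hk : 0 < k) {z : LocalForm k D} (hz : z ∈ invariantGens k D) :
    gamma z = 0 := by
  rcases hz with ((⟨ρ, rfl⟩ | ⟨S, μ, ν, rfl⟩) | ⟨j, hj, S, μ, ν, rfl⟩) | ⟨S, μ, ν, rfl⟩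
  · exact gamma_gen _
  · exact gamma_gen _
  · exact gamma_gen _
  · have h0 : osc.A false (osc.A true (osc.L (genFam k D))) = 0 :=
      LinearMap.congr_fun (Oscillators.A_A_L osc) _
    have h : post gamma (osc.A false (osc.A true (genFam k D))) = 0 := by
      rw [post_A, post_A, post_gamma hk, map_zsmul, map_zsmul, h0, smul_zero]
    rw [curvature_eq, map_zsmul, ← ev_post, h, ev_zero, smul_zero]

theorem gamma_topGhost (hk : 0 < k) (S : Multiset (Fin D)) (μ : Fin k → Fin D) :
    gamma (gen (.ghost 0 hk S μ Fin.elim0)) = 0 := by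
  rw [gamma_gen]
  simp [gammaGen, ghostGauge]

theorem gamma_topGens (hk : 0 < k) {z : LocalForm k D} (hz : z ∈ topGens hk D) :
    gamma z = 0 := by
  rcases hz with ⟨μ, rfl⟩ | ⟨μ, rfl⟩
  · exact gamma_topGhost hk _ _
  · rw [topGhostCurl, map_sum]
    exact Finset.sum_eq_zero fun i _ => by rw [map_zsmul, gamma_topGhost, smul_zero]

theorem htpy_zero_modes (hk : 0 < k) {z : LocalForm k D}
    (hz : z ∈ invariantGens k D ∪ topGens hk D) : htpy z = 0 := by
  rcases hz with (((⟨ρ, rfl⟩ | ⟨S, μ, ν, rfl⟩) | ⟨j, hj, S, μ, ν, rfl⟩) | ⟨S, μ, ν, rfl⟩) |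
    ⟨μ, rfl⟩ | ⟨μ, rfl⟩
  · exact htpy_gen _
  · exact htpy_gen _
  · exact htpy_gen _
  · rw [curvature, map_sum]
    refine Finset.sum_eq_zero fun i _ => ?_
    rw [map_sum]
    exact Finset.sum_eq_zero fun l _ => by
      rw [map_zsmul, htpy_gen]; exact smul_zero _
  · simp [topGhost, htpy_gen, htpyGen, ev_B_card_zero]
  · -- the homotopy removes the derivative; the result vanishes by the Bianchi I identity
    have h1 : osc.A false * osc.B true =
        (osc.E false + osc.B true * osc.A false : Module.End ℝ (Fam (Fin D) (LocalForm k D))) :=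
      osc.A_B' false
    have h2 := LinearMap.congr_fun h1 (genFam k D)
    rw [LinearMap.add_apply, Module.End.mul_apply, Module.End.mul_apply, E_false_genFam,
      zero_add] at h2
    rw [topGhostCurl_eq, ← ev_post, post_A, post_htpy, map_zsmul, h2]
    refine (map_zsmul (evL (0 : Multiset (Fin D)) μ Fin.elim0) _ _).trans ?_
    change sgn k • ev (osc.B true (osc.A false (genFam k D))) 0 μ Fin.elim0 = 0
    rw [ev_B_card_zero, smul_zero]

theorem gamma_zero_modes (hk : 0 < k) {z : LocalForm k D}
    (hz : z ∈ invariantGens k D ∪ topGens hk D) : gamma z = 0 :=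
  hz.elim (gamma_invariantGens hk) (gamma_topGens hk)

theorem lap_zero_modes (hk : 0 < k) {z : LocalForm k D}
    (hz : z ∈ invariantGens k D ∪ topGens hk D) : lap z = 0 := by
  rw [lap_apply, htpy_zero_modes hk hz, gamma_zero_modes hk hz, map_zero, map_zero, add_zero]

/-- The eigenspaces of the Laplacian, except that for the eigenvalue `0` only the linear
combinations of the generators of the cohomology are taken. -/
noncomputable def modes (hk : 0 < k) (D : ℕ) (r : ℝ) : Submodule ℝ (LocalForm k D) :=
  if r = 0 then Submodule.span ℝ (invariantGens k D ∪ topGens hk D)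
  else Module.End.eigenspace lap r

theorem modes_zero (hk : 0 < k) :
    modes hk D 0 = Submodule.span ℝ (invariantGens k D ∪ topGens hk D) := if_pos rfl

theorem modes_of_ne (hk : 0 < k) {r : ℝ} (hr : r ≠ 0) :
    modes hk D r = Module.End.eigenspace lap r := if_neg hr

theorem modes_le (hk : 0 < k) (r : ℝ) : modes hk D r ≤ Module.End.eigenspace lap r := by
  by_cases hr : r = 0
  · subst hr
    rw [modes_zero, Submodule.span_le]
    intro z hz
    rw [SetLike.mem_coe, Module.End.mem_eigenspace_iff, lap_zero_modes hk hz, zero_smul]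
  · rw [modes_of_ne hk hr]

theorem mem_modes (hk : 0 < k) {r : ℝ} (hr : r ≠ 0) {v : LocalForm k D} (hv : lap v = r • v) :
    v ∈ modes hk D r := by
  rw [modes_of_ne hk hr]
  exact Module.End.mem_eigenspace_iff.2 hv

theorem ev_num_smul {ι N : Type*} [DecidableEq ι] [Fintype ι] [AddCommGroup N] [Module ℝ N]
    (X : Fam ι N) {a b : ℕ} (S : Multiset ι) (μ : Fin a → ι) (ν : Fin b → ι) :
    ev (((osc.m + 1) * (osc.nx + osc.n true) : Module.End ℝ (Fam ι N)) X) S μ ν =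
      (((a : ℝ) - b + 2) * ((S.card : ℝ) + b)) • ev X S μ ν := by
  rw [Module.End.mul_apply, LinearMap.add_apply, ev_add, ev_m, Module.End.one_apply, ev_N]
  module

/-- The Laplacian on a generator and its images under the operators `C`, `B₂ L` and `Z`. -/
theorem lap_chain (hk : 0 < k) {b : ℕ} (S : Multiset (Fin D)) (μ : Fin k → Fin D)
    (ν : Fin b → Fin D) (q x : ℝ) (hq : q = k - b) (hx : x = S.card + b) :
    let v := ev (genFam k D) S μ ν
    let w := ev (osc.C (genFam k D)) S μ ν
    let u := ev (osc.B true (osc.L (genFam k D))) S μ ν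
    let z := ev (osc.Z (genFam k D)) S μ ν
    lap v = ((q + 2) * x) • v - w ∧ lap w = ((q + 1) * (x - 1)) • w + u - (2 : ℝ) • z ∧
      lap u = ((q + 1) * x) • u - q • z ∧ lap z = (q * (x - 1)) • z := by
  subst hq hx
  intro v w u z
  have hD : ∀ Y : Fam (Fin D) (LocalForm k D), ev (osc.D Y) S μ ν =
      (((k : ℝ) - b + 2) * (S.card + b)) • ev Y S μ ν - ev (osc.C Y) S μ ν := by
    intro Y
    rw [Oscillators.D, LinearMap.sub_apply, ev_sub, ev_num_smul]
  refine ⟨?_, ?_, ?_, ?_⟩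
  · rw [← ev_post, post_lap hk, hD]
  · rw [← ev_post, post_C, post_lap hk]
    obtain ⟨X, hX⟩ := (osc (ι := Fin D) (N := LocalForm k D)).C_mul_D
    have h := LinearMap.congr_fun hX (genFam k D)
    simp only [Module.End.mul_apply, LinearMap.add_apply, LinearMap.sub_apply, E_false_genFam,
      map_zero, add_zero, map_add, Module.End.one_apply] at h
    rw [h]
    simp only [ev_add, ev_sub, ev_m, ev_nx, ev_n_true]
    rw [show (2 : Module.End ℝ (Fam (Fin D) (LocalForm k D))) (osc.Z (genFam k D)) =
      (2 : ℝ) • osc.Z (genFam k D) by rw [two_smul]; exact two_nsmul _, ev_smul]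
    simp only [w, u, z]
    module
  · rw [← ev_post, post_B, post_L, post_lap hk]
    obtain ⟨X, hX⟩ := (osc (ι := Fin D) (N := LocalForm k D)).B_L_mul_D
    have h := LinearMap.congr_fun hX (genFam k D)
    simp only [Module.End.mul_apply, LinearMap.add_apply, LinearMap.sub_apply, E_false_genFam,
      map_zero, add_zero, map_add, Module.End.one_apply] at h
    rw [h]
    simp only [ev_add, ev_sub, ev_m, ev_nx, ev_n_true]
    simp only [u, z]
    module
  · rw [← ev_post, post_Z, post_lap hk]
    have h := LinearMap.congr_fun (osc (ι := Fin D) (N := LocalForm k D)).Z_mul_D (genFam k D)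
    simp only [Module.End.mul_apply, LinearMap.add_apply, LinearMap.sub_apply, map_add,
      Module.End.one_apply] at h
    rw [h]
    have h2 : ∀ Y : Fam (Fin D) (LocalForm k D),
        (2 : Module.End ℝ (Fam (Fin D) (LocalForm k D))) Y = (2 : ℝ) • Y := by
      intro Y; rw [two_smul]; exact two_nsmul _
    simp only [ev_add, ev_sub, ev_m, ev_nx, ev_n_true, h2, ev_smul]
    simp only [z]
    module

theorem ev_C_top_one (hk : 0 < k) (ρ : Fin D) (μ : Fin k → Fin D) :
    ev (osc.C (genFam k D)) {ρ} μ (Fin.elim0 : Fin 0 → Fin D) =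
      topGhostCurl hk (Fin.cons ρ μ) + genFun k D {ρ} k μ 0 Fin.elim0 := by
  have hs : ∀ f : Fin D → LocalForm k D, ∑ σ, (Multiset.count σ {ρ} : ℝ) • f σ = f ρ := by
    intro f
    rw [Finset.sum_eq_single ρ]
    · simp
    · intro σ _ hσ
      rw [Multiset.count_singleton, if_neg hσ]; simp
    · simp
  rw [Oscillators.C, LinearMap.add_apply, ev_add, Module.End.mul_apply, Module.End.mul_apply,
    ev_B_false, ev_B_true, hs, hs, Multiset.erase_singleton, topGhostCurl_eq]
  congr 1
  rw [ev_A_true]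
  simp [ev_genFam]

/-- The first derivative of a top ghost is its curl and an eigenvector for the eigenvalue
`k + 1`. -/
theorem genFun_top_one_mem (hk : 0 < k) (ρ : Fin D) (μ : Fin k → Fin D) (ν : Fin 0 → Fin D) :
    genFun k D {ρ} k μ 0 ν ∈ ⨆ r ∈ Set.Ici (0 : ℝ), modes hk D r := by
  obtain rfl : ν = Fin.elim0 := Subsingleton.elim _ _
  obtain ⟨h1, -⟩ := lap_chain hk {ρ} μ (Fin.elim0 : Fin 0 → Fin D) k 1 (by simp) (by simp)
  rw [ev_genFam, ev_C_top_one hk] at h1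
  have h2 : lap (genFun k D {ρ} k μ 0 Fin.elim0) -
      ((k : ℝ) + 1) • genFun k D {ρ} k μ 0 Fin.elim0 =
      -topGhostCurl hk (Fin.cons ρ μ : Fin (k + 1) → Fin D) := by
    rw [h1]
    module
  have h3 := mem_iSup_of_sub_smul_mem lap (modes hk D) (modes_le hk) (s := {0}) (r := (k : ℝ) + 1)
    (v := genFun k D {ρ} k μ 0 Fin.elim0)
    (by simp only [Set.mem_singleton_iff]; positivity) (modes_of_ne hk (by positivity)).ge (by
      rw [h2, iSup_singleton, modes_zero]
      exact neg_mem (Submodule.subset_span (Or.inr (Or.inr ⟨_, rfl⟩))))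
  have hle : ⨆ i ∈ (insert ((k : ℝ) + 1) {0} : Set ℝ), modes hk D i ≤
      ⨆ r ∈ Set.Ici (0 : ℝ), modes hk D r := by
    refine biSup_mono fun i hi => ?_
    rcases hi with rfl | rfl
    · exact Set.mem_Ici.2 (by positivity)
    · exact Set.self_mem_Ici
  exact hle h3

/-- The fields, the ghosts and their derivatives are sums of eigenvectors of the Laplacian with
non-negative eigenvalues. The eigenvalues of a generator with `p` derivative indices and mixed
symmetry `(k, b)` are `(q + 2) x`, `(q + 1) x`, `(q + 1) (x - 1)` and `q (x - 1)` with `q = k - b`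
and `x = p + b`; an eigenvector for the last one is a combination of derivatives of the
curvature if `q = 0`. -/
theorem genFun_mem_modes (hk : 0 < k) {b : ℕ} (hb : b ≤ k) (S : Multiset (Fin D))
    (μ : Fin k → Fin D) (ν : Fin b → Fin D) :
    genFun k D S k μ b ν ∈ ⨆ r ∈ Set.Ici (0 : ℝ), modes hk D r := by
  obtain ⟨h1, h2, h3, h4⟩ := lap_chain hk S μ ν (k - b) (S.card + b) rfl rfl
  have hbr : (b : ℝ) ≤ k := by exact_mod_cast hb
  rw [ev_genFam] at h1
  set v := genFun k D S k μ b ν with hv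
  set w := ev (osc.C (genFam k D)) S μ ν with hw
  set u := ev (osc.B true (osc.L (genFam k D))) S μ ν with hu
  set z := ev (osc.Z (genFam k D)) S μ ν with hz
  rcases Multiset.empty_or_exists_mem S with hS | hS
  · -- without derivative indices the generator is itself an eigenvector
    subst hS
    have hw0 : w = 0 := by
      rw [hw, Oscillators.C, LinearMap.add_apply, ev_add, Module.End.mul_apply,
        Module.End.mul_apply, ev_B_card_zero, ev_B_card_zero, add_zero]
    rw [hw0, sub_zero, Multiset.card_zero, Nat.cast_zero, zero_add] at h1
    rcases Nat.eq_zero_or_pos b with h0 | h0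
    · subst h0
      refine Submodule.mem_iSup_of_mem 0 (Submodule.mem_iSup_of_mem Set.self_mem_Ici ?_)
      rw [modes_zero]
      refine Submodule.subset_span (Or.inr (Or.inl ⟨μ, ?_⟩))
      rw [hv, genFun_ghost hk, topGhost]
      congr 2
      exact Subsingleton.elim _ _
    · have hb0 : (0 : ℝ) < b := by exact_mod_cast h0
      have hpos : 0 < ((k : ℝ) - b + 2) * b := mul_pos (by linarith) hb0
      exact Submodule.mem_iSup_of_mem _ (Submodule.mem_iSup_of_mem hpos.le
        (mem_modes hk hpos.ne' h1))
  have hp : 1 ≤ S.card := Multiset.card_pos_iff_exists_mem.2 hS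
  by_cases hx1 : S.card + b = 1
  · obtain rfl : b = 0 := by omega
    obtain ⟨ρ, rfl⟩ := Multiset.card_eq_one.1 (by omega : S.card = 1)
    exact genFun_top_one_mem hk ρ μ ν
  have hx : (2 : ℝ) ≤ S.card + b := by exact_mod_cast (by omega : 2 ≤ S.card + b)
  set x : ℝ := S.card + b with hxdef
  set q : ℝ := k - b with hqdef
  have hq : 0 ≤ q := sub_nonneg.2 hbr
  have hz' : z ∈ modes hk D (q * (x - 1)) := by
    rcases hq.eq_or_lt with h0 | h0
    · rw [← h0, zero_mul, modes_zero]
      obtain rfl : b = k := by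
        have : (b : ℝ) = k := by rw [hqdef] at h0; linarith
        exact_mod_cast this
      rw [hz, Oscillators.Z]
      simp only [Module.End.mul_apply, ev_B_false, ev_B_true]
      refine sum_mem fun ρ _ => Submodule.smul_mem _ _ (sum_mem fun σ _ =>
        Submodule.smul_mem _ _ ?_)
      rw [← sgn_smul_sgn b (ev _ _ _ _), ← curvature_eq]
      refine zsmul_mem ?_ _
      exact Submodule.subset_span (Or.inl (Or.inr ⟨_, _, _, rfl⟩))
    · exact mem_modes hk (mul_pos h0 (by linarith)).ne' h4
  have r0 : 0 ≤ q * (x - 1) := mul_nonneg hq (by linarith)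
  have r1 : q * (x - 1) < (q + 1) * (x - 1) := by nlinarith
  have r2 : (q + 1) * (x - 1) < (q + 1) * x := by nlinarith
  have r3 : (q + 1) * x < (q + 2) * x := by nlinarith
  have hu' : u ∈ ⨆ i ∈ ({(q + 1) * x, q * (x - 1)} : Set ℝ), modes hk D i := by
    refine mem_iSup_of_sub_smul_mem lap (modes hk D) (modes_le hk) ?_
      (modes_of_ne hk (by linarith)).ge ?_
    · simp only [Set.mem_singleton_iff]; linarith
    · have h : lap u - ((q + 1) * x) • u = -(q • z) := by rw [h3]; abel
      rw [h, iSup_singleton]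
      exact neg_mem (Submodule.smul_mem _ _ hz')
  have hz'' : z ∈ ⨆ i ∈ ({(q + 1) * x, q * (x - 1)} : Set ℝ), modes hk D i :=
    Submodule.mem_iSup_of_mem _ (Submodule.mem_iSup_of_mem (by simp) hz')
  have hw' : w ∈ ⨆ i ∈ ({(q + 1) * (x - 1), (q + 1) * x, q * (x - 1)} : Set ℝ),
      modes hk D i := by
    refine mem_iSup_of_sub_smul_mem lap (modes hk D) (modes_le hk) ?_
      (modes_of_ne hk (by linarith)).ge ?_
    · simp only [Set.mem_insert_iff, Set.mem_singleton_iff, not_or]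
      exact ⟨by linarith, by linarith⟩
    · have h : lap w - ((q + 1) * (x - 1)) • w = u - (2 : ℝ) • z := by rw [h2]; abel
      rw [h]
      exact sub_mem hu' (Submodule.smul_mem _ _ hz'')
  have hv' : v ∈ ⨆ i ∈ ({(q + 2) * x, (q + 1) * (x - 1), (q + 1) * x, q * (x - 1)} : Set ℝ),
      modes hk D i := by
    refine mem_iSup_of_sub_smul_mem lap (modes hk D) (modes_le hk) ?_
      (modes_of_ne hk (by linarith)).ge ?_
    · simp only [Set.mem_insert_iff, Set.mem_singleton_iff, not_or]
      exact ⟨by linarith, by linarith, by linarith⟩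
    · have h : lap v - ((q + 2) * x) • v = -w := by rw [h1]; abel
      rw [h]
      exact neg_mem hw'
  have hle : ⨆ i ∈ ({(q + 2) * x, (q + 1) * (x - 1), (q + 1) * x, q * (x - 1)} : Set ℝ),
      modes hk D i ≤ ⨆ r ∈ Set.Ici (0 : ℝ), modes hk D r := by
    refine biSup_mono fun i hi => ?_
    simp only [Set.mem_insert_iff, Set.mem_singleton_iff] at hi
    rcases hi with rfl | rfl | rfl | rfl <;> exact Set.mem_Ici.2 (by linarith)
  exact hle hv'

theorem gen_mem_modes (hk : 0 < k) (x : Gen k D) :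
    gen x ∈ ⨆ r ∈ Set.Ici (0 : ℝ), modes hk D r := by
  have h0 : modes hk D 0 ≤ ⨆ r ∈ Set.Ici (0 : ℝ), modes hk D r :=
    le_iSup₂_of_le 0 Set.self_mem_Ici le_rfl
  cases x with
  | dx ρ =>
    refine h0 ?_
    rw [modes_zero]
    exact Submodule.subset_span (Or.inl (Or.inl (Or.inl (Or.inl ⟨_, rfl⟩))))
  | tStar S μ ν =>
    refine h0 ?_
    rw [modes_zero]
    exact Submodule.subset_span (Or.inl (Or.inl (Or.inl (Or.inr ⟨_, _, _, rfl⟩))))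
  | ghostStar j hj S μ ν =>
    refine h0 ?_
    rw [modes_zero]
    exact Submodule.subset_span (Or.inl (Or.inl (Or.inr ⟨_, _, _, _, _, rfl⟩)))
  | t S μ ν =>
    rw [← sgn_smul_sgn k (gen (.t S μ ν)), ← genFun_t]
    exact zsmul_mem (genFun_mem_modes hk le_rfl S μ ν) _
  | ghost j hj S μ ν =>
    rw [← genFun_ghost]
    exact genFun_mem_modes hk hj.le S μ ν

/-! ### Hodge decomposition of the algebra of local forms -/

/-- The algebra generated by the zero modes. -/
def zeroModeAlgebra (hk : 0 < k) (D : ℕ) : Subalgebra ℝ (LocalForm k D) :=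
  Algebra.adjoin ℝ (invariantGens k D ∪ topGens hk D)

/-- The sum of the eigenspaces of the Laplacian with positive eigenvalues. -/
def positivePart (k D : ℕ) : Submodule ℝ (LocalForm k D) :=
  ⨆ r ∈ Set.Ioi (0 : ℝ), Module.End.eigenspace lap r

theorem gamma_zeroModeAlgebra (hk : 0 < k) {a : LocalForm k D} (ha : a ∈ zeroModeAlgebra hk D) :
    gamma a = 0 := by
  induction ha using Algebra.adjoin_induction with
  | mem x hx => exact gamma_zero_modes hk hx
  | algebraMap r => exact isOddDer_gamma.map_algebraMap r
  | add a b _ _ ha hb => rw [map_add, ha, hb, add_zero]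
  | mul a b _ _ ha hb => rw [gamma_mul, ha, hb, mul_zero, zero_mul, add_zero]

theorem lap_zeroModeAlgebra (hk : 0 < k) {a : LocalForm k D} (ha : a ∈ zeroModeAlgebra hk D) :
    lap a = 0 := by
  induction ha using Algebra.adjoin_induction with
  | mem x hx => exact lap_zero_modes hk hx
  | algebraMap r => exact lap_algebraMap r
  | add a b _ _ ha hb => rw [map_add, ha, hb, add_zero]
  | mul a b _ _ ha hb => rw [lap_mul hk, ha, hb, mul_zero, zero_mul, add_zero]

theorem eigenspace_le_positivePart {r : ℝ} (hr : 0 < r) :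
    Module.End.eigenspace lap r ≤ positivePart k D := le_iSup₂_of_le r hr le_rfl

theorem mul_mem_positivePart (hk : 0 < k) {r : ℝ} (hr : 0 ≤ r) {x y : LocalForm k D}
    (hx : lap x = r • x) (hy : y ∈ positivePart k D) :
    x * y ∈ positivePart k D ∧ y * x ∈ positivePart k D := by
  have h : positivePart k D ≤ (positivePart k D).comap (LinearMap.mulLeft ℝ x) ⊓
      (positivePart k D).comap (LinearMap.mulRight ℝ x) := by
    refine iSup₂_le fun s hs y hy => ?_
    rw [Module.End.mem_eigenspace_iff] at hy
    have hrs : 0 < r + s := add_pos_of_nonneg_of_pos hr hs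
    constructor
    · refine eigenspace_le_positivePart hrs (Module.End.mem_eigenspace_iff.2 ?_)
      rw [LinearMap.mulLeft_apply, lap_mul hk, hx, hy, mul_smul_comm, smul_mul_assoc, ← add_smul,
        add_comm]
    · refine eigenspace_le_positivePart hrs (Module.End.mem_eigenspace_iff.2 ?_)
      rw [LinearMap.mulRight_apply, lap_mul hk, hx, hy, mul_smul_comm, smul_mul_assoc, ← add_smul]
  exact h hy

theorem mem_zeroModeAlgebra_sup (hk : 0 < k) (a : LocalForm k D) :
    a ∈ Subalgebra.toSubmodule (zeroModeAlgebra hk D) ⊔ positivePart k D := by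
  induction a using LocalForm.induction with
  | halg r => exact Submodule.mem_sup_left ((zeroModeAlgebra hk D).algebraMap_mem r)
  | hgen x =>
    refine (iSup₂_le fun r hr => ?_ : (⨆ r ∈ Set.Ici (0 : ℝ), modes hk D r) ≤ _)
      (gen_mem_modes hk x)
    rcases (Set.mem_Ici.1 hr).eq_or_lt with h | h
    · rw [← h, modes_zero, Submodule.span_le]
      exact fun z hz => Submodule.mem_sup_left (Algebra.subset_adjoin hz)
    · exact (modes_le hk r).trans ((eigenspace_le_positivePart h).trans le_sup_right)
  | hadd a b ha hb => exact add_mem ha hb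
  | hmul a b ha hb =>
    obtain ⟨a0, ha0, a1, ha1, rfl⟩ := Submodule.mem_sup.1 ha
    obtain ⟨b0, hb0, b1, hb1, rfl⟩ := Submodule.mem_sup.1 hb
    have la : lap a0 = (0 : ℝ) • a0 := by rw [lap_zeroModeAlgebra hk ha0, zero_smul]
    have lb : lap b0 = (0 : ℝ) • b0 := by rw [lap_zeroModeAlgebra hk hb0, zero_smul]
    have h11 : a1 * b1 ∈ positivePart k D := by
      refine (iSup₂_le fun r hr y hy => ?_ : positivePart k D ≤
        (positivePart k D).comap (LinearMap.mulRight ℝ b1)) ha1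
      exact (mul_mem_positivePart hk (Set.mem_Ioi.1 hr).le
        (Module.End.mem_eigenspace_iff.1 hy) hb1).1
    have : (a0 + a1) * (b0 + b1) = a0 * b0 + (a0 * b1 + a1 * b0 + a1 * b1) := by noncomm_ring
    rw [this]
    exact Submodule.add_mem_sup ((zeroModeAlgebra hk D).mul_mem ha0 hb0)
      (add_mem (add_mem (mul_mem_positivePart hk le_rfl la hb1).1
        (mul_mem_positivePart hk le_rfl lb ha1).2) h11)

theorem eq_zero_of_mem_positivePart {a : LocalForm k D} (h0 : lap a = 0)
    (ha : a ∈ positivePart k D) : a = 0 := by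
  have h := (Module.End.eigenspaces_iSupIndep (lap (k := k) (D := D)) 0)
  refine Submodule.disjoint_def.1 h a ?_ ?_
  · rw [Module.End.mem_eigenspace_iff, h0, zero_smul]
  · refine (iSup₂_le fun r hr => ?_ : positivePart k D ≤ _) ha
    exact le_iSup₂_of_le r (ne_of_gt hr) le_rfl

theorem gamma_mem_positivePart (hk : 0 < k) {a : LocalForm k D} (ha : a ∈ positivePart k D) :
    gamma a ∈ positivePart k D := by
  refine (iSup₂_le fun r hr y hy => ?_ : positivePart k D ≤ (positivePart k D).comap gamma) ha
  refine eigenspace_le_positivePart hr (Module.End.mem_eigenspace_iff.2 ?_)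
  rw [← gamma_lap hk, Module.End.mem_eigenspace_iff.1 hy, map_smul]

/-- Every cocycle is cohomologous to a polynomial in the zero modes. -/
theorem exists_zeroModeAlgebra_add_gamma (hk : 0 < k) {a : LocalForm k D} (ha : gamma a = 0) :
    ∃ a0 ∈ zeroModeAlgebra hk D, ∃ b, a = a0 + gamma b := by
  obtain ⟨a0, ha0, a1, ha1, rfl⟩ := Submodule.mem_sup.1 (mem_zeroModeAlgebra_sup hk a)
  -- the Laplacian is invertible on the positive part
  have h : positivePart k D ≤ (positivePart k D).map lap := by
    refine iSup₂_le fun r hr y hy => ?_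
    refine ⟨r⁻¹ • y, Submodule.smul_mem _ _ (eigenspace_le_positivePart hr hy), ?_⟩
    rw [map_smul, Module.End.mem_eigenspace_iff.1 hy, smul_smul, inv_mul_cancel₀ (ne_of_gt hr),
      one_smul]
  obtain ⟨c, hc, rfl⟩ := h ha1
  have hc0 : gamma c = 0 := by
    refine eq_zero_of_mem_positivePart ?_ (gamma_mem_positivePart hk hc)
    rwa [map_add, gamma_zeroModeAlgebra hk ha0, zero_add, gamma_lap hk] at ha
  exact ⟨a0, ha0, htpy c, by rw [lap_apply, hc0, map_zero, add_zero]⟩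

/-- A polynomial in the zero modes is exact only if it vanishes. -/
theorem eq_zero_of_zeroModeAlgebra_of_exact (hk : 0 < k) {a b : LocalForm k D}
    (ha : a ∈ zeroModeAlgebra hk D) (hab : a = gamma b) : a = 0 := by
  obtain ⟨b0, hb0, b1, hb1, rfl⟩ := Submodule.mem_sup.1 (mem_zeroModeAlgebra_sup hk b)
  refine eq_zero_of_mem_positivePart (lap_zeroModeAlgebra hk ha) ?_
  rw [hab, map_add, gamma_zeroModeAlgebra hk hb0, zero_add]
  exact gamma_mem_positivePart hk hb1

end

section

variable {k D : ℕ}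

/-! ### The three gradings -/

/-- Pure ghost number, antighost number and form degree of a generator. -/
def Gen.deg (x : Gen k D) : ℕ × ℕ × ℕ := (x.pgh, x.agh, x.formDeg)

/-- The elements of the given pure ghost number, antighost number and form degree. -/
abbrev gradedPart (k D : ℕ) (d : ℕ × ℕ × ℕ) : Submodule ℝ (LocalForm k D) :=
  homogeneousPart k D d.1 d.2.1 d.2.2

theorem sum_map_deg (L : List (Gen k D)) : (L.map Gen.deg).sum =
    ((L.map Gen.pgh).sum, (L.map Gen.agh).sum, (L.map Gen.formDeg).sum) := by
  induction L with
  | nil => rfl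
  | cons x L ih => simp [ih, Gen.deg]

theorem prod_mem_gradedPart (L : List (Gen k D)) :
    (L.map gen).prod ∈ gradedPart k D (L.map Gen.deg).sum := by
  rw [sum_map_deg]
  exact Submodule.subset_span ⟨L, rfl, rfl, rfl, rfl⟩

theorem gradedPart_le {d : ℕ × ℕ × ℕ} {M : Submodule ℝ (LocalForm k D)}
    (h : ∀ L : List (Gen k D), (L.map Gen.deg).sum = d → (L.map gen).prod ∈ M) :
    gradedPart k D d ≤ M := by
  refine Submodule.span_le.2 ?_
  rintro _ ⟨L, h1, h2, h3, rfl⟩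
  exact h L (by rw [sum_map_deg, h1, h2, h3])

theorem gen_mem_gradedPart (x : Gen k D) : gen x ∈ gradedPart k D x.deg := by
  simpa using prod_mem_gradedPart [x]

theorem mul_mem_gradedPart {d d' : ℕ × ℕ × ℕ} {a b : LocalForm k D} (ha : a ∈ gradedPart k D d)
    (hb : b ∈ gradedPart k D d') : a * b ∈ gradedPart k D (d + d') := by
  refine (gradedPart_le fun L hL => ?_ : gradedPart k D d ≤
    (gradedPart k D (d + d')).comap (LinearMap.mulRight ℝ b)) ha
  refine (gradedPart_le fun L' hL' => ?_ : gradedPart k D d' ≤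
    (gradedPart k D (d + d')).comap (LinearMap.mulLeft ℝ (L.map gen).prod)) hb
  have h := prod_mem_gradedPart (L ++ L')
  rw [List.map_append, List.map_append, List.sum_append, List.prod_append, hL, hL'] at h
  exact h

theorem one_mem_gradedPart : (1 : LocalForm k D) ∈ gradedPart k D 0 := by
  simpa using prod_mem_gradedPart (k := k) (D := D) []

theorem fieldSpan_le_gradedPart (l : ℕ) : fieldSpan k D l ≤ gradedPart k D (l, 0, 0) := by
  refine Submodule.span_le.2 ?_
  rintro _ ⟨x, -, h1, h2, h3, rfl⟩
  have h := gen_mem_gradedPart x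
  rwa [Gen.deg, h1, h2, h3] at h

theorem gamma_mem_gradedPart (hk : 0 < k) {d : ℕ × ℕ × ℕ} {a : LocalForm k D}
    (ha : a ∈ gradedPart k D d) : gamma a ∈ gradedPart k D (d + (1, 0, 0)) := by
  refine (gradedPart_le fun L hL => ?_ : gradedPart k D d ≤
    (gradedPart k D (d + (1, 0, 0))).comap gamma) ha
  subst hL
  rw [Submodule.mem_comap]
  clear ha
  induction L using List.reverseRecOn with
  | nil =>
    rw [List.map_nil (f := gen), List.prod_nil, ← map_one (algebraMap ℝ (LocalForm k D)),
      isOddDer_gamma.map_algebraMap]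
    exact zero_mem _
  | append_singleton L x ih =>
    simp only [List.map_append, List.prod_append, List.sum_append, List.map_singleton,
      List.prod_singleton, List.sum_singleton, gamma_mul_gen, gamma_gen]
    refine add_mem ?_ (Submodule.smul_mem _ _ ?_)
    · by_cases hx : x.agh = 0 ∧ x.formDeg = 0
      · have h := mul_mem_gradedPart (prod_mem_gradedPart L)
          (fieldSpan_le_gradedPart _ (gammaGen_mem_fieldSpan hk x))
        have he : ((x.pgh + 1, 0, 0) : ℕ × ℕ × ℕ) = x.deg + (1, 0, 0) := by
          simp [Gen.deg, hx.1, hx.2]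
        rwa [he, ← add_assoc] at h
      · have h0 : gammaGen x = 0 := by
          cases x with
          | dx => rfl
          | tStar => rfl
          | ghostStar => rfl
          | t => exact absurd ⟨rfl, rfl⟩ hx
          | ghost => exact absurd ⟨rfl, rfl⟩ hx
        rw [h0, mul_zero]
        exact zero_mem _
    · have h := mul_mem_gradedPart ih (gen_mem_gradedPart x)
      rwa [add_right_comm] at h

/-- The homomorphism which multiplies each generator by the monomial of its degree. -/
noncomputable def degHom : LocalForm k D →ₐ[ℝ] AddMonoidAlgebra (LocalForm k D) (ℕ × ℕ × ℕ) :=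
  lift (FreeAlgebra.lift ℝ fun x => AddMonoidAlgebra.single x.deg (gen x)) <| by
    have young : ∀ {j : ℕ} {X : (Fin k → Fin D) → (Fin j → Fin D) → Gen k D} (d : ℕ × ℕ × ℕ),
        (∀ μ ν, (X μ ν).deg = d) → (IsYoung fun μ ν => gen (X μ ν)) →
        ∀ z, YoungRel (fun μ ν => FreeAlgebra.ι ℝ (X μ ν)) z →
          FreeAlgebra.lift ℝ (fun x : Gen k D => AddMonoidAlgebra.single x.deg (gen x)) z = 0 := by
      intro j X d hd hX z hz
      refine hz.map_eq_zero (FreeAlgebra.lift ℝ (fun x : Gen k D =>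
        AddMonoidAlgebra.single x.deg (gen x)) : FreeAlgebra ℝ (Gen k D) →+
          AddMonoidAlgebra (LocalForm k D) (ℕ × ℕ × ℕ)) ?_
      have h : IsYoung fun μ ν =>
          AddMonoidAlgebra.singleAddHom d (gen (X μ ν)) := by
        constructor
        · intro a b hab μ ν
          rw [← map_neg, hX.left a b hab]
        · intro a b hab μ ν
          rw [← map_neg, hX.right a b hab]
        · intro h μ ν
          rw [← map_sum, ← hX.bianchi h]
      simpa [hd] using h
    intro u v h
    cases h with
    | comm x y =>
      rw [map_smul, map_mul, map_mul, FreeAlgebra.lift_ι_apply, FreeAlgebra.lift_ι_apply,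
        AddMonoidAlgebra.single_mul_single, AddMonoidAlgebra.single_mul_single, gen_comm x y,
        AddMonoidAlgebra.smul_single, add_comm]
    | t S z hz => rw [map_zero]; exact young (0, 0, 0) (fun _ _ => rfl) (isYoung_t S) _ hz
    | t_symm S μ ν =>
      have h1 : gen (Gen.t S μ ν) = gen (Gen.t S ν μ) := mk_rel (Rel.t_symm S μ ν)
      rw [FreeAlgebra.lift_ι_apply, FreeAlgebra.lift_ι_apply, h1]
      rfl
    | ghost j hj S z hz =>
      rw [map_zero]; exact young (k - j, 0, 0) (fun _ _ => rfl) (isYoung_ghost j hj S) _ hz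
    | tStar S z hz => rw [map_zero]; exact young (0, 1, 0) (fun _ _ => rfl) (isYoung_tStar S) _ hz
    | tStar_symm S μ ν =>
      have h1 : gen (Gen.tStar S μ ν) = gen (Gen.tStar S ν μ) := mk_rel (Rel.tStar_symm S μ ν)
      rw [FreeAlgebra.lift_ι_apply, FreeAlgebra.lift_ι_apply, h1]
      rfl
    | ghostStar j hj S z hz =>
      rw [map_zero]
      exact young (0, k - j + 1, 0) (fun _ _ => rfl) (isYoung_ghostStar j hj S) _ hz

theorem degHom_gen (x : Gen k D) : degHom (gen x) = AddMonoidAlgebra.single x.deg (gen x) := by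
  rw [degHom, gen, lift_mk, FreeAlgebra.lift_ι_apply]
  rfl

theorem degHom_prod (L : List (Gen k D)) : degHom (L.map gen).prod =
    AddMonoidAlgebra.single (L.map Gen.deg).sum (L.map gen).prod := by
  induction L with
  | nil => simp [AddMonoidAlgebra.one_def]
  | cons x L ih =>
    rw [List.map_cons, List.prod_cons, map_mul, ih, degHom_gen,
      AddMonoidAlgebra.single_mul_single, List.map_cons, List.sum_cons]

/-- The projection onto the elements of degree `d`. -/
noncomputable def degProj (d : ℕ × ℕ × ℕ) : LocalForm k D →ₗ[ℝ] LocalForm k D where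
  toFun a := (degHom a).coeff d
  map_add' a b := by simp
  map_smul' r a := by simp

theorem degProj_apply_of_mem {d : ℕ × ℕ × ℕ} (d' : ℕ × ℕ × ℕ) {a : LocalForm k D}
    (ha : a ∈ gradedPart k D d) : degProj d' a = if d = d' then a else 0 := by
  have h : gradedPart k D d ≤
      LinearMap.eqLocus (degProj d') (if d = d' then LinearMap.id else 0) := by
    refine gradedPart_le fun L hL => ?_
    rw [LinearMap.mem_eqLocus]
    change (degHom (L.map gen).prod).coeff d' = _
    rw [degHom_prod, hL, AddMonoidAlgebra.coeff_single, Finsupp.single_apply]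
    split_ifs <;> rfl
  have h1 := LinearMap.mem_eqLocus.1 (h ha)
  rw [h1]
  split_ifs <;> rfl

theorem degProj_self {d : ℕ × ℕ × ℕ} {a : LocalForm k D} (ha : a ∈ gradedPart k D d) :
    degProj d a = a := by rw [degProj_apply_of_mem d ha, if_pos rfl]

theorem iSup_gradedPart (k D : ℕ) : ⨆ d, gradedPart k D d = ⊤ := by
  refine eq_top_iff.2 fun a _ => ?_
  have h : Submodule.span ℝ (Set.range fun L : List (Gen k D) => (L.map gen).prod) ≤
      ⨆ d, gradedPart k D d := by
    rw [Submodule.span_le]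
    rintro _ ⟨L, rfl⟩
    exact Submodule.mem_iSup_of_mem _ (prod_mem_gradedPart L)
  refine h ?_
  induction a using LocalForm.induction with
  | halg r =>
    rw [Algebra.algebraMap_eq_smul_one]
    exact Submodule.smul_mem _ _ (Submodule.subset_span ⟨[], rfl⟩)
  | hgen x => exact Submodule.subset_span ⟨[x], by simp⟩
  | hadd a b ha hb => exact add_mem (ha trivial) (hb trivial)
  | hmul a b ha hb =>
    have := Submodule.mul_mem_mul (ha trivial) (hb trivial)
    rw [Submodule.span_mul_span] at this
    refine Submodule.span_mono ?_ this
    rintro _ ⟨_, ⟨L, rfl⟩, _, ⟨L', rfl⟩, rfl⟩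
    exact ⟨L ++ L', by simp⟩

theorem degProj_gamma (hk : 0 < k) (d : ℕ × ℕ × ℕ) (a : LocalForm k D) :
    degProj (d + (1, 0, 0)) (gamma a) = gamma (degProj d a) := by
  have h : (⊤ : Submodule ℝ (LocalForm k D)) ≤
      LinearMap.eqLocus (degProj (d + (1, 0, 0)) ∘ₗ gamma) (gamma ∘ₗ degProj d) := by
    rw [← iSup_gradedPart]
    refine iSup_le fun d' a ha => ?_
    rw [LinearMap.mem_eqLocus, LinearMap.comp_apply, LinearMap.comp_apply,
      degProj_apply_of_mem _ ha, degProj_apply_of_mem _ (gamma_mem_gradedPart hk ha)]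
    simp only [add_left_inj]
    split_ifs
    · rfl
    · rw [map_zero]
  exact LinearMap.mem_eqLocus.1 (h trivial)

theorem degProj_gamma_mem_range (hk : 0 < k) (d : ℕ × ℕ × ℕ) (b : LocalForm k D) :
    degProj d (gamma b) ∈ LinearMap.range (gamma (k := k) (D := D)) := by
  have h : (⊤ : Submodule ℝ (LocalForm k D)) ≤
      (LinearMap.range (gamma (k := k) (D := D))).comap (degProj d ∘ₗ gamma) := by
    rw [← iSup_gradedPart]
    refine iSup_le fun d' a ha => ?_
    rw [Submodule.mem_comap, LinearMap.comp_apply,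
      degProj_apply_of_mem _ (gamma_mem_gradedPart hk ha)]
    split_ifs
    · exact ⟨a, rfl⟩
    · exact zero_mem _
  exact h trivial

/-- An exact element has no component of pure ghost number zero. -/
theorem degProj_zero_gamma (hk : 0 < k) (j p : ℕ) (b : LocalForm k D) :
    degProj (0, j, p) (gamma b) = 0 := by
  have h : (⊤ : Submodule ℝ (LocalForm k D)) ≤
      LinearMap.ker (degProj (0, j, p) ∘ₗ gamma) := by
    rw [← iSup_gradedPart]
    refine iSup_le fun d' a ha => ?_
    rw [LinearMap.mem_ker, LinearMap.comp_apply,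
      degProj_apply_of_mem _ (gamma_mem_gradedPart hk ha), if_neg]
    intro h
    have := congr_arg Prod.fst h
    simp at this
  exact LinearMap.mem_ker.1 (h trivial)

theorem pghPart_le (l : ℕ) : pghPart k D l ≤ ⨆ jp : ℕ × ℕ, gradedPart k D (l, jp) := by
  refine Submodule.span_le.2 ?_
  rintro _ ⟨L, h, rfl⟩
  refine Submodule.mem_iSup_of_mem ((L.map Gen.agh).sum, (L.map Gen.formDeg).sum) ?_
  exact Submodule.subset_span ⟨L, h, rfl, rfl, rfl⟩

theorem homogeneousPart_le_pghPart (l j p : ℕ) : homogeneousPart k D l j p ≤ pghPart k D l := by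
  refine Submodule.span_le.2 ?_
  rintro _ ⟨L, h, -, -, rfl⟩
  exact Submodule.subset_span ⟨L, h, rfl⟩

end

section

variable {k D : ℕ}

/-! ### Polynomials in the zero modes -/

theorem topGens_le_fieldSpan (hk : 0 < k) {t : LocalForm k D} (ht : t ∈ topGens hk D) :
    t ∈ fieldSpan k D k := by
  have h : ∀ S μ, gen (.ghost 0 hk S μ Fin.elim0) ∈ fieldSpan k D k := fun S μ =>
    Submodule.subset_span ⟨_, rfl, rfl, rfl, rfl, rfl⟩
  rcases ht with ⟨μ, rfl⟩ | ⟨μ, rfl⟩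
  · exact h _ _
  · exact sum_mem fun i _ => zsmul_mem (h _ _) _

theorem curvature_mem_fieldSpan (S : Multiset (Fin D)) (μ ν : Fin (k + 1) → Fin D) :
    curvature S μ ν ∈ fieldSpan k D 0 := by
  refine sum_mem fun i _ => sum_mem fun l _ => zsmul_mem ?_ _
  exact Submodule.subset_span ⟨_, rfl, rfl, rfl, rfl, rfl⟩

theorem exists_mem_gradedPart_of_mem_invariantGens {z : LocalForm k D}
    (hz : z ∈ invariantGens k D) : ∃ jp : ℕ × ℕ, z ∈ gradedPart k D (0, jp) := by
  rcases hz with ((⟨ρ, rfl⟩ | ⟨S, μ, ν, rfl⟩) | ⟨j, hj, S, μ, ν, rfl⟩) | ⟨S, μ, ν, rfl⟩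
  · exact ⟨_, gen_mem_gradedPart (.dx ρ)⟩
  · exact ⟨_, gen_mem_gradedPart (.tStar S μ ν)⟩
  · exact ⟨_, gen_mem_gradedPart (.ghostStar j hj S μ ν)⟩
  · exact ⟨_, fieldSpan_le_gradedPart 0 (curvature_mem_fieldSpan S μ ν)⟩

/-- Generators of pure ghost number zero can be moved through the top ghosts. -/
theorem exists_topGens_mul_invariantGens (hk : 0 < k) {t z : LocalForm k D} (ht : t ∈ topGens hk D)
    (hz : z ∈ invariantGens k D) : ∃ c : ℝ, t * z = c • (z * t) := by
  have ht' := topGens_le_fieldSpan hk ht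
  have h : ∀ y : Gen k D, ∃ c : ℝ, t * gen y = c • (gen y * t) := fun y =>
    ⟨(-1) ^ (y.parity * k), by
      rw [gen_mul_fieldSpan y ht', smul_smul, ← mul_pow, neg_one_mul, neg_neg, one_pow, one_smul]⟩
  rcases hz with ((⟨ρ, rfl⟩ | ⟨S, μ, ν, rfl⟩) | ⟨j, hj, S, μ, ν, rfl⟩) | ⟨S, μ, ν, rfl⟩
  · exact h _
  · exact h _
  · exact h _
  · refine ⟨1, ?_⟩
    have hle : fieldSpan k D 0 ≤
        LinearMap.eqLocus (LinearMap.mulLeft ℝ t) (LinearMap.mulRight ℝ t) := by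
      refine Submodule.span_le.2 ?_
      rintro _ ⟨x, hx, -, -, -, rfl⟩
      change t * gen x = gen x * t
      rw [gen_mul_fieldSpan x ht', hx, zero_mul, pow_zero, one_smul]
    rw [one_smul]
    exact LinearMap.mem_eqLocus.1 (hle (curvature_mem_fieldSpan S μ ν))

theorem mem_invariantPolynomials {z : LocalForm k D} (hz : z ∈ invariantGens k D) :
    z ∈ invariantPolynomials k D := Algebra.subset_adjoin (s := invariantGens k D) hz

/-- The representatives of the cohomology in the degree `d`: sums of products of an invariant
polynomial and a polynomial of degree `m` in the top ghosts and their curls. -/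
def repPart (hk : 0 < k) (D : ℕ) (d : ℕ × ℕ × ℕ) : Submodule ℝ (LocalForm k D) :=
  Submodule.span ℝ {z | ∃ m α e, d.1 = k * m ∧ α ∈ invariantPolynomials k D ∧
    α ∈ gradedPart k D (0, d.2) ∧ e ∈ topGhostPolynomials hk D (k * m) ∧
    e ∈ gradedPart k D (k * m, 0, 0) ∧ (m = 0 → e = 1) ∧ z = α * e}

theorem repPart_le_gradedPart (hk : 0 < k) (d : ℕ × ℕ × ℕ) :
    repPart hk D d ≤ gradedPart k D d := by
  refine Submodule.span_le.2 ?_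
  rintro _ ⟨m, α, e, hm, -, hα, -, he, -, rfl⟩
  have h := mul_mem_gradedPart hα he
  rwa [← hm, Prod.mk_add_mk, zero_add, ← Prod.zero_eq_mk, add_zero] at h

/-- A product of zero modes is, up to a sign, a product of invariant generators times a product of
top ghosts and curls. -/
theorem exists_of_mem_closure (hk : 0 < k) {x : LocalForm k D}
    (hx : x ∈ Submonoid.closure (invariantGens k D ∪ topGens hk D)) :
    ∃ (m : ℕ) (jp : ℕ × ℕ) (α e : LocalForm k D), α ∈ invariantPolynomials k D ∧
      α ∈ gradedPart k D (0, jp) ∧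
      e ∈ Algebra.adjoin ℝ (topGens hk D) ∧ e ∈ gradedPart k D (k * m, 0, 0) ∧ (m = 0 → e = 1) ∧
      (∀ z ∈ invariantGens k D, ∃ c : ℝ, e * z = c • (z * e)) ∧ x = α * e := by
  induction hx using Submonoid.closure_induction_right with
  | one =>
    refine ⟨0, 0, 1, 1, one_mem _, one_mem_gradedPart, one_mem _, one_mem_gradedPart, fun _ => rfl,
      fun z _ => ⟨1, by simp⟩, by simp⟩
  | mul_right x _ y hy ih =>
    obtain ⟨m, jp, α, e, hα, hα', he, he', hm, hc, rfl⟩ := ih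
    rcases hy with hy | hy
    · obtain ⟨c, hcy⟩ := hc y hy
      obtain ⟨jp', hjp⟩ := exists_mem_gradedPart_of_mem_invariantGens hy
      have hαy := mul_mem_gradedPart hα' hjp
      rw [Prod.mk_add_mk, add_zero] at hαy
      refine ⟨m, jp + jp', c • (α * y), e, Subalgebra.smul_mem _
        ((invariantPolynomials k D).mul_mem hα (mem_invariantPolynomials hy)) c,
        Submodule.smul_mem _ _ hαy, he, he', hm, hc, ?_⟩
      rw [mul_assoc, hcy, mul_smul_comm, smul_mul_assoc, mul_assoc]
    · have hey := mul_mem_gradedPart he'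
        (fieldSpan_le_gradedPart k (topGens_le_fieldSpan hk hy))
      rw [Prod.mk_add_mk, ← mul_add_one, Prod.mk_add_mk, add_zero] at hey
      refine ⟨m + 1, jp, α, e * y, hα, hα', Subalgebra.mul_mem _ he (Algebra.subset_adjoin hy),
        hey, fun h => absurd h m.succ_ne_zero, fun z hz => ?_, mul_assoc _ _ _⟩
      obtain ⟨c, hcz⟩ := hc z hz
      obtain ⟨c', hcz'⟩ := exists_topGens_mul_invariantGens hk hy hz
      refine ⟨c' * c, ?_⟩
      rw [mul_assoc, hcz', mul_smul_comm, ← mul_assoc, hcz, smul_mul_assoc, smul_smul, mul_assoc]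

theorem zeroModeAlgebra_le (hk : 0 < k) (D : ℕ) :
    Subalgebra.toSubmodule (zeroModeAlgebra hk D) ≤ ⨆ d, repPart hk D d := by
  rw [zeroModeAlgebra, Algebra.adjoin_eq_span, Submodule.span_le]
  intro x hx
  obtain ⟨m, jp, α, e, hα, hα', he, he', hm, -, rfl⟩ := exists_of_mem_closure hk hx
  refine Submodule.mem_iSup_of_mem (k * m, jp) (Submodule.subset_span ?_)
  exact ⟨m, α, e, rfl, hα, hα', ⟨he, homogeneousPart_le_pghPart _ _ _ he'⟩, he', hm, rfl⟩

theorem degProj_mem_repPart (hk : 0 < k) (d : ℕ × ℕ × ℕ) {a : LocalForm k D}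
    (ha : a ∈ zeroModeAlgebra hk D) : degProj d a ∈ repPart hk D d := by
  refine (iSup_le fun d' a ha => ?_ : ⨆ d', repPart hk D d' ≤ (repPart hk D d).comap (degProj d))
    (zeroModeAlgebra_le hk D ha)
  rw [Submodule.mem_comap, degProj_apply_of_mem d (repPart_le_gradedPart hk d' ha)]
  split_ifs with h
  · exact h ▸ ha
  · exact zero_mem _

/-- A cocycle of definite degree is cohomologous to a representative of this degree. -/
theorem exists_repPart_add_gamma (hk : 0 < k) {d : ℕ × ℕ × ℕ} {a : LocalForm k D}
    (had : a ∈ gradedPart k D d) (ha : gamma a = 0) :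
    ∃ a0 ∈ repPart hk D d, ∃ b, a = a0 + gamma b := by
  obtain ⟨a0, ha0, b, hab⟩ := exists_zeroModeAlgebra_add_gamma hk ha
  obtain ⟨c, hc⟩ := degProj_gamma_mem_range hk d b
  refine ⟨degProj d a0, degProj_mem_repPart hk d ha0, c, ?_⟩
  rw [hc, ← map_add, ← hab, degProj_self had]

/-! ### The cohomology of the exterior longitudinal derivative -/

theorem repPart_eq_bot (hk : 0 < k) {d : ℕ × ℕ × ℕ} (hd : ∀ l, d.1 ≠ k * l) :
    repPart hk D d = ⊥ := by
  refine Submodule.span_eq_bot.2 ?_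
  rintro _ ⟨m, -, -, hm, -⟩
  exact absurd hm (hd m)

/-- The cohomology vanishes in pure ghost numbers which are not multiples of `k`. -/
theorem subsingleton_HGamma (hk : 0 < k) {l' : ℕ} (hl : ∀ l, l' ≠ k * l) :
    Subsingleton (HGamma k D l') := by
  rw [Submodule.Quotient.subsingleton_iff, eq_top_iff]
  rintro ⟨a, ha, hap⟩ -
  obtain ⟨f, hfm, hf⟩ := (Submodule.mem_iSup_iff_exists_finsupp _ a).1 (pghPart_le l' hap)
  -- the components of a cocycle are cocycles
  have h : ∀ jp : ℕ × ℕ, degProj (l', jp) a = f jp := by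
    intro jp
    have h1 : ∀ jp', degProj (l', jp) (f jp') = if jp' = jp then f jp else 0 := by
      intro jp'
      rw [degProj_apply_of_mem _ (hfm jp')]
      simp only [Prod.mk.injEq, true_and]
      split_ifs with h
      · rw [h]
      · rfl
    rw [← hf, Finsupp.sum, map_sum]
    simp only [h1, Finset.sum_ite_eq']
    split_ifs with h2
    · rfl
    · exact (Finsupp.notMem_support_iff.1 h2).symm
  replace ha : gamma a = 0 := ha
  change a ∈ LinearMap.range gamma
  rw [← hf]
  refine sum_mem fun jp _ => ?_
  have h1 : gamma (f jp) = 0 := by rw [← h, ← degProj_gamma hk, ha, map_zero]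
  obtain ⟨a0, ha0, b, hab⟩ := exists_repPart_add_gamma hk (hfm jp) h1
  rw [repPart_eq_bot hk hl, Submodule.mem_bot] at ha0
  rw [ha0, zero_add] at hab
  exact ⟨b, hab.symm⟩

theorem invariantPolynomials_le (hk : 0 < k) :
    invariantPolynomials k D ≤ zeroModeAlgebra hk D :=
  Algebra.adjoin_mono Set.subset_union_left

theorem topGhostPolynomials_le (hk : 0 < k) (l : ℕ) :
    topGhostPolynomials hk D l ≤ Subalgebra.toSubmodule (zeroModeAlgebra hk D) :=
  inf_le_left.trans (Algebra.adjoin_mono Set.subset_union_right)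

theorem repPart_zero_le (hk : 0 < k) (j p : ℕ) :
    repPart hk D (0, j, p) ≤ Subalgebra.toSubmodule (invariantPolynomials k D) := by
  refine Submodule.span_le.2 ?_
  rintro _ ⟨m, α, e, hm, hα, -, -, -, he, rfl⟩
  have hm0 : m = 0 := (Nat.mul_eq_zero.1 hm.symm).resolve_left hk.ne'
  rw [he hm0, mul_one]
  exact hα

theorem gamma_eq_zero_iff_mem_invariantPolynomials (hk : 0 < k) {j p : ℕ} {a : LocalForm k D}
    (had : a ∈ gradedPart k D (0, j, p)) : gamma a = 0 ↔ a ∈ invariantPolynomials k D := by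
  refine ⟨fun ha => ?_, fun ha => gamma_zeroModeAlgebra hk (invariantPolynomials_le hk ha)⟩
  obtain ⟨a0, ha0, b, hab⟩ := exists_repPart_add_gamma hk had ha
  have h0 : degProj (0, j, p) a = degProj (0, j, p) a0 := by
    rw [hab, map_add, degProj_zero_gamma hk, add_zero]
  rw [degProj_self had, degProj_self (repPart_le_gradedPart hk _ ha0)] at h0
  rw [h0]
  exact repPart_zero_le hk j p ha0

/-- The representatives of pure ghost number `k l` are expanded in a basis of the polynomials in
the top ghosts and their curls. -/
theorem exists_finsupp_of_mem_repPart (hk : 0 < k) {l j p : ℕ} {J : Type}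
    (e : Module.Basis J ℝ (topGhostPolynomials hk D (k * l))) {a : LocalForm k D}
    (ha : a ∈ repPart hk D (k * l, j, p)) :
    ∃ α : J →₀ LocalForm k D,
      (∀ i, α i ∈ invariantPolynomials k D ∧ α i ∈ homogeneousPart k D 0 j p) ∧
      a = α.sum fun i c => c * (e i : LocalForm k D) := by
  induction ha using Submodule.span_induction with
  | mem z hz =>
    obtain ⟨m, α, x, hm, hα, hα', hx, -, -, rfl⟩ := hz
    obtain rfl : l = m := Nat.eq_of_mul_eq_mul_left hk hm
    refine ⟨(e.repr ⟨x, hx⟩).mapRange (fun r => r • α) (zero_smul _ _), fun i => ?_, ?_⟩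
    · rw [Finsupp.mapRange_apply]
      exact ⟨Subalgebra.smul_mem _ hα _, Submodule.smul_mem _ _ hα'⟩
    · rw [Finsupp.sum_mapRange_index (fun i => zero_mul _)]
      have h := congr_arg (Submodule.subtype _) (e.linearCombination_repr ⟨x, hx⟩)
      rw [Finsupp.linearCombination_apply, map_finsuppSum] at h
      change _ = x at h
      conv_lhs => rw [← h]
      rw [Finsupp.mul_sum]
      refine Finsupp.sum_congr fun i _ => ?_
      rw [map_smul, mul_smul_comm, smul_mul_assoc]
      rfl
  | zero => exact ⟨0, fun i => ⟨zero_mem _, zero_mem _⟩, by simp⟩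
  | add a b _ _ ha hb =>
    obtain ⟨α, hα, rfl⟩ := ha
    obtain ⟨β, hβ, rfl⟩ := hb
    refine ⟨α + β, fun i => ⟨add_mem (hα i).1 (hβ i).1, add_mem (hα i).2 (hβ i).2⟩, ?_⟩
    rw [Finsupp.sum_add_index' (fun i => zero_mul _) fun i a b => add_mul a b _]
  | smul r a _ ha =>
    obtain ⟨α, hα, rfl⟩ := ha
    refine ⟨r • α, fun i => ⟨Subalgebra.smul_mem _ (hα i).1 r,
      Submodule.smul_mem _ r (hα i).2⟩, ?_⟩
    rw [Finsupp.sum_smul_index' (fun i => zero_mul _), Finsupp.smul_sum]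
    simp only [smul_mul_assoc]

theorem sum_mul_mem_zeroModeAlgebra (hk : 0 < k) {l : ℕ} {J : Type}
    (e : J → topGhostPolynomials hk D l) (α : J →₀ LocalForm k D)
    (hα : ∀ i, α i ∈ invariantPolynomials k D) :
    (α.sum fun i c => c * (e i : LocalForm k D)) ∈ zeroModeAlgebra hk D :=
  sum_mem fun i _ => mul_mem (invariantPolynomials_le hk (hα i))
    (topGhostPolynomials_le hk l (e i).2)

end

end MixedBRST

theorem mainTheorem3 (k D : ℕ) (hk : 2 < k) (hD : 2 * k + 1 ≤ D) :
    -- vanishing in pure ghost numbers between 1 and k - 1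
    (∀ l : ℕ, 1 ≤ l → l ≤ k - 1 → Subsingleton (MixedBRST.HGamma k D l)) ∧
    -- vanishing in all pure ghost numbers that are not multiples of k
    (∀ l' : ℕ, (∀ l : ℕ, l' ≠ k * l) → Subsingleton (MixedBRST.HGamma k D l')) ∧
    -- the cocycles of pure ghost number zero are the invariant polynomials
    (∀ j p : ℕ, ∀ a ∈ MixedBRST.homogeneousPart k D 0 j p,
      MixedBRST.gamma a = 0 ↔ a ∈ MixedBRST.invariantPolynomials k D) ∧
    -- the cocycles of pure ghost number k * l > 0
    (∀ l : ℕ, 0 < l → ∀ j p : ℕ, ∀ (J : Type)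
      (e : Module.Basis J ℝ
        (MixedBRST.topGhostPolynomials (by omega : 0 < k) D (k * l))),
      ∀ a ∈ MixedBRST.homogeneousPart k D (k * l) j p,
        (MixedBRST.gamma a = 0 ↔
          ∃ (α : J →₀ MixedBRST.LocalForm k D) (b : MixedBRST.LocalForm k D),
            (∀ i, α i ∈ MixedBRST.invariantPolynomials k D ∧
              α i ∈ MixedBRST.homogeneousPart k D 0 j p) ∧
            a = (α.sum fun i c => c * (e i : MixedBRST.LocalForm k D)) +
              MixedBRST.gamma b)) ∧
    -- the representatives are non-trivial
    (∀ l : ℕ, ∀ (J : Type)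
      (e : Module.Basis J ℝ
        (MixedBRST.topGhostPolynomials (by omega : 0 < k) D (k * l)))
      (α : J →₀ MixedBRST.LocalForm k D),
      (∀ i, α i ∈ MixedBRST.invariantPolynomials k D) →
      (∃ b, (α.sum fun i c => c * (e i : MixedBRST.LocalForm k D)) = MixedBRST.gamma b) →
        (α.sum fun i c => c * (e i : MixedBRST.LocalForm k D)) = 0) := by
  have hk0 : 0 < k := by omega
  refine ⟨fun l h1 h2 => ?_, fun l' hl => MixedBRST.subsingleton_HGamma hk0 hl,
    fun j p a ha => MixedBRST.gamma_eq_zero_iff_mem_invariantPolynomials hk0 ha,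
    fun l _ j p J e a ha => ⟨fun h => ?_, ?_⟩, fun l J e α hα ⟨b, hb⟩ =>
      MixedBRST.eq_zero_of_zeroModeAlgebra_of_exact hk0
        (MixedBRST.sum_mul_mem_zeroModeAlgebra hk0 e α hα) hb⟩
  · refine MixedBRST.subsingleton_HGamma hk0 fun m hm => ?_
    rcases Nat.eq_zero_or_pos m with rfl | hm0
    · omega
    · have := Nat.le_mul_of_pos_right k hm0
      omega
  · obtain ⟨a0, ha0, b, hab⟩ :=
      MixedBRST.exists_repPart_add_gamma hk0 (d := (k * l, j, p)) ha h
    obtain ⟨α, hα, rfl⟩ := MixedBRST.exists_finsupp_of_mem_repPart hk0 e ha0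
    exact ⟨α, b, hα, hab⟩
  · rintro ⟨α, b, hα, rfl⟩
    rw [map_add, MixedBRST.gamma_gamma hk0, add_zero]
    exact MixedBRST.gamma_zeroModeAlgebra hk0
      (MixedBRST.sum_mul_mem_zeroModeAlgebra hk0 e α fun i => (hα i).1)
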